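/- Fix an integer $D\ge 1$. Let $\mathcal S^D$ be the space of real symmetric $D\times D$ matrices with inner product $a\cdot b=\mathrm{tr}(ab)$, and $\mathcal S^D_+$ its cone of positive semidefinite matrices; write $a\ge b$ if $a-b\in\mathcal S^D_+$. Let $\mathcal H=L^2([0,1);\mathcal S^D)$ and let $\mathcal C\subset\mathcal H$ be the cone of (classes of) square-integrable, right-continuous with left limits, increasing paths $\mu:[0,1)\to\mathcal S^D_+$. For a subset $A$ of a Hilbert space, $A^*=\{x:\langle x,y\rangle\ge 0\ \forall y\in A\}$, and a function $g$ on a set $B$ is $A^*$-increasing if $g(x)\ge g(x')$ whenever $x,x'\in B$ and $x-x'\in A^*$. $\|\cdot\|_{\mathrm{Lip}}\in[0,\infty]$ denotes the best Lipschitz constant. For a partition $j=(0=t_0<t_1<\dots<t_n=1)$, $|j|=n$, let $\mathcal H^j=(\mathcal S^D)^{n}$ with $\langle x,y\rangle=\sum_k (t_k-t_{k-1})\,x_k\cdot y_k$, $\mathcal C^j=\{x:0\le x_1\le\dots\le x_{n}\}$, $\mathrm p_j\iota=\big(\frac1{t_k-t_{k-1}}\int_{t_{k-1}}^{t_k}\iota\big)_k$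 for $\iota\in\mathcal H$, and $\mathrm l_jx=\sum_k x_k\mathbf 1_{[t_{k-1},t_k)}$. A collection $\mathfrak J$ of partitions is good if its members are uniform partitions ($t_k=k/n$), it is directed under inclusion of the sets of partition points, and the $\sigma$-algebras generated by the cells $[t_{k-1},t_k)$ of its members together generate the Borel $\sigma$-algebra of $[0,1)$. Let $H:\mathcal H\to\mathbb R$ be locally Lipschitz and $\mathcal C^*$-increasing, and let $\psi:\mathcal C\to\mathbb R$ be $\mathcal C^*$-increasing and satisfy, for some $C>0$ and $p\in[1,2)$, $|\psi(\mu)-\psi(\nu)|\le C|\mu-\nu|_{L^p}$ for all $\mu,\nu\in\mathcal C$. For a partition $j$ let $f_j:[0,\infty)\times\mathcal C^j\to\mathbb R$ denote the viscosity solution of $\partial_tf=H(\mathrm l_j\nabla f)$ on $[0,\infty)\times\mathcal C^j$ with $f_j(0,\cdot)=\psi\circ\mathrm l_j$, in the class of functions $f$ such that $\sup_{t\ge0}\|f(t,\cdot)\|_{\mathrm{Lip}}<\infty$, $\sup_{t>0,x}|f(t,x)-f(0,x)|/t<\infty$, and every $f(t,\cdot)$ is $(\mathcal C^j)^*$-increasing.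 (Here sub- and supersolutions are continuous functions tested, at every point of $(0,\infty)\times\mathcal C^j$ including boundary points, by functions on $(0,\infty)\times\mathcal C^j$ that have a first-order expansion with quadratic error at every point and a continuous differential; extrema are local relative to $(0,\infty)\times\mathcal C^j$.) Then: (1) For every good collection $\mathfrak J$, the net of lifts $(t,\mu)\mapsto f_j(t,\mathrm p_j\mu)$, $j\in\mathfrak J$, converges, uniformly on every closed ball of $[0,\infty)\times\mathcal C$ of finite radius, to a Lipschitz function $f:[0,\infty)\times\mathcal C\to\mathbb R$ with $f(0,\cdot)=\psi$, $$\sup_{t\ge0}\|f(t,\cdot)\|_{\mathrm{Lip}}\le\|\psi\|_{\mathrm{Lip}},\qquad \sup_{\mu\in\mathcal C}\|f(\cdot,\mu)\|_{\mathrm{Lip}}\le\sup_{\iota\in\mathcal H,\ |\iota|\le\|\psi\|_{\mathrm{Lip}}}|H(\iota)|,$$ the Lipschitz constants of $\psi$ and $f(t,\cdot)$ being taken with respect to the norm of $\mathcal H$. (2) There is a constant $K$, depending only on $D,H,\psi,p,C$, such that for all uniform partitions $j\subset j'$, $$|f_j(t,\mathrm p_j\mathrm l_{j'}x)-f_{j'}(t,x)|\le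 K\,|j|^{-\frac{2-p}{2p}}\,(t+|x|_{\mathcal H^{j'}})\qquad\text{for all }t\ge0,\ x\in\mathcal C^{j'}.$$ -/

import Mathlib

open MeasureTheory Filter Topology Set
open scoped ENNReal NNReal

/-! ### Monotonicity along a cone and Lipschitz constants -/

/-- `g` is `K`-increasing over `A`: `g x' ≤ g x` whenever `x, x' ∈ A` and `x - x' ∈ K`. -/
def ConeIncreasingOn {E : Type*} [AddCommGroup E] (K A : Set E) (g : E → ℝ) : Prop :=
  ∀ x ∈ A, ∀ x' ∈ A, x - x' ∈ K → g x' ≤ g x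

/-- The dual cone `{x | ⟨x, y⟩ ≥ 0 for all y ∈ A}`. -/
def dualCone {E : Type*} [NormedAddCommGroup E] [InnerProductSpace ℝ E] (A : Set E) : Set E :=
  {x | ∀ y ∈ A, 0 ≤ inner ℝ x y}

/-- The best Lipschitz constant of `g` over `A`, as an element of `[0, ∞]`
(pairs `x = y` contribute `0 / 0 = 0`). -/
noncomputable def lipConst {E : Type*} [PseudoEMetricSpace E] (A : Set E) (g : E → ℝ) : ℝ≥0∞ :=
  ⨆ x ∈ A, ⨆ y ∈ A, edist (g x) (g y) / edist x y

/-! ### Viscosity solutions of `∂ₜ f = H (∇ f)` on `[0, ∞) × A` -/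

section Viscosity

variable {E : Type*} [NormedAddCommGroup E] [InnerProductSpace ℝ E]

/-- `φ` is a smooth test function on `(0, ∞) × A` with time derivative `a` and gradient `g`:
the first order expansion of `φ` holds at every point with an error
`O(|s - t|² + |y - x|²)`, along `(0, ∞) × A`, and `a`, `g` are continuous.
(The differential is unique as soon as `A` is a closed convex cone whose span is dense.) -/
structure IsSmoothTest (A : Set E) (φ : ℝ × E → ℝ) (a : ℝ × E → ℝ) (g : ℝ × E → E) : Prop where
  expansion : ∀ z ∈ Ioi (0 : ℝ) ×ˢ A,
    (fun w : ℝ × E => φ w - φ z - (a z * (w.1 - z.1) + inner ℝ (g z) (w.2 - z.2)))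
      =O[𝓝[Ioi (0 : ℝ) ×ˢ A] z] (fun w : ℝ × E => |w.1 - z.1| ^ 2 + ‖w.2 - z.2‖ ^ 2)
  continuousOn_time : ContinuousOn a (Ioi (0 : ℝ) ×ˢ A)
  continuousOn_grad : ContinuousOn g (Ioi (0 : ℝ) ×ˢ A)

/-- Viscosity subsolutions of `∂ₜ f - H (∇ f) = 0` on `[0, ∞) × A`. -/
def IsViscositySubsolution (A : Set E) (H : E → ℝ) (f : ℝ → E → ℝ) : Prop :=
  ContinuousOn (fun z : ℝ × E => f z.1 z.2) (Ici (0 : ℝ) ×ˢ A) ∧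
  ∀ z ∈ Ioi (0 : ℝ) ×ˢ A, ∀ (φ : ℝ × E → ℝ) (a : ℝ × E → ℝ) (g : ℝ × E → E),
    IsSmoothTest A φ a g →
    IsLocalMaxOn (fun w : ℝ × E => f w.1 w.2 - φ w) (Ioi (0 : ℝ) ×ˢ A) z →
    a z - H (g z) ≤ 0

/-- Viscosity supersolutions of `∂ₜ f - H (∇ f) = 0` on `[0, ∞) × A`. -/
def IsViscositySupersolution (A : Set E) (H : E → ℝ) (f : ℝ → E → ℝ) : Prop :=
  ContinuousOn (fun z : ℝ × E => f z.1 z.2) (Ici (0 : ℝ) ×ˢ A) ∧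
  ∀ z ∈ Ioi (0 : ℝ) ×ˢ A, ∀ (φ : ℝ × E → ℝ) (a : ℝ × E → ℝ) (g : ℝ × E → E),
    IsSmoothTest A φ a g →
    IsLocalMinOn (fun w : ℝ × E => f w.1 w.2 - φ w) (Ioi (0 : ℝ) ×ˢ A) z →
    0 ≤ a z - H (g z)

/-- Viscosity solutions: both sub- and supersolutions. -/
def IsViscositySolution (A : Set E) (H : E → ℝ) (f : ℝ → E → ℝ) : Prop :=
  IsViscositySubsolution A H f ∧ IsViscositySupersolution A H f

/-- The class in which the Cauchy problem on a cone `A` is uniquely solvable: `f` is Lipschitz in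
space uniformly in time, `|f(t, x) - f(0, x)| / t` is bounded, and every `f(t, ·)` is increasing
along the dual cone of `A`. -/
structure InSolutionClass (A : Set E) (f : ℝ → E → ℝ) : Prop where
  lipschitz_space : ∃ L : ℝ≥0, ∀ t, 0 ≤ t → LipschitzOnWith L (f t) A
  growth_time : ∃ M : ℝ, ∀ t, 0 < t → ∀ x ∈ A, |f t x - f 0 x| / t ≤ M
  increasing : ∀ t, 0 ≤ t → ConeIncreasingOn (dualCone A) A (f t)

/-- `f` is the viscosity solution, in the class above, of the Cauchy problem
`∂ₜ f = H (∇ f)` on `[0, ∞) × A` with `f(0, ·) = ψ` on `A`. -/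
structure IsCauchySolution (A : Set E) (H : E → ℝ) (ψ : E → ℝ) (f : ℝ → E → ℝ) : Prop where
  solution : IsViscositySolution A H f
  initial : ∀ x ∈ A, f 0 x = ψ x
  inClass : InSolutionClass A f

end Viscosity

/-! ### Symmetric matrices -/

/-- Real symmetric `D × D` matrices, as a subspace of the Euclidean space of all `D × D` arrays.
The induced inner product is `a · b = ∑ i k, a i k * b i k = tr (a b)`. -/
def SymMat (D : ℕ) : Submodule ℝ (EuclideanSpace ℝ (Fin D × Fin D)) where
  carrier := {a | ∀ i k, a (i, k) = a (k, i)}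
  add_mem' := by
    intro a b ha hb i k
    simp [ha i k, hb i k]
  zero_mem' := by
    intro i k
    simp
  smul_mem' := by
    intro c a ha i k
    simp [ha i k]

/-- The underlying matrix. -/
def SymMat.toMatrix {D : ℕ} (a : SymMat D) : Matrix (Fin D) (Fin D) ℝ :=
  Matrix.of fun i k => (a : EuclideanSpace ℝ (Fin D × Fin D)) (i, k)

/-- `a ≥ 0` for a symmetric matrix `a`: it is positive semidefinite. -/
def SymMat.IsPSD {D : ℕ} (a : SymMat D) : Prop := (SymMat.toMatrix a).PosSemidef

/-! ### The Hilbert space of paths and its cone of increasing paths -/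

/-- Lebesgue measure on `[0, 1)`. -/
noncomputable abbrev unitMeasure : Measure ℝ := volume.restrict (Ico (0 : ℝ) 1)

/-- The Hilbert space `L²([0, 1); S^D)`. -/
abbrev PathSpace (D : ℕ) : Type := Lp (SymMat D) 2 unitMeasure

/-- The cone of (classes of) square-integrable, right-continuous with left limits, increasing
paths `[0, 1) → S^D₊`. -/
def pathCone (D : ℕ) : Set (PathSpace D) :=
  {ι | ∃ μ : ℝ → SymMat D,
    (∀ s ∈ Ico (0 : ℝ) 1, SymMat.IsPSD (μ s)) ∧
    (∀ s ∈ Ico (0 : ℝ) 1, ∀ t ∈ Ico (0 : ℝ) 1, s ≤ t → SymMat.IsPSD (μ t - μ s)) ∧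
    (∀ t ∈ Ico (0 : ℝ) 1, ContinuousWithinAt μ (Ici t) t) ∧
    (∀ t ∈ Ioo (0 : ℝ) 1, ∃ l, Tendsto μ (𝓝[<] t) (𝓝 l)) ∧
    ⇑ι =ᵐ[unitMeasure] μ}

/-! ### Partitions of `[0, 1)` -/

/-- A partition `0 = t₀ < t₁ < ⋯ < tₙ = 1`. -/
structure UnitPartition where
  n : ℕ
  t : Fin (n + 1) → ℝ
  strictMono : StrictMono t
  zero : t 0 = 0
  one : t (Fin.last n) = 1

namespace UnitPartition

/-- Partitions are ordered by inclusion of their sets of points. -/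
instance : LE UnitPartition := ⟨fun j j' => range j.t ⊆ range j'.t⟩

/-- The `k`-th cell of the partition. -/
def cell (j : UnitPartition) (k : Fin j.n) : Set ℝ := Ico (j.t k.castSucc) (j.t k.succ)

/-- The length of the `k`-th cell. -/
def len (j : UnitPartition) (k : Fin j.n) : ℝ := j.t k.succ - j.t k.castSucc

theorem len_pos (j : UnitPartition) (k : Fin j.n) : 0 < j.len k :=
  sub_pos.2 (j.strictMono Fin.castSucc_lt_succ)

/-- Uniform partitions. -/
def IsUniform (j : UnitPartition) : Prop := ∀ k, j.t k = (k : ℝ) / j.n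

/-- The sigma-algebra on `[0, 1)` generated by the cells of the partition. -/
@[reducible] def sigmaAlgebra (j : UnitPartition) : MeasurableSpace (Ico (0 : ℝ) 1) :=
  MeasurableSpace.generateFrom {s | ∃ k, s = Subtype.val ⁻¹' j.cell k}

/-- A generating collection of partitions: it is directed, and the associated sigma-algebras
generate the Borel sigma-algebra of `[0, 1)`. -/
def IsGenerating (J : Set UnitPartition) : Prop :=
  (∀ j ∈ J, ∀ j' ∈ J, ∃ j'' ∈ J, j ≤ j'' ∧ j' ≤ j'') ∧
  ⨆ j ∈ J, j.sigmaAlgebra = borel (Ico (0 : ℝ) 1)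

/-- A good collection of partitions: a generating collection of uniform partitions. -/
def IsGood (J : Set UnitPartition) : Prop := (∀ j ∈ J, j.IsUniform) ∧ IsGenerating J

/-- Convergence in the local uniform topology over `X` of the net `(g j)`, `j ∈ J`:
uniform convergence on the trace on `X` of every closed ball. -/
def TendstoLocalUniform {E : Type*} [PseudoMetricSpace E] (J : Set UnitPartition) (X : Set E)
    (g : UnitPartition → E → ℝ) (f : E → ℝ) : Prop :=
  ∀ z ∈ X, ∀ r : ℝ, ∀ ε > 0, ∃ j₀ ∈ J, ∀ j ∈ J, j₀ ≤ j →
    ∀ y ∈ X ∩ Metric.closedBall z r, |g j y - f y| ≤ ε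

end UnitPartition

/-! ### The finite-dimensional spaces attached to a partition -/

/-- The space `(S^D)^{|j|}`. -/
def StepSpace (D : ℕ) (j : UnitPartition) : Type := Fin j.n → SymMat D

namespace StepSpace

variable {D : ℕ} {j : UnitPartition}

instance : AddCommGroup (StepSpace D j) := inferInstanceAs (AddCommGroup (Fin j.n → SymMat D))

noncomputable instance : Module ℝ (StepSpace D j) :=
  inferInstanceAs (Module ℝ (Fin j.n → SymMat D))

/-- The coordinates of an element of the step space. -/
def coord (x : StepSpace D j) : Fin j.n → SymMat D := x

theorem coord_add (x y : StepSpace D j) (k : Fin j.n) :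
    (x + y).coord k = x.coord k + y.coord k := rfl

theorem coord_smul (r : ℝ) (x : StepSpace D j) (k : Fin j.n) :
    (r • x).coord k = r • x.coord k := rfl

/-- The inner product `⟨x, y⟩ = ∑ k, (t_k - t_{k-1}) x_k · y_k`. -/
@[reducible] noncomputable def innerCore (D : ℕ) (j : UnitPartition) :
    InnerProductSpace.Core ℝ (StepSpace D j) where
  inner x y := ∑ k, j.len k * inner ℝ (x.coord k) (y.coord k)
  conj_inner_symm x y := by
    simp [real_inner_comm]
  re_inner_nonneg x := by
    simpa using Finset.sum_nonneg fun k _ => mul_nonneg (j.len_pos k).le (sq_nonneg ‖x.coord k‖)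
  add_left x y z := by
    rw [← Finset.sum_add_distrib]
    refine Finset.sum_congr rfl fun k _ => ?_
    rw [coord_add, inner_add_left, mul_add]
  smul_left x y r := by
    rw [Finset.mul_sum]
    refine Finset.sum_congr rfl fun k _ => ?_
    have h : inner ℝ ((r • x).coord k) (y.coord k) = r * inner ℝ (x.coord k) (y.coord k) :=
      real_inner_smul_left (x.coord k) (y.coord k) r
    rw [h, conj_trivial]
    ring
  definite x hx := by
    have h := (Finset.sum_eq_zero_iff_of_nonneg fun k _ =>
      mul_nonneg (j.len_pos k).le (real_inner_self_nonneg (x := x.coord k))).1 hx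
    funext k
    have hk := (mul_eq_zero.1 (h k (Finset.mem_univ k))).resolve_left (j.len_pos k).ne'
    exact inner_self_eq_zero.1 hk

noncomputable instance : NormedAddCommGroup (StepSpace D j) :=
  (innerCore D j).toNormedAddCommGroup

noncomputable instance : InnerProductSpace ℝ (StepSpace D j) :=
  InnerProductSpace.ofCore (innerCore D j).toCore

end StepSpace

/-- The cone `{0 ≤ x₁ ≤ ⋯ ≤ x_{|j|}}` of the step space. -/
def stepCone (D : ℕ) (j : UnitPartition) : Set (StepSpace D j) :=
  {x | (∀ k, SymMat.IsPSD (x.coord k)) ∧ ∀ k l, k ≤ l → SymMat.IsPSD (x.coord l - x.coord k)}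

/-- The projection `p_j`: averages over the cells of the partition. -/
noncomputable def pathProj {D : ℕ} (j : UnitPartition) (ι : PathSpace D) : StepSpace D j :=
  fun k => (j.len k)⁻¹ • ∫ s in j.cell k, ι s

/-- The lift `l_j x = ∑ k, x_k 1_{[t_{k-1}, t_k)}`. -/
noncomputable def pathLift {D : ℕ} (j : UnitPartition) (x : StepSpace D j) : PathSpace D :=
  ∑ k, indicatorConstLp 2 (s := j.cell k) (measurableSet_Ico) (measure_ne_top unitMeasure _)
    (x.coord k)

/-- `f_j` is the solution of the `j`-th approximate problem: the Cauchy problem on the cone of the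
step space with nonlinearity `H ∘ l_j` and initial condition `ψ ∘ l_j`. -/
def IsApproximateSolution {D : ℕ} (H ψ : PathSpace D → ℝ) (j : UnitPartition)
    (f : ℝ → StepSpace D j → ℝ) : Prop :=
  IsCauchySolution (stepCone D j) (fun x => H (pathLift j x)) (fun x => ψ (pathLift j x)) f

/-
Two solutions are compared by doubling variables, penalising with a smoothed `L¹` norm and the `L²`
norm. No boundary condition on the cone is needed: a test function touching a solution from above
or below at a boundary point can be moved into the interior by an arbitrarily small perturbation
along the dual cone, and `H` is increasing along that cone. The comparison transfers every bound
`ψ μ - ψ ν ≤ a |μ - ν|_{L¹} + b |μ - ν|_{L²}` from `ψ` to the solutions, so their gradients are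
increasing paths which satisfy the dual bounds. An increasing path is approximated in `L¹` by its
averages at the rate `n^{-1/2}`, and an `Lᵖ`-Lipschitz `ψ` with `p < 2` admits arbitrarily small
`b`; hence the gradients form a totally bounded set, near which `H` is bounded and uniformly
Lipschitz although it is only locally Lipschitz. Comparing the solutions of two levels then reduces
to the error made by averaging the argument of `ψ`, and interpolating `Lᵖ` between `L¹` and `L²`
turns the rate `n^{-1/2}` into `n^{-(2-p)/(2p)}`. The resulting Cauchy estimate gives the limit.
-/
theorem le_apply_zero_of_eventually {f : ℝ → ℝ} {a : ℝ} (hf : Continuous f)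
    (h : ∀ᶠ ε in 𝓝[>] 0, a ≤ f ε) : a ≤ f 0 :=
  ge_of_tendsto ((hf.tendsto 0).mono_left nhdsWithin_le_nhds) h

/-! ### Functions with a global quadratic expansion -/

section QuadraticExpansion

variable {E : Type*} [NormedAddCommGroup E] [InnerProductSpace ℝ E]
  {G : Type*} [NormedAddCommGroup G] [InnerProductSpace ℝ G]

/-- `φ` has first order expansions with gradient `g` and a quadratic error, uniformly over `E`.
The spatial parts of all test functions below are of this kind. -/
def HasQuadraticExpansion (φ : E → ℝ) (g : E → E) : Prop :=
  ∃ c : ℝ, ∀ x w, |φ w - φ x - inner ℝ (g x) (w - x)| ≤ c * ‖w - x‖ ^ 2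

namespace HasQuadraticExpansion

variable {φ ψ : E → ℝ} {g h : E → E}

theorem exists_nonneg (hφ : HasQuadraticExpansion φ g) :
    ∃ c : ℝ, 0 ≤ c ∧ ∀ x w, |φ w - φ x - inner ℝ (g x) (w - x)| ≤ c * ‖w - x‖ ^ 2 := by
  obtain ⟨c, hc⟩ := hφ
  exact ⟨|c|, abs_nonneg c, fun x w => (hc x w).trans (by gcongr; exact le_abs_self c)⟩

theorem add (hφ : HasQuadraticExpansion φ g) (hψ : HasQuadraticExpansion ψ h) :
    HasQuadraticExpansion (fun x => φ x + ψ x) (fun x => g x + h x) := by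
  obtain ⟨c, hc⟩ := hφ
  obtain ⟨d, hd⟩ := hψ
  refine ⟨c + d, fun x w => ?_⟩
  calc |φ w + ψ w - (φ x + ψ x) - inner ℝ (g x + h x) (w - x)|
      = |(φ w - φ x - inner ℝ (g x) (w - x)) + (ψ w - ψ x - inner ℝ (h x) (w - x))| := by
        rw [inner_add_left]
        congr 1
        ring
    _ ≤ c * ‖w - x‖ ^ 2 + d * ‖w - x‖ ^ 2 := (abs_add_le _ _).trans (add_le_add (hc x w) (hd x w))
    _ = (c + d) * ‖w - x‖ ^ 2 := by ring

theorem const_mul (hφ : HasQuadraticExpansion φ g) (a : ℝ) :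
    HasQuadraticExpansion (fun x => a * φ x) (fun x => a • g x) := by
  obtain ⟨c, hc⟩ := hφ
  refine ⟨|a| * c, fun x w => ?_⟩
  rw [real_inner_smul_left, ← mul_sub, ← mul_sub, abs_mul, mul_assoc]
  exact mul_le_mul_of_nonneg_left (hc x w) (abs_nonneg a)

theorem const (b : ℝ) : HasQuadraticExpansion (fun _ : E => b) (fun _ => 0) :=
  ⟨0, fun x w => by simp⟩

theorem neg (hφ : HasQuadraticExpansion φ g) :
    HasQuadraticExpansion (fun x => -φ x) (fun x => -g x) := by
  simpa only [neg_mul, one_mul, neg_smul, one_smul] using hφ.const_mul (-1)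

theorem congr (hφ : HasQuadraticExpansion φ g) (h1 : ∀ x, ψ x = φ x) (h2 : ∀ x, h x = g x) :
    HasQuadraticExpansion ψ h := by
  obtain rfl : ψ = φ := funext h1
  obtain rfl : h = g := funext h2
  exact hφ

theorem comp_sub_const (hφ : HasQuadraticExpansion φ g) (b : E) :
    HasQuadraticExpansion (fun x => φ (x - b)) (fun x => g (x - b)) := by
  obtain ⟨c, hc⟩ := hφ
  refine ⟨c, fun x w => ?_⟩
  simpa only [sub_sub_sub_cancel_right] using hc (x - b) (w - b)

theorem comp_const_sub_clm {φ : G → ℝ} {g : G → G} (hφ : HasQuadraticExpansion φ g)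
    (p : E →L[ℝ] G) (e : G → E) (hpe : ∀ v w, inner ℝ (e v) w = inner ℝ v (p w)) (b : G) :
    HasQuadraticExpansion (fun y => φ (b - p y)) (fun y => -e (g (b - p y))) := by
  obtain ⟨c, hc0, hc⟩ := hφ.exists_nonneg
  refine ⟨c * ‖p‖ ^ 2, fun x w => ?_⟩
  have hsub : b - p w - (b - p x) = -p (w - x) := by rw [map_sub]; abel
  have h := hc (b - p x) (b - p w)
  rw [hsub, inner_neg_right, norm_neg] at h
  rw [inner_neg_left, hpe, mul_assoc, ← mul_pow]
  exact h.trans (by gcongr; exact p.le_opNorm _)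

theorem inner_grad_sub_le {c : ℝ}
    (hc : ∀ x w, |φ w - φ x - inner ℝ (g x) (w - x)| ≤ c * ‖w - x‖ ^ 2) (x y z : E) :
    inner ℝ (g x - g y) z ≤ c * (‖y + z - x‖ ^ 2 + ‖y - x‖ ^ 2 + ‖z‖ ^ 2) := by
  have hxz := (abs_le.1 (hc x (y + z))).1
  have hxy := (abs_le.1 (hc x y)).2
  have hyz := (abs_le.1 (hc y (y + z))).2
  rw [add_sub_right_comm, inner_add_right, ← add_sub_right_comm] at hxz
  rw [add_sub_cancel_left] at hyz
  rw [inner_sub_left]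
  linarith

theorem norm_grad_sub_le {c : ℝ} (hc0 : 0 ≤ c)
    (hc : ∀ x w, |φ w - φ x - inner ℝ (g x) (w - x)| ≤ c * ‖w - x‖ ^ 2) (x y : E) :
    ‖g x - g y‖ ≤ 6 * c * ‖x - y‖ := by
  rcases eq_or_ne (g x) (g y) with hg | hg
  · rw [hg, sub_self, norm_zero]
    positivity
  have hg0 : 0 < ‖g x - g y‖ := norm_sub_pos_iff.2 hg
  have hxy0 : 0 < ‖x - y‖ := norm_sub_pos_iff.2 fun hxy => hg (hxy ▸ rfl)
  set z := (‖x - y‖ / ‖g x - g y‖) • (g x - g y) with hz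
  have hz_norm : ‖z‖ = ‖x - y‖ := by
    rw [hz, norm_smul, Real.norm_of_nonneg (by positivity), div_mul_cancel₀ _ hg0.ne']
  have hz_inner : inner ℝ (g x - g y) z = ‖x - y‖ * ‖g x - g y‖ := by
    rw [hz, real_inner_smul_right, real_inner_self_eq_norm_sq]
    field_simp
  have hyz : ‖y + z - x‖ ≤ 2 * ‖x - y‖ := by
    calc ‖y + z - x‖ = ‖(y - x) + z‖ := by rw [add_sub_right_comm]
      _ ≤ ‖y - x‖ + ‖z‖ := norm_add_le _ _
      _ = 2 * ‖x - y‖ := by rw [hz_norm, norm_sub_rev y x, two_mul]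
  refine le_of_mul_le_mul_left ?_ hxy0
  calc ‖x - y‖ * ‖g x - g y‖ ≤ c * (‖y + z - x‖ ^ 2 + ‖y - x‖ ^ 2 + ‖z‖ ^ 2) :=
        hz_inner ▸ inner_grad_sub_le hc x y z
    _ ≤ c * ((2 * ‖x - y‖) ^ 2 + ‖x - y‖ ^ 2 + ‖x - y‖ ^ 2) := by
        rw [hz_norm, norm_sub_rev y x]
        gcongr
    _ = ‖x - y‖ * (6 * c * ‖x - y‖) := by ring

theorem continuous_grad (hφ : HasQuadraticExpansion φ g) : Continuous g := by
  obtain ⟨c, hc0, hc⟩ := hφ.exists_nonneg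
  refine (LipschitzWith.of_dist_le_mul (K := ⟨6 * c, by positivity⟩) fun x y => ?_).continuous
  rw [dist_eq_norm, dist_eq_norm]
  exact norm_grad_sub_le hc0 hc x y

theorem norm_sq : HasQuadraticExpansion (fun x : E => ‖x‖ ^ 2) (fun x => (2 : ℝ) • x) := by
  refine ⟨1, fun x w => ?_⟩
  have : ‖w‖ ^ 2 - ‖x‖ ^ 2 - inner ℝ ((2 : ℝ) • x) (w - x) = ‖w - x‖ ^ 2 := by
    rw [real_inner_smul_left, inner_sub_right, norm_sub_sq_real, real_inner_self_eq_norm_sq,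
      real_inner_comm w x]
    ring
  rw [this, one_mul, abs_of_nonneg (by positivity)]

theorem real_quadratic (α β b : ℝ) :
    HasQuadraticExpansion (fun t : ℝ => α * (t - b) ^ 2 + β * t)
      (fun t => 2 * α * (t - b) + β) := by
  refine ⟨|α|, fun t s => ?_⟩
  have : α * (s - b) ^ 2 + β * s - (α * (t - b) ^ 2 + β * t) -
      inner ℝ (2 * α * (t - b) + β) (s - t) = α * (s - t) ^ 2 := by
    rw [real_inner_comm, RCLike.inner_apply, conj_trivial]
    ring
  rw [this, abs_mul, abs_of_nonneg (sq_nonneg (s - t)), Real.norm_eq_abs, sq_abs]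

end HasQuadraticExpansion

end QuadraticExpansion

/-! ### Regularized norms -/

section SoftNorm

/-- The regularization `√(c² + ‖x‖²)` of the norm: unlike the norm it can serve as a test
function at the origin, and it converges to the norm uniformly as `c → 0`. -/
noncomputable def softNorm {V : Type*} [Norm V] (c : ℝ) (x : V) : ℝ := √(c ^ 2 + ‖x‖ ^ 2)

variable {V : Type*} [NormedAddCommGroup V] {c : ℝ}

theorem continuous_softNorm (c : ℝ) : Continuous (softNorm c : V → ℝ) := by
  unfold softNorm
  fun_prop

theorem softNorm_sq (c : ℝ) (x : V) : softNorm c x ^ 2 = c ^ 2 + ‖x‖ ^ 2 :=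
  Real.sq_sqrt (by positivity)

theorem softNorm_pos (hc : 0 < c) (x : V) : 0 < softNorm c x := Real.sqrt_pos.2 (by positivity)

theorem norm_le_softNorm (c : ℝ) (x : V) : ‖x‖ ≤ softNorm c x :=
  Real.le_sqrt_of_sq_le (by linarith [sq_nonneg c])

theorem le_softNorm (c : ℝ) (x : V) : c ≤ softNorm c x :=
  Real.le_sqrt_of_sq_le (by linarith [sq_nonneg ‖x‖])

theorem softNorm_le (hc : 0 ≤ c) (x : V) : softNorm c x ≤ c + ‖x‖ := by
  refine Real.sqrt_le_iff.2 ⟨by positivity, ?_⟩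
  nlinarith [mul_nonneg hc (norm_nonneg x)]

theorem softNorm_zero (hc : 0 ≤ c) : softNorm c (0 : V) = c := by
  rw [softNorm, norm_zero, zero_pow two_ne_zero, add_zero, Real.sqrt_sq hc]

theorem norm_inv_softNorm_smul_le [NormedSpace ℝ V] (hc : 0 < c) (x : V) :
    ‖(softNorm c x)⁻¹ • x‖ ≤ 1 := by
  rw [norm_smul, norm_inv, Real.norm_of_nonneg (softNorm_pos hc x).le,
    inv_mul_le_iff₀ (softNorm_pos hc x), mul_one]
  exact norm_le_softNorm c x

variable [InnerProductSpace ℝ V]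

theorem sq_add_inner_le_softNorm_mul (hc : 0 < c) (x w : V) :
    c ^ 2 + inner ℝ x w ≤ softNorm c x * softNorm c w := by
  have hprod : c ^ 2 + ‖x‖ * ‖w‖ ≤ softNorm c x * softNorm c w := by
    refine (abs_le_of_sq_le_sq' ?_ (mul_pos (softNorm_pos hc x) (softNorm_pos hc w)).le).2
    rw [mul_pow, softNorm_sq, softNorm_sq]
    nlinarith [mul_nonneg (sq_nonneg c) (sq_nonneg (‖x‖ - ‖w‖))]
  linarith [real_inner_le_norm x w]

theorem abs_softNorm_sub_sub_inner_le (hc : 0 < c) (x w : V) :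
    |softNorm c w - softNorm c x - inner ℝ ((softNorm c x)⁻¹ • x) (w - x)| ≤
      c⁻¹ * ‖w - x‖ ^ 2 := by
  have hx := softNorm_pos hc x
  have hxsq := softNorm_sq c x
  have hexact : softNorm c w - softNorm c x - inner ℝ ((softNorm c x)⁻¹ • x) (w - x) =
      (softNorm c x)⁻¹ * (softNorm c x * softNorm c w - c ^ 2 - inner ℝ x w) := by
    rw [real_inner_smul_left, inner_sub_right, real_inner_self_eq_norm_sq]
    field_simp
    linarith
  have hnonneg : 0 ≤ softNorm c x * softNorm c w - c ^ 2 - inner ℝ x w := by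
    linarith [sq_add_inner_le_softNorm_mul hc x w]
  have hle : softNorm c x * softNorm c w - c ^ 2 - inner ℝ x w ≤ ‖w - x‖ ^ 2 := by
    have hwx := norm_sub_sq_real w x
    rw [real_inner_comm x w] at hwx
    nlinarith [sq_nonneg (softNorm c x - softNorm c w), softNorm_sq c w, sq_nonneg ‖w - x‖]
  rw [hexact, abs_of_nonneg (by positivity)]
  gcongr
  exact le_softNorm c x

theorem hasQuadraticExpansion_softNorm (hc : 0 < c) :
    HasQuadraticExpansion (softNorm c : V → ℝ) (fun x => (softNorm c x)⁻¹ • x) :=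
  ⟨c⁻¹, abs_softNorm_sub_sub_inner_le hc⟩

end SoftNorm

/-! ### Squared distance to a convex set -/

section MetricProjection

variable {E : Type*} [NormedAddCommGroup E] [InnerProductSpace ℝ E] {K : Set E} {P : E → E}

/-- `P` is the metric projection onto the closed convex set `K`, through its variational
characterization. -/
structure IsMetricProjection (K : Set E) (P : E → E) : Prop where
  mem : ∀ x, P x ∈ K
  inner_nonpos : ∀ x, ∀ k ∈ K, inner ℝ (x - P x) (k - P x) ≤ 0

theorem exists_isMetricProjection [CompleteSpace E] (hne : K.Nonempty) (hcl : IsClosed K)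
    (hconv : Convex ℝ K) : ∃ P : E → E, IsMetricProjection K P := by
  have h : ∀ x, ∃ v ∈ K, ∀ k ∈ K, inner ℝ (x - v) (k - v) ≤ 0 := fun x => by
    obtain ⟨v, hv, hmin⟩ := exists_norm_eq_iInf_of_complete_convex hne hcl.isComplete hconv x
    exact ⟨v, hv, (norm_eq_iInf_iff_real_inner_le_zero hconv hv).1 hmin⟩
  choose P hP hP' using h
  exact ⟨P, hP, hP'⟩

namespace IsMetricProjection

theorem eq_self (hP : IsMetricProjection K P) {x : E} (hx : x ∈ K) : P x = x :=
  (sub_eq_zero.1 (real_inner_self_nonpos.1 (hP.inner_nonpos x x hx))).symm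

theorem norm_sub_sq_le (hP : IsMetricProjection K P) (x : E) {k : E} (hk : k ∈ K) :
    ‖x - P x‖ ^ 2 ≤ ‖x - k‖ ^ 2 := by
  rw [← sub_sub_sub_cancel_right x k (P x), norm_sub_sq_real (x - P x) (k - P x)]
  nlinarith [hP.inner_nonpos x k hk, sq_nonneg ‖k - P x‖]

theorem inner_sub_sub_nonneg (hP : IsMetricProjection K P) (x w : E) :
    0 ≤ inner ℝ ((w - P w) - (x - P x)) (w - x) := by
  have hx := hP.inner_nonpos x (P w) (hP.mem w)
  have hw := hP.inner_nonpos w (P x) (hP.mem x)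
  rw [← neg_sub (P w) (P x), inner_neg_right] at hw
  have hsplit : w - x = ((w - P w) - (x - P x)) + (P w - P x) := by abel
  rw [hsplit, inner_add_right, real_inner_self_eq_norm_sq, inner_sub_left _ _ (P w - P x)]
  nlinarith [sq_nonneg ‖(w - P w) - (x - P x)‖]

theorem hasQuadraticExpansion_norm_sub_sq (hP : IsMetricProjection K P) :
    HasQuadraticExpansion (fun x => ‖x - P x‖ ^ 2) (fun x => (2 : ℝ) • (x - P x)) := by
  refine ⟨1, fun x w => ?_⟩
  have hup := hP.norm_sub_sq_le w (hP.mem x)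
  rw [show w - P x = (x - P x) + (w - x) by abel, norm_add_sq_real (x - P x) (w - x)] at hup
  have hlow := hP.norm_sub_sq_le x (hP.mem w)
  rw [show x - P w = (w - P w) - (w - x) by abel, norm_sub_sq_real (w - P w) (w - x)] at hlow
  have hmono := hP.inner_sub_sub_nonneg x w
  rw [inner_sub_left] at hmono
  rw [real_inner_smul_left, one_mul, abs_le]
  constructor <;> linarith

end IsMetricProjection

end MetricProjection
/-! ### Smooth test functions and jets -/

section Jets

variable {E : Type*} [NormedAddCommGroup E] [InnerProductSpace ℝ E]

theorem HasQuadraticExpansion.isSmoothTest_add {θ θ' : ℝ → ℝ} {ρ : E → ℝ} {g : E → E}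
    (hθ : HasQuadraticExpansion θ θ') (hρ : HasQuadraticExpansion ρ g) (A : Set E) :
    IsSmoothTest A (fun w => θ w.1 + ρ w.2) (fun w => θ' w.1) (fun w => g w.2) where
  expansion z _ := by
    obtain ⟨c, hc0, hc⟩ := hθ.exists_nonneg
    obtain ⟨d, hd0, hd⟩ := hρ.exists_nonneg
    refine Asymptotics.IsBigO.of_bound (c + d) (Eventually.of_forall fun w => ?_)
    have hsplit : θ w.1 + ρ w.2 - (θ z.1 + ρ z.2) -
        (θ' z.1 * (w.1 - z.1) + inner ℝ (g z.2) (w.2 - z.2)) =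
        (θ w.1 - θ z.1 - inner ℝ (θ' z.1) (w.1 - z.1)) +
          (ρ w.2 - ρ z.2 - inner ℝ (g z.2) (w.2 - z.2)) := by
      rw [real_inner_comm, RCLike.inner_apply, conj_trivial]
      ring
    rw [hsplit, Real.norm_eq_abs, Real.norm_of_nonneg (by positivity)]
    have htime := hc z.1 w.1
    rw [Real.norm_eq_abs] at htime
    refine (abs_add_le _ _).trans ((add_le_add htime (hd z.2 w.2)).trans ?_)
    nlinarith [mul_nonneg hd0 (sq_nonneg |w.1 - z.1|), mul_nonneg hc0 (sq_nonneg ‖w.2 - z.2‖)]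
  continuousOn_time := (hθ.continuous_grad.comp continuous_fst).continuousOn
  continuousOn_grad := (hρ.continuous_grad.comp continuous_snd).continuousOn

namespace IsSmoothTest

variable {A : Set E} {φ φ' : ℝ × E → ℝ} {a a' : ℝ × E → ℝ} {g g' : ℝ × E → E}

theorem add (h : IsSmoothTest A φ a g) (h' : IsSmoothTest A φ' a' g') :
    IsSmoothTest A (fun w => φ w + φ' w) (fun w => a w + a' w) (fun w => g w + g' w) where
  expansion z hz := by
    refine ((h.expansion z hz).add (h'.expansion z hz)).congr_left fun w => ?_
    rw [inner_add_left]
    ring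
  continuousOn_time := h.continuousOn_time.add h'.continuousOn_time
  continuousOn_grad := h.continuousOn_grad.add h'.continuousOn_grad

theorem neg (h : IsSmoothTest A φ a g) :
    IsSmoothTest A (fun w => -φ w) (fun w => -a w) (fun w => -g w) where
  expansion z hz := by
    refine (h.expansion z hz).neg_left.congr_left fun w => ?_
    rw [inner_neg_left]
    ring
  continuousOn_time := h.continuousOn_time.neg
  continuousOn_grad := h.continuousOn_grad.neg

theorem continuousOn (h : IsSmoothTest A φ a g) : ContinuousOn φ (Ioi (0 : ℝ) ×ˢ A) := by
  intro z hz
  have herror : Tendsto (fun w : ℝ × E => |w.1 - z.1| ^ 2 + ‖w.2 - z.2‖ ^ 2)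
      (𝓝[Ioi (0 : ℝ) ×ˢ A] z) (𝓝 0) := by
    have hc : Continuous fun w : ℝ × E => |w.1 - z.1| ^ 2 + ‖w.2 - z.2‖ ^ 2 := by fun_prop
    simpa using (hc.tendsto z).mono_left nhdsWithin_le_nhds
  have haffine : Tendsto (fun w : ℝ × E => a z * (w.1 - z.1) + inner ℝ (g z) (w.2 - z.2) + φ z)
      (𝓝[Ioi (0 : ℝ) ×ˢ A] z) (𝓝 (φ z)) := by
    have hc : Continuous fun w : ℝ × E =>
      a z * (w.1 - z.1) + inner ℝ (g z) (w.2 - z.2) + φ z := by fun_prop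
    simpa using (hc.tendsto z).mono_left nhdsWithin_le_nhds
  have hsum := ((h.expansion z hz).trans_tendsto herror).add haffine
  rw [zero_add] at hsum
  exact hsum.congr fun w => by ring

end IsSmoothTest

/-- The superjet of `u` at `z` relative to `(0, ∞) × A`: the pairs (time derivative, gradient) at
`z` of the smooth test functions touching `u` from above at `z`. -/
def superjet (A : Set E) (u : ℝ → E → ℝ) (z : ℝ × E) : Set (ℝ × E) :=
  {q | ∃ (φ : ℝ × E → ℝ) (a : ℝ × E → ℝ) (g : ℝ × E → E), IsSmoothTest A φ a g ∧
    IsLocalMaxOn (fun w : ℝ × E => u w.1 w.2 - φ w) (Ioi (0 : ℝ) ×ˢ A) z ∧ (a z, g z) = q}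

/-- The subjet of `u` at `z` relative to `(0, ∞) × A`: the pairs (time derivative, gradient) at
`z` of the smooth test functions touching `u` from below at `z`. -/
def subjet (A : Set E) (u : ℝ → E → ℝ) (z : ℝ × E) : Set (ℝ × E) :=
  {q | ∃ (φ : ℝ × E → ℝ) (a : ℝ × E → ℝ) (g : ℝ × E → E), IsSmoothTest A φ a g ∧
    IsLocalMinOn (fun w : ℝ × E => u w.1 w.2 - φ w) (Ioi (0 : ℝ) ×ˢ A) z ∧ (a z, g z) = q}

variable {A : Set E} {H : E → ℝ} {u f : ℝ → E → ℝ} {z : ℝ × E} {q : ℝ × E}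

theorem neg_mem_superjet_neg (hq : q ∈ subjet A u z) : -q ∈ superjet A (-u) z := by
  obtain ⟨φ, a, g, hφ, hmin, rfl⟩ := hq
  refine ⟨_, _, _, hφ.neg, ?_, rfl⟩
  filter_upwards [hmin] with w hw
  simp only [Pi.neg_apply]
  linarith

theorem neg_mem_subjet_neg (hq : q ∈ superjet A u z) : -q ∈ subjet A (-u) z := by
  obtain ⟨φ, a, g, hφ, hmax, rfl⟩ := hq
  refine ⟨_, _, _, hφ.neg, ?_, rfl⟩
  filter_upwards [hmax] with w hw
  simp only [Pi.neg_apply]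
  linarith

theorem IsViscositySubsolution.le_of_mem_superjet (hu : IsViscositySubsolution A H u)
    (hz : z ∈ Ioi (0 : ℝ) ×ˢ A) (hq : q ∈ superjet A u z) : q.1 ≤ H q.2 := by
  obtain ⟨φ, a, g, hφ, hmax, rfl⟩ := hq
  exact sub_nonpos.1 (hu.2 z hz φ a g hφ hmax)

theorem IsViscositySupersolution.le_of_mem_subjet (hu : IsViscositySupersolution A H u)
    (hz : z ∈ Ioi (0 : ℝ) ×ˢ A) (hq : q ∈ subjet A u z) : H q.2 ≤ q.1 := by
  obtain ⟨φ, a, g, hφ, hmin, rfl⟩ := hq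
  exact sub_nonneg.1 (hu.2 z hz φ a g hφ hmin)

theorem IsViscositySupersolution.neg (hf : IsViscositySupersolution A H f) :
    IsViscositySubsolution A (fun q => -H (-q)) (-f) := by
  refine ⟨hf.1.neg, fun z hz φ a g hφ hmax => ?_⟩
  have hq := neg_mem_subjet_neg (A := A) ⟨φ, a, g, hφ, hmax, rfl⟩
  rw [neg_neg] at hq
  have h := hf.le_of_mem_subjet hz hq
  simp only [Prod.snd_neg, Prod.fst_neg] at h
  linarith

theorem IsViscositySubsolution.neg (hf : IsViscositySubsolution A H f) :
    IsViscositySupersolution A (fun q => -H (-q)) (-f) := by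
  refine ⟨hf.1.neg, fun z hz φ a g hφ hmin => ?_⟩
  have hq := neg_mem_superjet_neg (A := A) ⟨φ, a, g, hφ, hmin, rfl⟩
  rw [neg_neg] at hq
  have h := hf.le_of_mem_superjet hz hq
  simp only [Prod.snd_neg, Prod.fst_neg] at h
  linarith

theorem IsViscositySolution.neg (hf : IsViscositySolution A H f) :
    IsViscositySolution A (fun q => -H (-q)) (-f) :=
  ⟨hf.2.neg, hf.1.neg⟩

/-- Testing a superjet in the direction `d = (τ, v)` along the segment `z + ε d`, where `u`
decreases at rate at most `m`. -/
theorem neg_le_of_mem_superjet (hz : z ∈ Ioi (0 : ℝ) ×ˢ A) (hq : q ∈ superjet A u z)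
    {d : ℝ × E} {m : ℝ} (hd : ∀ᶠ ε in 𝓝[>] (0 : ℝ), z + ε • d ∈ Ioi (0 : ℝ) ×ˢ A ∧
      u z.1 z.2 - u (z + ε • d).1 (z + ε • d).2 ≤ ε * m) :
    -(q.1 * d.1 + inner ℝ q.2 d.2) ≤ m := by
  obtain ⟨φ, a, g, hφ, hmax, rfl⟩ := hq
  have hcurve : Tendsto (fun ε : ℝ => z + ε • d) (𝓝[>] 0) (𝓝[Ioi (0 : ℝ) ×ˢ A] z) := by
    refine tendsto_nhdsWithin_iff.2 ⟨?_, hd.mono fun ε h => h.1⟩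
    have hc : Continuous fun ε : ℝ => z + ε • d := by fun_prop
    simpa using (hc.tendsto 0).mono_left nhdsWithin_le_nhds
  obtain ⟨c, hc⟩ := (hφ.expansion z hz).bound
  have hquot : ∀ᶠ ε in 𝓝[>] (0 : ℝ),
      -(a z * d.1 + inner ℝ (g z) d.2) ≤ m + c * (|d.1| ^ 2 + ‖d.2‖ ^ 2) * ε := by
    filter_upwards [hcurve.eventually hc, hcurve.eventually hmax, hd, self_mem_nhdsWithin]
      with ε hexp hle hdε hε
    replace hε : 0 < ε := hε
    have hbound : |φ (z + ε • d) - φ z - ε * (a z * d.1 + inner ℝ (g z) d.2)| ≤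
        c * (ε ^ 2 * (|d.1| ^ 2 + ‖d.2‖ ^ 2)) := by
      have hincrement : a z * ((z + ε • d).1 - z.1) + inner ℝ (g z) ((z + ε • d).2 - z.2) =
          ε * (a z * d.1 + inner ℝ (g z) d.2) := by
        simp only [Prod.fst_add, Prod.snd_add, Prod.smul_fst, Prod.smul_snd, add_sub_cancel_left,
          smul_eq_mul, real_inner_smul_right]
        ring
      have hsquare : ‖|(z + ε • d).1 - z.1| ^ 2 + ‖(z + ε • d).2 - z.2‖ ^ 2‖ =
          ε ^ 2 * (|d.1| ^ 2 + ‖d.2‖ ^ 2) := by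
        rw [Real.norm_of_nonneg (by positivity)]
        simp only [Prod.fst_add, Prod.snd_add, Prod.smul_fst, Prod.smul_snd, add_sub_cancel_left,
          smul_eq_mul, norm_smul, abs_mul, mul_pow, Real.norm_eq_abs, sq_abs]
        ring
      rwa [hincrement, hsquare] at hexp
    have hφε := (abs_le.1 hbound).2
    refine le_of_mul_le_mul_left ?_ hε
    nlinarith [hdε.2]
  simpa using le_apply_zero_of_eventually (by fun_prop) hquot

end Jets

/-! ### Doubling of variables -/

section Doubling

/-- The penalty in the time variables used when doubling variables with shift `h`: it forces
`t ≈ s + h` as `ε → 0`, while the slope `γ + η` in `s` makes the inequality between the time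
derivatives strict and `η s ^ 2` makes the penalty coercive. -/
noncomputable def timePenalty (ε η γ h t s : ℝ) : ℝ :=
  (t - s - h) ^ 2 / (2 * ε) + ((γ + η) * s + η * s ^ 2)

variable {ε η γ h : ℝ}

theorem mul_sub_sq_div_le (hε : 0 < ε) (M τ : ℝ) : M * τ - τ ^ 2 / (2 * ε) ≤ M ^ 2 * ε / 2 := by
  have hsquare : M ^ 2 * ε / 2 - (M * τ - τ ^ 2 / (2 * ε)) = (τ - ε * M) ^ 2 / (2 * ε) := by
    field_simp
    ring
  rw [← sub_nonneg, hsquare]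
  positivity

theorem exists_add_le_add_timePenalty (hε : 0 < ε) (hη : 0 < η) (γ h M M' : ℝ) :
    ∃ b, ∀ t s, M * t + M' * s + (t + s) ≤ b + timePenalty ε η γ h t s := by
  refine ⟨(M + 1) ^ 2 * ε / 2 + (M + M' + 2 - γ - η) ^ 2 * (1 / (2 * η)) / 2 + (M + 1) * h,
    fun t s => ?_⟩
  have hshift := mul_sub_sq_div_le hε (M + 1) (t - s - h)
  have hdrift := mul_sub_sq_div_le (one_div_pos.2 (mul_pos two_pos hη)) (M + M' + 2 - γ - η) s
  have hsq : s ^ 2 / (2 * (1 / (2 * η))) = η * s ^ 2 := by field_simp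
  rw [hsq] at hdrift
  rw [timePenalty]
  linarith

theorem sub_timePenalty_le_of_eq_zero {M M' t s : ℝ} (hε : 0 < ε) (hη : 0 ≤ η) (hγ : 0 ≤ γ)
    (hh : 0 ≤ h) (hM : 0 ≤ M) (hM' : 0 ≤ M') (hs : 0 ≤ s) (hzero : t = 0 ∨ s = 0) :
    M * t + M' * s - timePenalty ε η γ h t s ≤ M * h + (M ^ 2 + M' ^ 2) * ε / 2 := by
  have hdrift : 0 ≤ (γ + η) * s + η * s ^ 2 := by positivity
  have hMh : 0 ≤ M * h := by positivity
  have hMε : 0 ≤ M ^ 2 * ε / 2 := by positivity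
  rw [timePenalty]
  rcases hzero with rfl | rfl
  · have hle := mul_sub_sq_div_le hε M' (s + h)
    have hsq : (0 - s - h) ^ 2 = (s + h) ^ 2 := by ring
    have hM'h : 0 ≤ M' * h := by positivity
    rw [hsq]
    linarith
  · have hle := mul_sub_sq_div_le hε M (t - h)
    have hM'ε : 0 ≤ M' ^ 2 * ε / 2 := by positivity
    rw [sub_zero]
    linarith

theorem exists_isMaxOn_of_le_sub_norm {F : Type*} [NormedAddCommGroup F] [ProperSpace F]
    {s : Set F} (hs : IsClosed s) {f : F → ℝ} (hf : ContinuousOn f s) {w₀ : F} (hw₀ : w₀ ∈ s)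
    {b c : ℝ} (hc : 0 < c) (hle : ∀ w ∈ s, f w ≤ b - c * ‖w‖) : ∃ w ∈ s, IsMaxOn f s w := by
  refine hf.exists_isMaxOn' hs hw₀ ?_
  have hfar : ∀ᶠ w in cocompact F, (b - f w₀) / c < ‖w‖ :=
    tendsto_norm_cocompact_atTop.eventually_gt_atTop _
  filter_upwards [hfar.filter_mono inf_le_left, mem_inf_of_right (mem_principal_self s)]
    with w hw hws
  rw [div_lt_iff₀ hc] at hw
  linarith [hle w hws]

/-- The function of the doubled variables `((t, x), (s, y))` whose maximisation compares `u` with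
`v`, with spatial penalty `Φ`. -/
noncomputable def doubled {X X' : Type*} (u : ℝ → X → ℝ) (v : ℝ → X' → ℝ) (Φ : X → X' → ℝ)
    (ε η γ h : ℝ) (w : (ℝ × X) × (ℝ × X')) : ℝ :=
  u w.1.1 w.1.2 - v w.2.1 w.2.2 - Φ w.1.2 w.2.2 - timePenalty ε η γ h w.1.1 w.2.1

theorem continuousOn_doubled {X X' : Type*} [TopologicalSpace X] [TopologicalSpace X']
    {A : Set X} {A' : Set X'} {u : ℝ → X → ℝ} {v : ℝ → X' → ℝ} {Φ : X → X' → ℝ}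
    (hu : ContinuousOn (fun z : ℝ × X => u z.1 z.2) (Ici (0 : ℝ) ×ˢ A))
    (hv : ContinuousOn (fun z : ℝ × X' => v z.1 z.2) (Ici (0 : ℝ) ×ˢ A'))
    (hΦ : Continuous fun w : X × X' => Φ w.1 w.2) :
    ContinuousOn (doubled u v Φ ε η γ h) ((Ici (0 : ℝ) ×ˢ A) ×ˢ (Ici (0 : ℝ) ×ˢ A')) := by
  have hu' := hu.comp continuous_fst.continuousOn
    fun (w : (ℝ × X) × (ℝ × X')) (hw : w ∈ (Ici (0 : ℝ) ×ˢ A) ×ˢ (Ici (0 : ℝ) ×ˢ A')) => hw.1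
  have hv' := hv.comp continuous_snd.continuousOn
    fun (w : (ℝ × X) × (ℝ × X')) (hw : w ∈ (Ici (0 : ℝ) ×ˢ A) ×ˢ (Ici (0 : ℝ) ×ˢ A')) => hw.2
  have hΦ' : Continuous fun w : (ℝ × X) × (ℝ × X') => Φ w.1.2 w.2.2 :=
    hΦ.comp (by fun_prop : Continuous fun w : (ℝ × X) × (ℝ × X') => (w.1.2, w.2.2))
  have htime : Continuous fun w : (ℝ × X) × (ℝ × X') => timePenalty ε η γ h w.1.1 w.2.1 := by
    unfold timePenalty
    fun_prop
  exact ((hu'.sub hv').sub hΦ'.continuousOn).sub htime.continuousOn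

theorem exists_isMaxOn_doubled {E E' : Type*} [NormedAddCommGroup E] [NormedAddCommGroup E']
    [ProperSpace E] [ProperSpace E'] {A : Set E} {A' : Set E'} {u : ℝ → E → ℝ} {v : ℝ → E' → ℝ}
    {Φ : E → E' → ℝ} {x : E} {y : E'} (hA : IsClosed A)
    (hA' : IsClosed A') (hu : ContinuousOn (fun z : ℝ × E => u z.1 z.2) (Ici (0 : ℝ) ×ˢ A))
    (hv : ContinuousOn (fun z : ℝ × E' => v z.1 z.2) (Ici (0 : ℝ) ×ˢ A'))
    (hΦ : Continuous fun w : E × E' => Φ w.1 w.2) {c M M' : ℝ} (hc : 0 < c)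
    (hgrowth : ∀ t, 0 ≤ t → ∀ x ∈ A, ∀ s, 0 ≤ s → ∀ y ∈ A',
      u t x - v s y + c * (‖x‖ + ‖y‖) ≤ Φ x y + M * t + M' * s)
    (hε : 0 < ε) (hη : 0 < η) (hx : x ∈ A) (hy : y ∈ A') :
    ∃ w ∈ (Ici (0 : ℝ) ×ˢ A) ×ˢ (Ici (0 : ℝ) ×ˢ A'),
      IsMaxOn (doubled u v Φ ε η γ h) ((Ici (0 : ℝ) ×ˢ A) ×ˢ (Ici (0 : ℝ) ×ˢ A')) w := by
  obtain ⟨b, hb⟩ := exists_add_le_add_timePenalty hε hη γ h M M'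
  have hm0 : 0 < min 1 c := lt_min one_pos hc
  have hw₀ : ((0, x), (0, y)) ∈ (Ici (0 : ℝ) ×ˢ A) ×ˢ (Ici (0 : ℝ) ×ˢ A') :=
    ⟨⟨self_mem_Ici, hx⟩, self_mem_Ici, hy⟩
  refine exists_isMaxOn_of_le_sub_norm (b := b)
    ((isClosed_Ici.prod hA).prod (isClosed_Ici.prod hA')) (continuousOn_doubled hu hv hΦ) hw₀ hm0 ?_
  rintro ⟨⟨t, x⟩, ⟨s, y⟩⟩ ⟨⟨ht, hx⟩, ⟨hs, hy⟩⟩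
  rw [mem_Ici] at ht hs
  have hnorm : ‖(((t, x), (s, y)) : (ℝ × E) × (ℝ × E'))‖ ≤ t + s + (‖x‖ + ‖y‖) := by
    have hx0 := norm_nonneg x
    have hy0 := norm_nonneg y
    simp only [Prod.norm_def, Real.norm_of_nonneg ht, Real.norm_of_nonneg hs]
    refine max_le (max_le ?_ ?_) (max_le ?_ ?_) <;> linarith
  have hweight : min 1 c * (t + s + (‖x‖ + ‖y‖)) ≤ 1 * (t + s) + c * (‖x‖ + ‖y‖) := by
    rw [mul_add]
    gcongr
    · exact min_le_left _ _
    · exact min_le_right _ _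
  have hscaled := mul_le_mul_of_nonneg_left hnorm hm0.le
  have hgrow := hgrowth t ht x hx s hs y hy
  have hpenalty := hb t s
  simp only [doubled]
  linarith

variable {E : Type*} [NormedAddCommGroup E] [InnerProductSpace ℝ E]
  {A : Set E} {u : ℝ → E → ℝ} {t s : ℝ}

theorem mem_superjet_of_isMaxOn_doubled {X' : Type*} {A' : Set X'} {v : ℝ → X' → ℝ}
    {Φ : E → X' → ℝ} {G : E → X' → E} {x : E} {y : X'}
    (hG : HasQuadraticExpansion (fun x => Φ x y) (G · y))
    (hs : 0 ≤ s) (hy : y ∈ A')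
    (hmax : IsMaxOn (doubled u v Φ ε η γ h) ((Ici (0 : ℝ) ×ˢ A) ×ˢ (Ici (0 : ℝ) ×ˢ A'))
      ((t, x), (s, y))) :
    ((t - s - h) / ε, G x y) ∈ superjet A u (t, x) := by
  refine ⟨_, _, _, (HasQuadraticExpansion.real_quadratic (1 / (2 * ε)) 0 (s + h)).isSmoothTest_add
    hG A, IsMaxOn.localize ?_, Prod.ext ?_ rfl⟩
  · rintro ⟨t', x'⟩ ⟨ht', hx'⟩
    have hle := hmax (show ((t', x'), (s, y)) ∈ _ from ⟨⟨(mem_Ioi.1 ht').le, hx'⟩, hs, hy⟩)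
    simp only [mem_ofPred_eq, doubled, timePenalty] at hle ⊢
    linear_combination hle
  · simp only
    ring

variable {E' : Type*} [NormedAddCommGroup E'] [InnerProductSpace ℝ E'] {A' : Set E'}
  {v : ℝ → E' → ℝ}

theorem mem_subjet_of_isMaxOn_doubled {X : Type*} {A : Set X} {u : ℝ → X → ℝ}
    {Φ : X → E' → ℝ} {G' : X → E' → E'} {x : X} {y : E'}
    (hG' : HasQuadraticExpansion (fun y => -Φ x y) (G' x))
    (ht : 0 ≤ t) (hx : x ∈ A)
    (hmax : IsMaxOn (doubled u v Φ ε η γ h) ((Ici (0 : ℝ) ×ˢ A) ×ˢ (Ici (0 : ℝ) ×ˢ A'))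
      ((t, x), (s, y))) :
    ((t - s - h) / ε - (γ + η) - 2 * η * s, G' x y) ∈ subjet A' v (s, y) := by
  refine ⟨_, _, _, ((HasQuadraticExpansion.real_quadratic (-(1 / (2 * ε))) (-(γ + η)) (t - h)).add
    (HasQuadraticExpansion.real_quadratic (-η) 0 0)).isSmoothTest_add hG' A',
    IsMinOn.localize ?_, Prod.ext ?_ rfl⟩
  · rintro ⟨s', y'⟩ ⟨hs', hy'⟩
    have hle := hmax (show ((t, x), (s', y')) ∈ _ from ⟨⟨ht, hx⟩, (mem_Ioi.1 hs').le, hy'⟩)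
    simp only [mem_ofPred_eq, doubled, timePenalty] at hle ⊢
    linear_combination hle
  · simp only
    ring

variable {Φ : E → E' → ℝ} {G : E → E' → E} {G' : E → E' → E'} {y : E'} {x : E}

/-- At a maximum of the doubled function at positive times, the strict slope `γ + η` of the time
penalty contradicts `hjet`; so the maximum is attained at a zero time, where the growth bound
applies. -/
theorem doubled_le_of_isMaxOn {c M M' : ℝ}
    (hG : HasQuadraticExpansion (fun x => Φ x y) (G · y))
    (hG' : HasQuadraticExpansion (fun y => -Φ x y) (G' x))
    (hc : 0 ≤ c) (hM : 0 ≤ M) (hM' : 0 ≤ M') (hγ : 0 ≤ γ) (hh : 0 ≤ h) (hε : 0 < ε) (hη : 0 < η)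
    (hgrowth : u t x - v s y + c * (‖x‖ + ‖y‖) ≤ Φ x y + M * t + M' * s)
    (hjet : 0 < t → 0 < s → ∀ a a', (a, G x y) ∈ superjet A u (t, x) →
      (a', G' x y) ∈ subjet A' v (s, y) → a ≤ a' + γ)
    (ht : 0 ≤ t) (hx : x ∈ A) (hs : 0 ≤ s) (hy : y ∈ A')
    (hmax : IsMaxOn (doubled u v Φ ε η γ h) ((Ici (0 : ℝ) ×ˢ A) ×ˢ (Ici (0 : ℝ) ×ˢ A'))
      ((t, x), (s, y))) :
    doubled u v Φ ε η γ h ((t, x), (s, y)) ≤ M * h + (M ^ 2 + M' ^ 2) * ε / 2 := by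
  have hzero : t = 0 ∨ s = 0 := by
    by_contra! hpos
    have ht0 : 0 < t := ht.lt_of_ne' hpos.1
    have hs0 : 0 < s := hs.lt_of_ne' hpos.2
    have hslope := hjet ht0 hs0 _ _ (mem_superjet_of_isMaxOn_doubled hG hs hy hmax)
      (mem_subjet_of_isMaxOn_doubled hG' ht hx hmax)
    linarith [mul_pos hη hs0]
  have hle := sub_timePenalty_le_of_eq_zero hε hη.le hγ hh hM hM' hs hzero
  have hnorms : 0 ≤ c * (‖x‖ + ‖y‖) := by positivity
  simp only [doubled]
  linarith

theorem doubling_of_variables [ProperSpace E] [ProperSpace E'] (hA : IsClosed A)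
    (hA' : IsClosed A') (hu : ContinuousOn (fun z : ℝ × E => u z.1 z.2) (Ici (0 : ℝ) ×ˢ A))
    (hv : ContinuousOn (fun z : ℝ × E' => v z.1 z.2) (Ici (0 : ℝ) ×ˢ A'))
    (hΦ : Continuous fun w : E × E' => Φ w.1 w.2)
    (hG : ∀ y, HasQuadraticExpansion (fun x => Φ x y) (G · y))
    (hG' : ∀ x, HasQuadraticExpansion (fun y => -Φ x y) (G' x))
    {c M M' : ℝ} (hc : 0 < c) (hM : 0 ≤ M) (hM' : 0 ≤ M') (hγ : 0 ≤ γ) (hh : 0 ≤ h)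
    (hgrowth : ∀ t, 0 ≤ t → ∀ x ∈ A, ∀ s, 0 ≤ s → ∀ y ∈ A',
      u t x - v s y + c * (‖x‖ + ‖y‖) ≤ Φ x y + M * t + M' * s)
    (hjet : ∀ t, 0 < t → ∀ x ∈ A, ∀ s, 0 < s → ∀ y ∈ A', ∀ a a',
      (a, G x y) ∈ superjet A u (t, x) → (a', G' x y) ∈ subjet A' v (s, y) → a ≤ a' + γ)
    (ht : 0 ≤ t) (hx : x ∈ A) (hy : y ∈ A') :
    u (t + h) x - v t y ≤ Φ x y + γ * t + M * h := by
  have hpenalised : ∀ ε > 0, u (t + h) x - v t y - Φ x y - ((γ + ε) * t + ε * t ^ 2) ≤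
      M * h + (M ^ 2 + M' ^ 2) * ε / 2 := by
    intro ε hε
    obtain ⟨⟨⟨t₁, x₁⟩, ⟨s₁, y₁⟩⟩, ⟨⟨ht₁, hx₁⟩, ⟨hs₁, hy₁⟩⟩, hmax⟩ :=
      exists_isMaxOn_doubled (γ := γ) (h := h) hA hA' hu hv hΦ hc hgrowth hε hε hx hy
    have hle := (hmax (show ((t + h, x), (t, y)) ∈ _ from ⟨⟨add_nonneg ht hh, hx⟩, ht, hy⟩)).trans
      (doubled_le_of_isMaxOn (hG y₁) (hG' x₁) hc.le hM hM' hγ hh hε hε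
        (hgrowth t₁ ht₁ x₁ hx₁ s₁ hs₁ y₁ hy₁)
        (fun ht₁ hs₁ => hjet t₁ ht₁ x₁ hx₁ s₁ hs₁ y₁ hy₁) ht₁ hx₁ hs₁ hy₁ hmax)
    simpa [doubled, timePenalty] using hle
  have hlimit := le_apply_zero_of_eventually (a := u (t + h) x - v t y - Φ x y)
    (f := fun ε => M * h + (M ^ 2 + M' ^ 2) * ε / 2 + ((γ + ε) * t + ε * t ^ 2)) (by fun_prop) <| by
      filter_upwards [self_mem_nhdsWithin] with ε hε
      linarith [hpenalised ε hε]
  simp only [mul_zero, zero_mul, zero_div, add_zero] at hlimit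
  linarith

end Doubling

/-! ### Superjets at the boundary of a cone -/

section Boundary

/-- Touching survives a penalisation by `π` if `π` dominates the squared distance to `z` and is
small somewhere near `z`. -/
theorem exists_isLocalMaxOn_sub_penalty {X : Type*} [PseudoMetricSpace X] {S : Set X}
    {F π : X → ℝ} {z w₀ : X} {r : ℝ} (hcpt : IsCompact (S ∩ Metric.closedBall z r))
    (hF : ContinuousOn F S) (hπ : ContinuousOn π S) (hr : 0 ≤ r)
    (hmax : ∀ w ∈ S ∩ Metric.closedBall z r, F w ≤ F z)
    (hw₀ : w₀ ∈ S ∩ Metric.closedBall z r) (hsmall : F z - F w₀ + π w₀ < r ^ 2)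
    (hdist : ∀ w, dist w z ^ 2 ≤ π w) :
    ∃ z' ∈ S, dist z' z < r ∧ π z' < r ^ 2 ∧ IsLocalMaxOn (fun w => F w - π w) S z' := by
  obtain ⟨z', hz', hz'max⟩ :=
    hcpt.exists_isMaxOn ⟨w₀, hw₀⟩ ((hF.mono inter_subset_left).sub (hπ.mono inter_subset_left))
  have hπz' : π z' < r ^ 2 := by
    have hle : F w₀ - π w₀ ≤ F z' - π z' := hz'max hw₀
    linarith [hmax z' hz']
  have hz'r : dist z' z < r := lt_of_pow_lt_pow_left₀ 2 hr ((hdist z').trans_lt hπz')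
  refine ⟨z', hz'.1, hz'r, hπz', ?_⟩
  filter_upwards [nhdsWithin_le_nhds (Metric.isOpen_ball.mem_nhds hz'r), self_mem_nhdsWithin]
    with w hwr hwS
  exact hz'max ⟨hwS, Metric.ball_subset_closedBall hwr⟩

theorem isCompact_Ioi_prod_inter_closedBall {X : Type*} [PseudoMetricSpace X] [ProperSpace X]
    {A : Set X} (hA : IsClosed A) {z : ℝ × X} {r : ℝ} (hr : r < z.1) :
    IsCompact ((Ioi (0 : ℝ) ×ˢ A) ∩ Metric.closedBall z r) := by
  have hIci : (Ioi (0 : ℝ) ×ˢ A) ∩ Metric.closedBall z r =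
      (Ici (0 : ℝ) ×ˢ A) ∩ Metric.closedBall z r := by
    refine Subset.antisymm (inter_subset_inter_left _ (prod_mono_left Ioi_subset_Ici_self)) ?_
    rintro w ⟨⟨-, hwA⟩, hw⟩
    have hdist : |w.1 - z.1| ≤ r := (le_max_left _ _).trans hw
    exact ⟨⟨mem_Ioi.2 (by linarith [(abs_le.1 hdist).1]), hwA⟩, hw⟩
  rw [hIci]
  exact (isCompact_closedBall z r).inter_left (isClosed_Ici.prod hA)

variable {E : Type*} [NormedAddCommGroup E] [InnerProductSpace ℝ E]

/-- Closed convex cones with nonempty interior. -/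
structure IsSolidCone (A : Set E) : Prop where
  isClosed : IsClosed A
  add_mem : ∀ x ∈ A, ∀ y ∈ A, x + y ∈ A
  smul_mem : ∀ c : ℝ, 0 ≤ c → ∀ x ∈ A, c • x ∈ A
  nonempty_interior : (interior A).Nonempty

theorem isClosed_dualCone (A : Set E) : IsClosed (dualCone A) := by
  have hinter : dualCone A = ⋂ y ∈ A, {x | 0 ≤ inner ℝ x y} := by ext x; simp [dualCone]
  rw [hinter]
  exact isClosed_biInter fun y _ => isClosed_le continuous_const (by fun_prop)

variable {A : Set E}

theorem smul_mem_dualCone {c : ℝ} (hc : 0 ≤ c) {k : E} (hk : k ∈ dualCone A) :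
    c • k ∈ dualCone A := fun y hy => by
  rw [real_inner_smul_left]
  exact mul_nonneg hc (hk y hy)

namespace IsSolidCone

theorem convex (hA : IsSolidCone A) : Convex ℝ A :=
  fun _ hx _ hy _ _ ha hb _ =>
    hA.add_mem _ (hA.smul_mem _ ha _ hx) _ (hA.smul_mem _ hb _ hy)

theorem mem_interior_of_norm_sub_lt (hA : IsSolidCone A) {e p x : E} {r δ : ℝ}
    (hball : Metric.ball e r ⊆ A) (hδ : 0 < δ) (hp : p ∈ A) (hx : ‖x - δ • e - p‖ < δ * r) :
    x ∈ interior A := by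
  refine mem_interior.2 ⟨Metric.ball (p + δ • e) (δ * r), fun y hy => ?_, Metric.isOpen_ball, ?_⟩
  · have hscaled : δ⁻¹ • (y - p) ∈ A := by
      refine hball ?_
      rw [Metric.mem_ball, dist_eq_norm] at hy ⊢
      have hsub : δ⁻¹ • (y - p) - e = δ⁻¹ • (y - (p + δ • e)) := by
        rw [← sub_sub, smul_sub _ _ (δ • e), inv_smul_smul₀ hδ.ne']
      rwa [hsub, norm_smul, norm_inv, Real.norm_of_nonneg hδ.le, inv_mul_lt_iff₀ hδ]
    have hsum := hA.add_mem _ hp _ (hA.smul_mem δ hδ.le _ hscaled)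
    rwa [smul_inv_smul₀ hδ.ne', add_sub_cancel] at hsum
  · rwa [Metric.mem_ball, dist_eq_norm, ← sub_sub, sub_right_comm]

theorem proj_sub_mem_dualCone (hA : IsSolidCone A) {P : E → E} (hP : IsMetricProjection A P)
    (x : E) : P x - x ∈ dualCone A := by
  intro y hy
  have hle := hP.inner_nonpos x _ (hA.add_mem _ (hP.mem x) _ hy)
  rwa [add_sub_cancel_left, ← neg_sub, inner_neg_left, neg_nonpos] at hle

variable {u : ℝ → E → ℝ} {z q : ℝ × E} {ε : ℝ}

theorem tendsto_shift (hA : IsSolidCone A) (hz : z ∈ Ioi (0 : ℝ) ×ˢ A) {e : E} (he : e ∈ A) :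
    Tendsto (fun δ : ℝ => (z.1, z.2 + δ • e)) (𝓝[>] 0) (𝓝[Ioi (0 : ℝ) ×ˢ A] z) := by
  refine tendsto_nhdsWithin_iff.2 ⟨?_, ?_⟩
  · have hcont : Continuous fun δ : ℝ => (z.1, z.2 + δ • e) := by fun_prop
    simpa using (hcont.tendsto 0).mono_left nhdsWithin_le_nhds
  · filter_upwards [self_mem_nhdsWithin] with δ hδ
    exact ⟨hz.1, hA.add_mem _ hz.2 _ (hA.smul_mem _ (le_of_lt hδ) _ he)⟩

theorem exists_small_shift (hA : IsSolidCone A) {F : ℝ × E → ℝ}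
    (hF : ContinuousOn F (Ioi (0 : ℝ) ×ˢ A)) (hz : z ∈ Ioi (0 : ℝ) ×ˢ A) {e : E} (he : e ∈ A)
    {r : ℝ} (hr : 0 < r) :
    ∃ δ : ℝ, 0 < δ ∧ (z.1, z.2 + δ • e) ∈ (Ioi (0 : ℝ) ×ˢ A) ∩ Metric.closedBall z r ∧
      F z - F (z.1, z.2 + δ • e) + ‖δ • e‖ ^ 2 < r ^ 2 := by
  have hshift := hA.tendsto_shift hz he
  have hcost : Tendsto (fun δ : ℝ => F z - F (z.1, z.2 + δ • e) + ‖δ • e‖ ^ 2) (𝓝[>] 0) (𝓝 0) := by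
    have hcont : Continuous fun δ : ℝ => ‖δ • e‖ ^ 2 := by fun_prop
    simpa using (((hF z hz).tendsto.comp hshift).const_sub (F z)).add
      ((hcont.tendsto 0).mono_left nhdsWithin_le_nhds)
  obtain ⟨δ, ⟨hmem, hlt⟩, hδ⟩ := ((hshift.eventually_mem (inter_mem self_mem_nhdsWithin
    (nhdsWithin_le_nhds (Metric.closedBall_mem_nhds z hr)))).and
      (hcost.eventually_lt_const (by positivity : 0 < r ^ 2))).and self_mem_nhdsWithin |>.exists
  exact ⟨δ, hδ, hmem, hlt⟩

/-- Penalising the squared distance to a translate of the cone into its interior moves a touching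
point into the interior, and lowers the gradient by an element of the dual cone. -/
theorem exists_interior_touching [ProperSpace E] (hA : IsSolidCone A)
    (hu : ContinuousOn (fun z : ℝ × E => u z.1 z.2) (Ici (0 : ℝ) ×ˢ A))
    (hz : z ∈ Ioi (0 : ℝ) ×ˢ A) {φ a : ℝ × E → ℝ} {g : ℝ × E → E} (hφ : IsSmoothTest A φ a g)
    {r : ℝ} (hr : 0 < r) (hrz : r < z.1)
    (hmax : ∀ w ∈ (Ioi (0 : ℝ) ×ˢ A) ∩ Metric.closedBall z r,
      u w.1 w.2 - φ w ≤ u z.1 z.2 - φ z) :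
    ∃ z' : ℝ × E, 0 < z'.1 ∧ z'.2 ∈ interior A ∧ dist z' z < r ∧
      ∃ k ∈ dualCone A, (a z' + 2 * (z'.1 - z.1), g z' + (2 : ℝ) • (z'.2 - z.2) - k) ∈
        superjet A u z' := by
  obtain ⟨e, he⟩ := hA.nonempty_interior
  obtain ⟨R, hR, hball⟩ := Metric.mem_nhds_iff.1 (mem_interior_iff_mem_nhds.1 he)
  obtain ⟨P, hP⟩ := exists_isMetricProjection ⟨z.2, hz.2⟩ hA.isClosed hA.convex
  have hF : ContinuousOn (fun w : ℝ × E => u w.1 w.2 - φ w) (Ioi (0 : ℝ) ×ˢ A) :=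
    (hu.mono (prod_mono_left Ioi_subset_Ici_self)).sub hφ.continuousOn
  obtain ⟨δ, hδ, hw₀, hsmall⟩ := hA.exists_small_shift hF hz (interior_subset he) hr
  set B := r ^ 2 / (δ * R) ^ 2 with hB
  have hB0 : 0 < B := by positivity
  have hpen := (HasQuadraticExpansion.real_quadratic 1 0 z.1).isSmoothTest_add
    ((HasQuadraticExpansion.norm_sq.comp_sub_const z.2).add
      ((hP.hasQuadraticExpansion_norm_sub_sq.comp_sub_const (δ • e)).const_mul B)) A
  obtain ⟨z', ⟨hz'1, hz'2⟩, hz'r, hπz', hz'max⟩ := exists_isLocalMaxOn_sub_penalty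
    (isCompact_Ioi_prod_inter_closedBall hA.isClosed hrz) hF hpen.continuousOn hr.le hmax hw₀
    (by simpa [hP.eq_self hz.2] using hsmall)
    (fun w => by
      rw [Prod.dist_eq, Real.dist_eq, dist_eq_norm]
      have hdist : 0 ≤ B * ‖w.2 - δ • e - P (w.2 - δ • e)‖ ^ 2 := by positivity
      rcases max_cases |w.1 - z.1| ‖w.2 - z.2‖ with ⟨h, -⟩ | ⟨h, -⟩ <;> rw [h]
      · nlinarith [sq_abs (w.1 - z.1), sq_nonneg ‖w.2 - z.2‖]
      · nlinarith [sq_nonneg (w.1 - z.1)])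
  refine ⟨z', hz'1, hA.mem_interior_of_norm_sub_lt hball hδ (hP.mem (z'.2 - δ • e)) ?_, hz'r,
    (B * 2) • (P (z'.2 - δ • e) - (z'.2 - δ • e)),
    smul_mem_dualCone (by positivity) (hA.proj_sub_mem_dualCone hP _), ?_⟩
  · refine lt_of_pow_lt_pow_left₀ 2 (by positivity) (lt_of_mul_lt_mul_left ?_ hB0.le)
    have hr2 : B * (δ * R) ^ 2 = r ^ 2 := by rw [hB]; field_simp
    rw [hr2]
    nlinarith [sq_nonneg (z'.1 - z.1), sq_nonneg ‖z'.2 - z.2‖]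
  · refine ⟨_, _, _, hφ.add hpen, hz'max.congr (Eventually.of_forall fun w => sub_sub _ _ _)
      ⟨hz'1, hz'2⟩, Prod.ext ?_ ?_⟩
    · simp only
      ring
    · simp only
      module

theorem exists_superjet_interior [ProperSpace E] (hA : IsSolidCone A)
    (hu : ContinuousOn (fun z : ℝ × E => u z.1 z.2) (Ici (0 : ℝ) ×ˢ A))
    (hz : z ∈ Ioi (0 : ℝ) ×ˢ A) (hq : q ∈ superjet A u z) (hε : 0 < ε) :
    ∃ z' : ℝ × E, 0 < z'.1 ∧ z'.2 ∈ interior A ∧ ∃ q' ∈ superjet A u z', |q'.1 - q.1| < ε ∧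
      ∃ Q, ‖Q - q.2‖ < ε ∧ Q - q'.2 ∈ dualCone A := by
  obtain ⟨φ, a, g, hφ, hmax, rfl⟩ := hq
  have htime : Tendsto (fun w : ℝ × E => a w + 2 * (w.1 - z.1)) (𝓝[Ioi (0 : ℝ) ×ˢ A] z)
      (𝓝 (a z)) := by
    have hc : ContinuousOn (fun w : ℝ × E => a w + 2 * (w.1 - z.1)) (Ioi (0 : ℝ) ×ˢ A) :=
      hφ.continuousOn_time.add (by fun_prop)
    simpa using (hc z hz).tendsto
  have hgrad : Tendsto (fun w : ℝ × E => g w + (2 : ℝ) • (w.2 - z.2)) (𝓝[Ioi (0 : ℝ) ×ˢ A] z)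
      (𝓝 (g z)) := by
    have hc : ContinuousOn (fun w : ℝ × E => g w + (2 : ℝ) • (w.2 - z.2)) (Ioi (0 : ℝ) ×ˢ A) :=
      hφ.continuousOn_grad.add (by fun_prop)
    simpa using (hc z hz).tendsto
  obtain ⟨r, hr, hnear⟩ := Metric.mem_nhdsWithin_iff.1 ((hmax.and
    (htime.eventually (Metric.ball_mem_nhds _ hε))).and
      (hgrad.eventually (Metric.ball_mem_nhds _ hε)))
  have hz0 : 0 < z.1 := hz.1
  set r' := min (r / 2) (z.1 / 2)
  have hr'r : r' < r := (min_le_left _ _).trans_lt (by linarith)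
  obtain ⟨z', hz'1, hz'2, hz'r, k, hk, hq'⟩ := hA.exists_interior_touching hu hz hφ
    (lt_min (by linarith) (by linarith) : 0 < r') ((min_le_right _ _).trans_lt (by linarith))
    fun w hw => (hnear ⟨Metric.closedBall_subset_ball hr'r hw.2, hw.1⟩).1.1
  obtain ⟨⟨-, htime'⟩, hgrad'⟩ := hnear ⟨hz'r.trans hr'r, hz'1, interior_subset hz'2⟩
  exact ⟨z', hz'1, hz'2, _, hq', htime', g z' + (2 : ℝ) • (z'.2 - z.2),
    by simpa [dist_eq_norm] using hgrad', by simpa using hk⟩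

theorem exists_le_of_mem_superjet [ProperSpace E] (hA : IsSolidCone A) {H : E → ℝ}
    (hH : Continuous H) (hu : IsViscositySubsolution A H u) {S : Set E} (hS : IsCompact S)
    (hgrad : ∀ z : ℝ × E, 0 < z.1 → z.2 ∈ interior A → ∀ q ∈ superjet A u z, q.2 ∈ S)
    (hz : z ∈ Ioi (0 : ℝ) ×ˢ A) (hq : q ∈ superjet A u z) :
    ∃ Q ∈ S, q.2 - Q ∈ dualCone A ∧ q.1 ≤ H Q := by
  have happrox : ∀ n : ℕ, ∃ (q' : ℝ × E) (Q : E), q'.2 ∈ S ∧ q'.1 ≤ H q'.2 ∧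
      |q'.1 - q.1| < 1 / ((n : ℝ) + 1) ∧ ‖Q - q.2‖ < 1 / ((n : ℝ) + 1) ∧
      Q - q'.2 ∈ dualCone A := fun n => by
    obtain ⟨z', hz'1, hz'2, q', hq', htime, Q, hQ, hdual⟩ :=
      hA.exists_superjet_interior hu.1 hz hq (Nat.one_div_pos_of_nat (n := n))
    exact ⟨q', Q, hgrad z' hz'1 hz'2 q' hq',
      hu.le_of_mem_superjet ⟨hz'1, interior_subset hz'2⟩ hq', htime, hQ, hdual⟩
  choose q' Q hq'S hle htime hQ hdual using happrox
  obtain ⟨Q₀, hQ₀, θ, hθ, hlim⟩ := hS.tendsto_subseq hq'S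
  have htime_lim : Tendsto (fun n => (q' n).1) atTop (𝓝 q.1) :=
    tendsto_iff_norm_sub_tendsto_zero.2 (squeeze_zero (fun _ => norm_nonneg _)
      (fun n => (htime n).le) tendsto_one_div_add_atTop_nhds_zero_nat)
  have hQ_lim : Tendsto Q atTop (𝓝 q.2) :=
    tendsto_iff_norm_sub_tendsto_zero.2 (squeeze_zero (fun _ => norm_nonneg _)
      (fun n => (hQ n).le) tendsto_one_div_add_atTop_nhds_zero_nat)
  refine ⟨Q₀, hQ₀, ?_, ?_⟩
  · exact (isClosed_dualCone A).mem_of_tendsto ((hQ_lim.comp hθ.tendsto_atTop).sub hlim)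
      (Eventually.of_forall fun n => hdual _)
  · exact le_of_tendsto_of_tendsto' (htime_lim.comp hθ.tendsto_atTop)
      ((hH.tendsto Q₀).comp hlim) fun n => hle _

end IsSolidCone

end Boundary

/-! ### Comparison principles -/

section Comparison

variable {E : Type*} [NormedAddCommGroup E] [InnerProductSpace ℝ E] {A : Set E}

/-- Uniform limits from above of functions with quadratic expansions and bounded gradients: these
are the functions that can serve as spatial penalties when doubling variables. -/
def IsSmoothable (N : E → ℝ) : Prop :=
  ∀ δ > 0, ∃ (ρ : E → ℝ) (g : E → E) (R : ℝ), HasQuadraticExpansion ρ g ∧ Continuous ρ ∧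
    (∀ x, N x ≤ ρ x) ∧ (∀ x, ρ x ≤ N x + δ) ∧ ∀ x, ‖g x‖ ≤ R

theorem exists_modulus {F : Type*} [NormedAddCommGroup F] [ProperSpace F] {H : F → ℝ}
    (hH : Continuous H) (R : ℝ) {δ : ℝ} (hδ : 0 < δ) :
    ∃ c > 0, ∀ q k, ‖q‖ ≤ R → ‖k‖ ≤ c → H (q + k) ≤ H q + δ := by
  obtain ⟨c, hc, hcH⟩ := Metric.uniformContinuousOn_iff.1
    ((isCompact_closedBall (0 : F) (R + 1)).uniformContinuousOn_of_continuous hH.continuousOn) δ hδ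
  refine ⟨min (c / 2) 1, by positivity, fun q k hq hk => ?_⟩
  have hkc : ‖k‖ < c := (hk.trans (min_le_left _ _)).trans_lt (half_lt_self hc)
  have hk1 : ‖k‖ ≤ 1 := hk.trans (min_le_right _ _)
  have hdist := hcH (q + k) (mem_closedBall_zero_iff.2 ((norm_add_le q k).trans (by linarith))) q
    (mem_closedBall_zero_iff.2 (by linarith)) (by rwa [dist_self_add_left])
  linarith [(abs_lt.1 hdist).2]

variable {H : E → ℝ} {f : ℝ → E → ℝ} {M M' : ℝ} {t h : ℝ} {x y : E}

theorem IsViscositySolution.sub_le_of_initial_of_smooth [ProperSpace E] (hA : IsClosed A)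
    (hf : IsViscositySolution A H f) {ρ : E → ℝ} {g : E → E} (hρ : HasQuadraticExpansion ρ g)
    (hρc : Continuous ρ) (hM : 0 ≤ M) (hM' : 0 ≤ M')
    (hinit : ∀ x ∈ A, ∀ y ∈ A, f 0 x - f 0 y ≤ ρ (x - y))
    (hup : ∀ t, 0 ≤ t → ∀ x ∈ A, f t x ≤ f 0 x + M * t)
    (hlow : ∀ t, 0 ≤ t → ∀ x ∈ A, f 0 x - M' * t ≤ f t x)
    {c R γ : ℝ} (hc : 0 < c) (hγ : 0 ≤ γ) (hgR : ∀ x, ‖g x‖ ≤ R)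
    (hmodulus : ∀ q k, ‖q‖ ≤ R + c → ‖k‖ ≤ c → H (q + k) ≤ H q + γ)
    (ht : 0 ≤ t) (hh : 0 ≤ h) (hx : x ∈ A) (hy : y ∈ A) :
    f (t + h) x - f t y ≤
      ρ (x - y) + c * softNorm 1 (x - y) + c * softNorm 1 x + γ * t + M * h := by
  have hσ := hasQuadraticExpansion_softNorm (V := E) one_pos
  have hρσ := hρ.add (hσ.const_mul c)
  have hσc := continuous_softNorm (V := E) 1
  have hsoft : ∀ z : E, ‖c • (softNorm 1 z)⁻¹ • z‖ ≤ c := fun z => by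
    rw [norm_smul, Real.norm_of_nonneg hc.le]
    exact mul_le_of_le_one_right hc.le (norm_inv_softNorm_smul_le one_pos z)
  refine doubling_of_variables (Φ := fun x y =>
      ρ (x - y) + c * softNorm 1 (x - y) + c * softNorm 1 x)
    (G := fun x y => g (x - y) + c • (softNorm 1 (x - y))⁻¹ • (x - y) + c • (softNorm 1 x)⁻¹ • x)
    (G' := fun x y => g (x - y) + c • (softNorm 1 (x - y))⁻¹ • (x - y)) (c := c / 2)
    hA hA hf.1.1 hf.2.1 (by fun_prop) (fun y => (hρσ.comp_sub_const y).add (hσ.const_mul c))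
    (fun x => ?_) (half_pos hc) hM hM' hγ hh ?_ ?_ ht hx hy
  · exact ((hρσ.comp_const_sub_clm (ContinuousLinearMap.id ℝ E) id (fun _ _ => rfl) x).add
      (.const (c * softNorm 1 x))).neg.congr (fun y => rfl) (fun y => by simp)
  · intro t ht x hx s hs y hy
    have hxy := hinit x hx y hy
    have htriangle : ‖y‖ ≤ ‖x‖ + ‖x - y‖ := norm_le_norm_add_norm_sub x y
    have hsoft_x := mul_le_mul_of_nonneg_left (norm_le_softNorm 1 x) hc.le
    have hsoft_xy := mul_le_mul_of_nonneg_left (norm_le_softNorm 1 (x - y)) hc.le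
    have htriangle_c := mul_le_mul_of_nonneg_left htriangle hc.le
    have hxy0 := mul_nonneg hc.le (norm_nonneg (x - y))
    linarith [hup t ht x hx, hlow s hs y hy]
  · intro t ht x hx s hs y hy a a' hsuper hsub
    have hle := hf.1.le_of_mem_superjet (z := (t, x)) ⟨ht, hx⟩ hsuper
    have hge := hf.2.le_of_mem_subjet (z := (s, y)) ⟨hs, hy⟩ hsub
    have hH := hmodulus _ _ ((norm_add_le _ _).trans (add_le_add (hgR (x - y)) (hsoft (x - y))))
      (hsoft x)
    exact (hle.trans hH).trans (by simpa using hge)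

theorem IsViscositySolution.sub_le_of_initial [ProperSpace E] (hA : IsClosed A)
    (hH : Continuous H) (hf : IsViscositySolution A H f) {N : E → ℝ} (hN : IsSmoothable N)
    (hM : 0 ≤ M) (hM' : 0 ≤ M') (hinit : ∀ x ∈ A, ∀ y ∈ A, f 0 x - f 0 y ≤ N (x - y))
    (hup : ∀ t, 0 ≤ t → ∀ x ∈ A, f t x ≤ f 0 x + M * t)
    (hlow : ∀ t, 0 ≤ t → ∀ x ∈ A, f 0 x - M' * t ≤ f t x)
    (ht : 0 ≤ t) (hh : 0 ≤ h) (hx : x ∈ A) (hy : y ∈ A) :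
    f (t + h) x - f t y ≤ N (x - y) + M * h := by
  have happrox : ∀ δ > 0, f (t + h) x - f t y ≤
      N (x - y) + M * h + δ * (1 + softNorm 1 (x - y) + softNorm 1 x + t) := by
    intro δ hδ
    obtain ⟨ρ, g, R, hρ, hρc, hNρ, hρN, hgR⟩ := hN δ hδ
    obtain ⟨c₀, hc₀, hmodulus⟩ := exists_modulus hH (R + δ) hδ
    have hle := hf.sub_le_of_initial_of_smooth hA hρ hρc hM hM'
      (fun x hx y hy => (hinit x hx y hy).trans (hNρ _)) hup hlow (lt_min hc₀ hδ) hδ.le hgR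
      (fun q k hq hk => hmodulus q k (hq.trans (add_le_add le_rfl (min_le_right _ _)))
        (hk.trans (min_le_left _ _))) ht hh hx hy
    have hxy := mul_le_mul_of_nonneg_right (min_le_right c₀ δ) (softNorm_pos one_pos (x - y)).le
    have hx' := mul_le_mul_of_nonneg_right (min_le_right c₀ δ) (softNorm_pos one_pos x).le
    linarith [hρN (x - y)]
  have hlimit := le_apply_zero_of_eventually
    (f := fun δ => N (x - y) + M * h + δ * (1 + softNorm 1 (x - y) + softNorm 1 x + t))
    (by fun_prop) (by filter_upwards [self_mem_nhdsWithin] with δ hδ using happrox δ hδ)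
  rwa [zero_mul, add_zero] at hlimit

variable {E' : Type*} [NormedAddCommGroup E'] [InnerProductSpace ℝ E'] {A' : Set E'}
  {u : ℝ → E → ℝ} {v : ℝ → E' → ℝ}

theorem sub_le_of_link_of_soft [ProperSpace E] [ProperSpace E'] (hA : IsClosed A)
    (hA' : IsClosed A') (hu : ContinuousOn (fun z : ℝ × E => u z.1 z.2) (Ici (0 : ℝ) ×ˢ A))
    (hv : ContinuousOn (fun z : ℝ × E' => v z.1 z.2) (Ici (0 : ℝ) ×ˢ A'))
    (p : E' →L[ℝ] E) (e : E → E') (hpe : ∀ x y, inner ℝ (e x) y = inner ℝ x (p y))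
    (hp : ∀ y, ‖p y‖ ≤ ‖y‖) (hpA : ∀ y ∈ A', p y ∈ A)
    {L κ Λ c : ℝ} (hL : 0 ≤ L) (hκ : 0 ≤ κ) (hΛ : 0 ≤ Λ) (hM : 0 ≤ M) (hM' : 0 ≤ M') (hc : 0 < c)
    (hgrowth : ∀ t, 0 ≤ t → ∀ x ∈ A, ∀ s, 0 ≤ s → ∀ y ∈ A',
      u t x - v s y ≤ L * ‖x - p y‖ + κ * ‖y‖ + M * t + M' * s)
    (hjet : ∀ t, 0 < t → ∀ x ∈ A, ∀ s, 0 < s → ∀ y ∈ A', ∀ (g : E) (ρ : E') (a a' : ℝ),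
      ‖ρ‖ ≤ κ + c → (a, g) ∈ superjet A u (t, x) → (a', e g - ρ) ∈ subjet A' v (s, y) →
      a ≤ a' + Λ * (κ + c))
    (ht : 0 ≤ t) {y : E'} (hy : y ∈ A') :
    u t (p y) - v t y ≤ (L + c) * c + (κ + c) * (c + ‖y‖) + Λ * (κ + c) * t := by
  have hσ := (hasQuadraticExpansion_softNorm (V := E) hc).const_mul (L + c)
  have hσ' := (hasQuadraticExpansion_softNorm (V := E') hc).const_mul (κ + c)
  have hσc := continuous_softNorm (V := E) c
  have hσc' := continuous_softNorm (V := E') c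
  have hle := doubling_of_variables
    (Φ := fun x y => (L + c) * softNorm c (x - p y) + (κ + c) * softNorm c y)
    (G := fun x y => (L + c) • (softNorm c (x - p y))⁻¹ • (x - p y))
    (G' := fun x y => e ((L + c) • (softNorm c (x - p y))⁻¹ • (x - p y)) -
      (κ + c) • (softNorm c y)⁻¹ • y)
    (c := c / 2) (γ := Λ * (κ + c)) (h := 0) hA hA' hu hv (by fun_prop)
    (fun y => ((hσ.comp_sub_const (p y)).add (.const ((κ + c) * softNorm c y))).congr
      (fun x => rfl) (fun x => (add_zero _).symm))
    (fun x => ((hσ.comp_const_sub_clm p e hpe x).add hσ').neg.congr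
      (fun y => rfl) (fun y => by abel))
    (half_pos hc) hM hM' (by positivity) le_rfl
    (fun t ht x hx s hs y hy => by
      have htriangle : ‖x‖ ≤ ‖y‖ + ‖x - p y‖ := by
        linarith [norm_le_norm_add_norm_sub' x (p y), hp y]
      have hsoft_x := mul_le_mul_of_nonneg_left (norm_le_softNorm c (x - p y))
        (by positivity : 0 ≤ L + c)
      have hsoft_y := mul_le_mul_of_nonneg_left (norm_le_softNorm c y) (by positivity : 0 ≤ κ + c)
      have htriangle_c := mul_le_mul_of_nonneg_left htriangle hc.le
      have hx0 := mul_nonneg hc.le (norm_nonneg (x - p y))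
      linarith [hgrowth t ht x hx s hs y hy])
    (fun t ht x hx s hs y hy a a' hsuper hsub => hjet t ht x hx s hs y hy _ _ a a' (by
      rw [norm_smul, Real.norm_of_nonneg (by positivity)]
      exact mul_le_of_le_one_right (by positivity) (norm_inv_softNorm_smul_le hc y)) hsuper hsub)
    ht (hpA y hy) hy
  have hsoft_y := mul_le_mul_of_nonneg_left (softNorm_le hc.le y) (by positivity : 0 ≤ κ + c)
  simp only [add_zero, mul_zero, sub_self, softNorm_zero hc.le] at hle
  linarith

theorem sub_le_of_link [ProperSpace E] [ProperSpace E'] (hA : IsClosed A)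
    (hA' : IsClosed A') (hu : ContinuousOn (fun z : ℝ × E => u z.1 z.2) (Ici (0 : ℝ) ×ˢ A))
    (hv : ContinuousOn (fun z : ℝ × E' => v z.1 z.2) (Ici (0 : ℝ) ×ˢ A'))
    (p : E' →L[ℝ] E) (e : E → E') (hpe : ∀ x y, inner ℝ (e x) y = inner ℝ x (p y))
    (hp : ∀ y, ‖p y‖ ≤ ‖y‖) (hpA : ∀ y ∈ A', p y ∈ A)
    {L κ Λ r : ℝ} (hL : 0 ≤ L) (hκ : 0 ≤ κ) (hΛ : 0 ≤ Λ) (hM : 0 ≤ M) (hM' : 0 ≤ M') (hκr : κ < r)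
    (hgrowth : ∀ t, 0 ≤ t → ∀ x ∈ A, ∀ s, 0 ≤ s → ∀ y ∈ A',
      u t x - v s y ≤ L * ‖x - p y‖ + κ * ‖y‖ + M * t + M' * s)
    (hjet : ∀ t, 0 < t → ∀ x ∈ A, ∀ s, 0 < s → ∀ y ∈ A', ∀ (g : E) (ρ : E') (a a' b : ℝ),
      ‖ρ‖ ≤ b → b ≤ r → (a, g) ∈ superjet A u (t, x) → (a', e g - ρ) ∈ subjet A' v (s, y) →
      a ≤ a' + Λ * b)
    (ht : 0 ≤ t) {y : E'} (hy : y ∈ A') :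
    u t (p y) - v t y ≤ κ * ‖y‖ + Λ * κ * t := by
  have hsmall : ∀ᶠ c in 𝓝[>] (0 : ℝ), c < r - κ :=
    nhdsWithin_le_nhds (eventually_lt_nhds (sub_pos.2 hκr))
  have hlimit := le_apply_zero_of_eventually (a := u t (p y) - v t y)
    (f := fun c => (L + c) * c + (κ + c) * (c + ‖y‖) + Λ * (κ + c) * t) (by fun_prop) <| by
      filter_upwards [self_mem_nhdsWithin, hsmall] with c hc hcr
      exact sub_le_of_link_of_soft hA hA' hu hv p e hpe hp hpA hL hκ hΛ hM hM' hc hgrowth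
        (fun t ht x hx s hs y hy g ρ a a' hρ =>
          hjet t ht x hx s hs y hy g ρ a a' _ hρ (by linarith)) ht hy
  simpa using hlimit

theorem le_time_derivative_of_mem_subjet {f₀ : E → ℝ} {z q : ℝ × E}
    (hz : z ∈ Ioi (0 : ℝ) ×ˢ A) (hq : q ∈ subjet A (fun s y => f₀ y + M * s) z) : M ≤ q.1 := by
  have hpast : ∀ᶠ ε in 𝓝[>] (0 : ℝ), ε < z.1 := nhdsWithin_le_nhds (eventually_lt_nhds hz.1)
  have hle := neg_le_of_mem_superjet hz (neg_mem_superjet_neg hq) (d := (-1, 0)) (m := -M) <| by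
    filter_upwards [hpast] with ε hε
    refine ⟨⟨?_, by simpa using hz.2⟩, ?_⟩
    · simpa using hε
    · simp only [Pi.neg_apply, Prod.fst_add, Prod.snd_add, Prod.smul_fst, Prod.smul_snd, smul_zero,
        add_zero, smul_eq_mul]
      linarith
  simp only [Prod.fst_neg, Prod.snd_neg, inner_zero_right] at hle
  linarith

theorem le_initial_add_mul [ProperSpace E] (hA : IsClosed A)
    (hf : ContinuousOn (fun z : ℝ × E => f z.1 z.2) (Ici (0 : ℝ) ×ˢ A))
    {L M₀ : ℝ} (hL : 0 ≤ L) (hM₀ : 0 ≤ M₀)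
    (hinit : ∀ x ∈ A, ∀ y ∈ A, f 0 x - f 0 y ≤ L * ‖x - y‖)
    (hup : ∀ t, 0 ≤ t → ∀ x ∈ A, f t x ≤ f 0 x + M₀ * t)
    (hjet : ∀ z ∈ Ioi (0 : ℝ) ×ˢ A, ∀ q ∈ superjet A f z, q.1 ≤ M)
    (ht : 0 ≤ t) (hx : x ∈ A) : f t x ≤ f 0 x + M * t := by
  have hf0 : ContinuousOn (f 0) A :=
    hf.comp (f := fun x => ((0 : ℝ), x)) (by fun_prop) fun x hx => ⟨self_mem_Ici, hx⟩
  have hle := sub_le_of_link (u := f) (v := fun s y => f 0 y + M * s) (κ := 0) (Λ := 0)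
    (r := 1) (M' := |M|) hA hA hf
    ((hf0.comp continuous_snd.continuousOn fun w hw => hw.2).add (by fun_prop))
    (ContinuousLinearMap.id ℝ E) id (fun _ _ => rfl) (fun _ => le_rfl) (fun _ hy => hy) hL le_rfl
    le_rfl hM₀ (abs_nonneg M) zero_lt_one
    (fun t ht x hx s hs y hy => by
      have hxy := hinit x hx y hy
      simp only [ContinuousLinearMap.id_apply]
      linarith [hup t ht x hx, mul_le_mul_of_nonneg_right (neg_abs_le M) hs])
    (fun t ht x hx s hs y hy g ρ a a' b _ _ hsuper hsub => by
      linarith [hjet (t, x) ⟨ht, hx⟩ _ hsuper,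
        le_time_derivative_of_mem_subjet (z := (s, y)) ⟨hs, hy⟩ hsub])
    ht hx
  simp only [ContinuousLinearMap.id_apply] at hle
  linarith

end Comparison

/-! ### Symmetric matrices -/

namespace SymMat

variable {D : ℕ}

theorem inner_eq_sum (a b : SymMat D) : inner ℝ a b = ∑ i, ∑ k,
    (a : EuclideanSpace ℝ (Fin D × Fin D)) (i, k) *
      (b : EuclideanSpace ℝ (Fin D × Fin D)) (i, k) := by
  rw [Submodule.coe_inner, PiLp.inner_apply, Fintype.sum_prod_type]
  refine Finset.sum_congr rfl fun i _ => Finset.sum_congr rfl fun k _ => ?_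
  rw [real_inner_comm, RCLike.inner_apply, conj_trivial, mul_comm]

/-- The rank one matrix `v vᵀ`. -/
def outer (v : Fin D → ℝ) : SymMat D :=
  ⟨WithLp.toLp 2 fun q => v q.1 * v q.2, fun i k => by simp [mul_comm]⟩

theorem outer_apply (v : Fin D → ℝ) (i k : Fin D) :
    (outer v : EuclideanSpace ℝ (Fin D × Fin D)) (i, k) = v i * v k := rfl

theorem inner_outer (a : SymMat D) (v : Fin D → ℝ) :
    inner ℝ a (outer v) = v ⬝ᵥ (toMatrix a).mulVec v := by
  rw [inner_eq_sum]
  simp only [outer_apply, dotProduct, Matrix.mulVec, Finset.mul_sum, toMatrix, Matrix.of_apply]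
  refine Finset.sum_congr rfl fun i _ => Finset.sum_congr rfl fun k _ => ?_
  ring

theorem isPSD_iff {a : SymMat D} : IsPSD a ↔ ∀ v, 0 ≤ inner ℝ a (outer v) := by
  simp only [inner_outer]
  constructor
  · intro h v
    simpa using h.dotProduct_mulVec_nonneg v
  · intro h
    refine Matrix.PosSemidef.of_dotProduct_mulVec_nonneg ?_ fun v => by simpa using h v
    ext i k
    simpa [toMatrix, Matrix.conjTranspose] using a.2 k i

theorem isPSD_zero : IsPSD (0 : SymMat D) := isPSD_iff.2 fun v => by simp

theorem IsPSD.add {a b : SymMat D} (ha : IsPSD a) (hb : IsPSD b) : IsPSD (a + b) :=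
  isPSD_iff.2 fun v => by
    rw [inner_add_left]
    exact add_nonneg (isPSD_iff.1 ha v) (isPSD_iff.1 hb v)

theorem IsPSD.smul {a : SymMat D} (ha : IsPSD a) {c : ℝ} (hc : 0 ≤ c) : IsPSD (c • a) :=
  isPSD_iff.2 fun v =>
    (mul_nonneg hc (isPSD_iff.1 ha v)).trans_eq (real_inner_smul_left a (outer v) c).symm

theorem isClosed_isPSD : IsClosed {a : SymMat D | IsPSD a} := by
  simp only [isPSD_iff, Set.ofPred_forall]
  exact isClosed_iInter fun v => isClosed_le continuous_const (by fun_prop)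

/-- The identity matrix. -/
def one : SymMat D :=
  ⟨WithLp.toLp 2 fun q => if q.1 = q.2 then 1 else 0, fun i k => by simp [eq_comm]⟩

theorem inner_one_outer (v : Fin D → ℝ) : inner ℝ (one : SymMat D) (outer v) = ∑ i, v i ^ 2 := by
  rw [inner_eq_sum]
  simp [one, outer_apply, sq]

theorem norm_outer (v : Fin D → ℝ) : ‖outer v‖ = ∑ i, v i ^ 2 := by
  have hsq : ‖outer v‖ ^ 2 = (∑ i, v i ^ 2) ^ 2 := by
    rw [← real_inner_self_eq_norm_sq, inner_eq_sum, sq (∑ i, v i ^ 2), Finset.sum_mul_sum]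
    refine Finset.sum_congr rfl fun i _ => Finset.sum_congr rfl fun k _ => ?_
    rw [outer_apply]
    ring
  exact (sq_eq_sq₀ (norm_nonneg _) (Finset.sum_nonneg fun i _ => sq_nonneg _)).1 hsq

theorem isPSD_smul_one_add {c : ℝ} {b : SymMat D} (hb : ‖b‖ ≤ c) : IsPSD (c • one + b) := by
  refine isPSD_iff.2 fun v => ?_
  have hone : inner ℝ (c • one) (outer v) = c * ‖outer v‖ := by
    rw [norm_outer, ← inner_one_outer]
    exact real_inner_smul_left one (outer v) c
  rw [inner_add_left, hone]
  linarith [neg_le_of_abs_le (abs_real_inner_le_norm b (outer v)),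
    mul_le_mul_of_nonneg_right hb (norm_nonneg (outer v))]

/-- The trace, written as an inner product so that it is visibly linear and continuous. -/
noncomputable def tr (a : SymMat D) : ℝ := inner ℝ a one

theorem tr_sub (a b : SymMat D) : tr (a - b) = tr a - tr b := inner_sub_left _ _ _

theorem tr_eq_sum (a : SymMat D) :
    tr a = ∑ i, (a : EuclideanSpace ℝ (Fin D × Fin D)) (i, i) := by
  rw [tr, inner_eq_sum]
  simp [one]

theorem IsPSD.diag_nonneg {a : SymMat D} (ha : IsPSD a) (i : Fin D) :
    0 ≤ (a : EuclideanSpace ℝ (Fin D × Fin D)) (i, i) := by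
  have hsingle := isPSD_iff.1 ha (Pi.single i 1)
  rw [inner_eq_sum] at hsingle
  simpa [outer_apply, Pi.single_apply] using hsingle

theorem IsPSD.tr_nonneg {a : SymMat D} (ha : IsPSD a) : 0 ≤ tr a := by
  rw [tr_eq_sum]
  exact Finset.sum_nonneg fun i _ => ha.diag_nonneg i

theorem IsPSD.diag_le_tr {a : SymMat D} (ha : IsPSD a) (i : Fin D) :
    (a : EuclideanSpace ℝ (Fin D × Fin D)) (i, i) ≤ tr a := by
  rw [tr_eq_sum]
  exact Finset.single_le_sum (fun i _ => ha.diag_nonneg i) (Finset.mem_univ i)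

theorem IsPSD.two_minor_nonneg {a : SymMat D} (ha : IsPSD a) (i k : Fin D) (σ : ℝ) :
    0 ≤ (a : EuclideanSpace ℝ (Fin D × Fin D)) (i, i) +
      σ ^ 2 * (a : EuclideanSpace ℝ (Fin D × Fin D)) (k, k) +
      2 * σ * (a : EuclideanSpace ℝ (Fin D × Fin D)) (i, k) := by
  have hpair := isPSD_iff.1 ha (Pi.single i 1 + Pi.single k σ)
  rw [inner_outer] at hpair
  simp only [toMatrix, Matrix.mulVec_add, Matrix.mulVec_single, MulOpposite.op_one, one_smul,
    dotProduct_add, add_dotProduct, single_dotProduct, Matrix.col_apply, Matrix.of_apply, one_mul,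
    Pi.smul_apply, MulOpposite.smul_eq_mul_unop, MulOpposite.unop_op] at hpair
  rw [← a.2 i k] at hpair
  linarith

theorem IsPSD.abs_apply_le {a : SymMat D} (ha : IsPSD a) (i k : Fin D) :
    |(a : EuclideanSpace ℝ (Fin D × Fin D)) (i, k)| ≤ tr a := by
  have hplus := ha.two_minor_nonneg i k 1
  have hminus := ha.two_minor_nonneg i k (-1)
  rw [abs_le]
  constructor <;> linarith [ha.diag_le_tr i, ha.diag_le_tr k]

theorem IsPSD.norm_le {a : SymMat D} (ha : IsPSD a) : ‖a‖ ≤ D * tr a := by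
  have hsq : ‖a‖ ^ 2 ≤ (D * tr a) ^ 2 := by
    rw [← real_inner_self_eq_norm_sq, inner_eq_sum]
    calc _ ≤ ∑ _i : Fin D, ∑ _k : Fin D, tr a ^ 2 :=
          Finset.sum_le_sum fun i _ => Finset.sum_le_sum fun k _ => by
            rw [← sq]
            exact sq_le_sq' (neg_le_of_abs_le (ha.abs_apply_le i k))
              (le_of_abs_le (ha.abs_apply_le i k))
      _ = (D * tr a) ^ 2 := by
          simp only [Finset.sum_const, Finset.card_univ, Fintype.card_fin, nsmul_eq_mul]
          ring
  exact le_of_sq_le_sq hsq (mul_nonneg D.cast_nonneg ha.tr_nonneg)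

end SymMat

/-! ### Partitions and step spaces -/

namespace UnitPartition

theorem n_pos (j : UnitPartition) : 0 < j.n := by
  obtain ⟨_ | n, t, -, h0, h1⟩ := j
  · exact absurd (h0.symm.trans h1) zero_ne_one
  · exact n.succ_pos

theorem measurableSet_cell (j : UnitPartition) (k : Fin j.n) : MeasurableSet (j.cell k) :=
  measurableSet_Ico

theorem t_mem (j : UnitPartition) (k : Fin (j.n + 1)) : j.t k ∈ Icc (0 : ℝ) 1 := by
  rw [← j.zero, ← j.one]
  exact ⟨j.strictMono.monotone (Fin.zero_le k), j.strictMono.monotone (Fin.le_last k)⟩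

theorem cell_subset (j : UnitPartition) (k : Fin j.n) : j.cell k ⊆ Ico (0 : ℝ) 1 :=
  fun _ hs => ⟨(j.t_mem _).1.trans hs.1, hs.2.trans_le (j.t_mem _).2⟩

theorem t_castSucc_mem (j : UnitPartition) (k : Fin j.n) : j.t k.castSucc ∈ j.cell k :=
  ⟨le_rfl, j.strictMono Fin.castSucc_lt_succ⟩

theorem exists_not_castSucc_and_succ (j : UnitPartition) {p : ℝ → Prop} (h0 : ¬p 0) (h1 : p 1) :
    ∃ k : Fin j.n, ¬p (j.t k.castSucc) ∧ p (j.t k.succ) := by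
  by_contra! h
  refine Fin.induction (motive := fun i => ¬p (j.t i)) ?_ h (Fin.last j.n) ?_
  · rwa [j.zero]
  · rwa [j.one]

theorem exists_mem_cell (j : UnitPartition) {s : ℝ} (hs : s ∈ Ico (0 : ℝ) 1) :
    ∃ k, s ∈ j.cell k := by
  obtain ⟨k, hk, hk'⟩ := j.exists_not_castSucc_and_succ (p := (s < ·)) (not_lt.2 hs.1) hs.2
  exact ⟨k, not_lt.1 hk, hk'⟩

theorem exists_mem_Ioc (j : UnitPartition) {s : ℝ} (hs : s ∈ Ioc (0 : ℝ) 1) :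
    ∃ k : Fin j.n, s ∈ Ioc (j.t k.castSucc) (j.t k.succ) := by
  obtain ⟨k, hk, hk'⟩ := j.exists_not_castSucc_and_succ (p := (s ≤ ·)) (not_le.2 hs.1) hs.2
  exact ⟨k, not_le.1 hk, hk'⟩

theorem le_of_mem_cell (j : UnitPartition) {s s' : ℝ} (h : s ≤ s') {k l : Fin j.n}
    (hk : s ∈ j.cell k) (hl : s' ∈ j.cell l) : k ≤ l := by
  by_contra! hlt
  have hend : j.t l.succ ≤ j.t k.castSucc := j.strictMono.monotone (Fin.succ_le_castSucc_iff.2 hlt)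
  linarith [hk.1, hl.2]

theorem eq_of_mem_cell (j : UnitPartition) {s : ℝ} {k l : Fin j.n}
    (hk : s ∈ j.cell k) (hl : s ∈ j.cell l) : k = l :=
  le_antisymm (j.le_of_mem_cell le_rfl hk hl) (j.le_of_mem_cell le_rfl hl hk)

theorem iUnion_cell (j : UnitPartition) : ⋃ k, j.cell k = Ico (0 : ℝ) 1 :=
  Subset.antisymm (iUnion_subset j.cell_subset) fun _ hs => mem_iUnion.2 (j.exists_mem_cell hs)

theorem pairwise_disjoint_cell (j : UnitPartition) : Pairwise (Function.onFun Disjoint j.cell) :=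
  fun _ _ hkl => Set.disjoint_left.2 fun _ hk hl => hkl (j.eq_of_mem_cell hk hl)

theorem restrict_cell (j : UnitPartition) (k : Fin j.n) :
    unitMeasure.restrict (j.cell k) = volume.restrict (j.cell k) := by
  rw [unitMeasure, Measure.restrict_restrict (j.measurableSet_cell k),
    inter_eq_left.2 (j.cell_subset k)]

theorem volume_cell (j : UnitPartition) (k : Fin j.n) :
    volume.real (j.cell k) = j.len k := by
  rw [cell, Real.volume_real_Ico_of_le (sub_nonneg.1 (j.len_pos k).le), len]

theorem sum_len (j : UnitPartition) : ∑ k, j.len k = 1 := by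
  have hsum := (Fin.sum_univ_succ j.t).symm.trans (Fin.sum_univ_castSucc j.t)
  rw [j.zero, j.one] at hsum
  simp only [len, Finset.sum_sub_distrib]
  linarith

theorem exists_cell_subset {j j' : UnitPartition} (h : j ≤ j') (m : Fin j'.n) :
    ∃ k, j'.cell m ⊆ j.cell k := by
  obtain ⟨k, hk⟩ := j.exists_mem_cell (j'.cell_subset m (j'.t_castSucc_mem m))
  refine ⟨k, fun s hs => ⟨hk.1.trans hs.1, hs.2.trans_le ?_⟩⟩
  obtain ⟨i, hi⟩ := h ⟨k.succ, rfl⟩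
  have hlt : m.castSucc < i := j'.strictMono.lt_iff_lt.1 (by rw [hi]; exact hk.2)
  rw [← hi]
  exact j'.strictMono.monotone (Fin.castSucc_lt_iff_succ_le.1 hlt)

theorem n_le_of_le {j j' : UnitPartition} (h : j ≤ j') : j.n ≤ j'.n := by
  have hcard : (range j.t).ncard ≤ (range j'.t).ncard := ncard_le_ncard h (finite_range _)
  rw [← image_univ, ← image_univ, ncard_image_of_injective _ j.strictMono.injective,
    ncard_image_of_injective _ j'.strictMono.injective, ncard_univ, ncard_univ] at hcard
  simpa using hcard

theorem IsUniform.len_eq {j : UnitPartition} (h : j.IsUniform) (k : Fin j.n) :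
    j.len k = (j.n : ℝ)⁻¹ := by
  rw [len, h, h, Fin.val_succ, Fin.val_castSucc]
  push_cast
  ring

theorem len_mul_norm_inv_smul {D : ℕ} (j : UnitPartition) (k : Fin j.n) (a : SymMat D) :
    j.len k * ‖(j.len k)⁻¹ • a‖ = ‖a‖ := by
  have hnorm : ‖(j.len k)⁻¹ • a‖ = ‖(j.len k)⁻¹‖ * ‖a‖ := norm_smul _ a
  rw [hnorm, Real.norm_of_nonneg (inv_nonneg.2 (j.len_pos k).le),
    mul_inv_cancel_left₀ (j.len_pos k).ne']

end UnitPartition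

namespace StepSpace

variable {D : ℕ} {j : UnitPartition}

instance : FiniteDimensional ℝ (StepSpace D j) :=
  inferInstanceAs (FiniteDimensional ℝ (Fin j.n → SymMat D))

instance : ProperSpace (StepSpace D j) := FiniteDimensional.proper_real _

theorem inner_def (x y : StepSpace D j) :
    inner ℝ x y = ∑ k, j.len k * inner ℝ (x.coord k) (y.coord k) := rfl

theorem norm_sq_eq (x : StepSpace D j) : ‖x‖ ^ 2 = ∑ k, j.len k * ‖x.coord k‖ ^ 2 := by
  rw [← real_inner_self_eq_norm_sq, inner_def]
  simp only [real_inner_self_eq_norm_sq]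

/-- The `k`-th coordinate as a linear map, from which its continuity follows. -/
def coordₗ (D : ℕ) {j : UnitPartition} (k : Fin j.n) : StepSpace D j →ₗ[ℝ] SymMat D where
  toFun x := x.coord k
  map_add' _ _ := rfl
  map_smul' _ _ := rfl

theorem continuous_coord (k : Fin j.n) : Continuous fun x : StepSpace D j => x.coord k :=
  (coordₗ D k).continuous_of_finiteDimensional

theorem norm_coord_smul (c : ℝ) (x : StepSpace D j) (k : Fin j.n) :
    ‖(c • x).coord k‖ = |c| * ‖x.coord k‖ :=
  norm_smul c (x.coord k)

/-- The element of the step space with value `a` on the `k`-th cell and `0` elsewhere. -/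
def single (k : Fin j.n) (a : SymMat D) : StepSpace D j := Pi.single (M := fun _ => SymMat D) k a

theorem coord_single_same (k : Fin j.n) (a : SymMat D) : (single k a).coord k = a :=
  Pi.single_eq_same (M := fun _ => SymMat D) k a

theorem coord_single_of_ne {k l : Fin j.n} (h : l ≠ k) (a : SymMat D) :
    (single k a).coord l = 0 :=
  Pi.single_eq_of_ne (M := fun _ => SymMat D) h a

theorem inner_single (x : StepSpace D j) (k : Fin j.n) (a : SymMat D) :
    inner ℝ x (single k a) = j.len k * inner ℝ (x.coord k) a := by
  rw [inner_def, Finset.sum_eq_single k, coord_single_same]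
  · intro l _ hl
    rw [coord_single_of_ne hl, inner_zero_right, mul_zero]
  · exact fun h => absurd (Finset.mem_univ k) h

/-- The `L¹` norm on the step space. -/
noncomputable def normL1 (x : StepSpace D j) : ℝ := ∑ k, j.len k * ‖x.coord k‖

/-- A smooth approximation of the `L¹` norm from above, with parameter `c`. -/
noncomputable def softNormL1 (c : ℝ) (x : StepSpace D j) : ℝ :=
  ∑ k, j.len k * softNorm c (x.coord k)

/-- The gradient of `softNormL1 c`. -/
noncomputable def softSign (c : ℝ) (x : StepSpace D j) : StepSpace D j :=
  fun k => (softNorm c (x.coord k))⁻¹ • x.coord k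

theorem continuous_softNormL1 (c : ℝ) :
    Continuous (softNormL1 c : StepSpace D j → ℝ) :=
  continuous_finsetSum _ fun k _ =>
    continuous_const.mul ((continuous_softNorm c).comp (continuous_coord k))

theorem normL1_le_softNormL1 (c : ℝ) (x : StepSpace D j) : normL1 x ≤ softNormL1 c x :=
  Finset.sum_le_sum fun k _ =>
    mul_le_mul_of_nonneg_left (norm_le_softNorm c (x.coord k)) (j.len_pos k).le

theorem softNormL1_le {c : ℝ} (hc : 0 ≤ c) (x : StepSpace D j) :
    softNormL1 c x ≤ c + normL1 x :=
  calc softNormL1 c x ≤ ∑ k, (j.len k * c + j.len k * ‖x.coord k‖) :=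
        Finset.sum_le_sum fun k _ => by
          rw [← mul_add]
          exact mul_le_mul_of_nonneg_left (softNorm_le hc _) (j.len_pos k).le
    _ = c + normL1 x := by
        rw [Finset.sum_add_distrib, ← Finset.sum_mul, j.sum_len, one_mul, normL1]

theorem hasQuadraticExpansion_softNormL1 {c : ℝ} (hc : 0 < c) :
    HasQuadraticExpansion (softNormL1 c : StepSpace D j → ℝ) (softSign c) := by
  refine ⟨c⁻¹, fun x w => ?_⟩
  rw [inner_def, softNormL1, softNormL1, ← Finset.sum_sub_distrib, ← Finset.sum_sub_distrib,
    norm_sq_eq, Finset.mul_sum]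
  refine (Finset.abs_sum_le_sum_abs _ _).trans (Finset.sum_le_sum fun k _ => ?_)
  rw [← mul_sub, ← mul_sub, abs_mul, abs_of_pos (j.len_pos k), mul_left_comm]
  exact mul_le_mul_of_nonneg_left
    (abs_softNorm_sub_sub_inner_le hc (x.coord k) (w.coord k)) (j.len_pos k).le

theorem norm_softSign_le {c : ℝ} (hc : 0 < c) (x : StepSpace D j) : ‖softSign c x‖ ≤ 1 := by
  have hsq : ‖softSign c x‖ ^ 2 ≤ 1 ^ 2 := by
    rw [norm_sq_eq, one_pow, ← j.sum_len]
    exact Finset.sum_le_sum fun k _ => mul_le_of_le_one_right (j.len_pos k).le <|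
      pow_le_one₀ (norm_nonneg _) (norm_inv_softNorm_smul_le hc (x.coord k))
  exact le_of_sq_le_sq hsq zero_le_one

theorem isSmoothable_norms {a b : ℝ} (ha : 0 ≤ a) (hb : 0 ≤ b) :
    IsSmoothable fun x : StepSpace D j => a * normL1 x + b * ‖x‖ := by
  intro δ hδ
  have hc : 0 < δ / (a + b + 1) := by positivity
  have hcδ : (a + b) * (δ / (a + b + 1)) ≤ δ := by
    rw [mul_div_assoc', div_le_iff₀ (by positivity)]
    linarith
  set c := δ / (a + b + 1)
  refine ⟨_, _, a + b, ((hasQuadraticExpansion_softNormL1 hc).const_mul a).add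
    ((hasQuadraticExpansion_softNorm hc).const_mul b),
    (continuous_const.mul (continuous_softNormL1 c)).add
      (continuous_const.mul (continuous_softNorm c)), fun x => ?_, fun x => ?_, fun x => ?_⟩
  · exact add_le_add (mul_le_mul_of_nonneg_left (normL1_le_softNormL1 c x) ha)
      (mul_le_mul_of_nonneg_left (norm_le_softNorm c x) hb)
  · linarith [mul_le_mul_of_nonneg_left (softNormL1_le hc.le x) ha,
      mul_le_mul_of_nonneg_left (softNorm_le hc.le x) hb]
  · refine norm_add_le_of_le ?_ ?_ <;> rw [norm_smul, Real.norm_of_nonneg (by assumption)]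
    · exact mul_le_of_le_one_right ha (norm_softSign_le hc x)
    · exact mul_le_of_le_one_right hb (norm_inv_softNorm_smul_le hc x)

end StepSpace

section StepCone

variable {D : ℕ} {j : UnitPartition}

open StepSpace

theorem isClosed_stepCone (D : ℕ) (j : UnitPartition) : IsClosed (stepCone D j) := by
  simp only [stepCone, Set.ofPred_and, Set.ofPred_forall]
  exact (isClosed_iInter fun k => SymMat.isClosed_isPSD.preimage (continuous_coord k)).inter
    (isClosed_iInter fun k => isClosed_iInter fun l => isClosed_iInter fun _ =>
      SymMat.isClosed_isPSD.preimage ((continuous_coord l).sub (continuous_coord k)))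

/-- The staircase `k ↦ (k + 1) I`, an interior point of the cone. -/
noncomputable def staircase (D : ℕ) (j : UnitPartition) : StepSpace D j :=
  fun k => ((k : ℕ) + 1 : ℝ) • SymMat.one

theorem coord_staircase (k : Fin j.n) :
    (staircase D j).coord k = ((k : ℕ) + 1 : ℝ) • SymMat.one := rfl

theorem mem_stepCone_of_close_staircase {y : StepSpace D j}
    (hy : ∀ k, ‖y.coord k - (staircase D j).coord k‖ < 1 / 2) : y ∈ stepCone D j := by
  refine ⟨fun k => ?_, fun k l hkl => ?_⟩
  · have hsplit : y.coord k =
        ((k : ℕ) + 1 : ℝ) • SymMat.one + (y.coord k - (staircase D j).coord k) := by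
      rw [coord_staircase]
      abel
    rw [hsplit]
    exact SymMat.isPSD_smul_one_add
      ((hy k).le.trans (by linarith [(k : ℕ).cast_nonneg (α := ℝ)]))
  · rcases hkl.eq_or_lt with rfl | hlt
    · rw [sub_self]
      exact SymMat.isPSD_zero
    have hsplit : y.coord l - y.coord k = ((l : ℕ) - (k : ℕ) : ℝ) • SymMat.one +
        ((y.coord l - (staircase D j).coord l) - (y.coord k - (staircase D j).coord k)) := by
      rw [coord_staircase, coord_staircase]
      module
    rw [hsplit]
    have hkl' : ((k : ℕ) : ℝ) + 1 ≤ (l : ℕ) := by exact_mod_cast hlt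
    exact SymMat.isPSD_smul_one_add ((norm_sub_le _ _).trans (by linarith [hy k, hy l]))

theorem isSolidCone_stepCone (D : ℕ) (j : UnitPartition) : IsSolidCone (stepCone D j) where
  isClosed := isClosed_stepCone D j
  add_mem x hx y hy := by
    refine ⟨fun k => (hx.1 k).add (hy.1 k), fun k l hkl => ?_⟩
    rw [coord_add, coord_add, add_sub_add_comm]
    exact (hx.2 k l hkl).add (hy.2 k l hkl)
  smul_mem c hc x hx := by
    refine ⟨fun k => (hx.1 k).smul hc, fun k l hkl => ?_⟩
    rw [coord_smul, coord_smul, ← smul_sub]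
    exact (hx.2 k l hkl).smul hc
  nonempty_interior := by
    refine ⟨staircase D j, mem_interior.2
      ⟨⋂ k, {y | ‖y.coord k - (staircase D j).coord k‖ < 1 / 2}, fun y hy => ?_, ?_, ?_⟩⟩
    · exact mem_stepCone_of_close_staircase fun k => mem_iInter.1 hy k
    · exact isOpen_iInter_of_finite fun k =>
        isOpen_lt ((continuous_coord k).sub continuous_const).norm continuous_const
    · simp

theorem mem_stepCone_of_dual {q : StepSpace D j}
    (h : ∀ z ∈ dualCone (stepCone D j), 0 ≤ inner ℝ q z) : q ∈ stepCone D j := by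
  refine ⟨fun k => SymMat.isPSD_iff.2 fun v => ?_,
    fun k l hkl => SymMat.isPSD_iff.2 fun v => ?_⟩
  · have hk := h (single k (SymMat.outer v)) fun y hy => by
      rw [real_inner_comm, inner_single]
      exact mul_nonneg (j.len_pos k).le (SymMat.isPSD_iff.1 (hy.1 k) v)
    rw [inner_single] at hk
    exact nonneg_of_mul_nonneg_right hk (j.len_pos k)
  · have hdiff : ∀ y : StepSpace D j, inner ℝ y ((j.len l)⁻¹ • single l (SymMat.outer v) -
        (j.len k)⁻¹ • single k (SymMat.outer v)) =
        inner ℝ (y.coord l - y.coord k) (SymMat.outer v) := by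
      intro y
      rw [inner_sub_right, real_inner_smul_right, real_inner_smul_right, inner_single,
        inner_single, inner_sub_left, inv_mul_cancel_left₀ (j.len_pos l).ne',
        inv_mul_cancel_left₀ (j.len_pos k).ne']
    have hkl' := h _ fun y hy => by
      rw [real_inner_comm, hdiff y]
      exact SymMat.isPSD_iff.1 (hy.2 k l hkl) v
    rwa [hdiff] at hkl'

end StepCone

/-! ### Lifts and projections -/

section LiftProj

variable {D : ℕ}

theorem pathLift_eq_sum (j : UnitPartition) (x : StepSpace D j) :
    pathLift j x = ∑ k, (indicatorConstLp 2 (j.measurableSet_cell k)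
      (measure_ne_top unitMeasure _) (x.coord k) : PathSpace D) := rfl

theorem pathLift_coeFn (j : UnitPartition) (x : StepSpace D j) :
    ⇑(pathLift j x) =ᵐ[unitMeasure] fun s => ∑ k, (j.cell k).indicator (fun _ => x.coord k) s := by
  have hsum : ⇑(pathLift j x) =ᵐ[unitMeasure] fun s => ∑ k, (indicatorConstLp 2
      (j.measurableSet_cell k) (measure_ne_top unitMeasure _) (x.coord k) : PathSpace D) s := by
    rw [pathLift_eq_sum]
    exact Lp.coeFn_fun_finsetSum _ _
  have hcell : ∀ᵐ s ∂unitMeasure, ∀ k : Fin j.n, (indicatorConstLp 2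
      (j.measurableSet_cell k) (measure_ne_top unitMeasure _) (x.coord k) : PathSpace D) s =
      (j.cell k).indicator (fun _ => x.coord k) s :=
    ae_all_iff.2 fun k => indicatorConstLp_coeFn
  filter_upwards [hsum, hcell] with s hs hsk
  rw [hs]
  exact Finset.sum_congr rfl fun k _ => hsk k

theorem sum_indicator_cell (j : UnitPartition) (x : StepSpace D j) {k : Fin j.n} {s : ℝ}
    (hs : s ∈ j.cell k) :
    ∑ l, (j.cell l).indicator (fun _ => x.coord l) s = x.coord k := by
  rw [Finset.sum_eq_single k]
  · rw [indicator_of_mem hs]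
  · exact fun l _ hl => indicator_of_notMem (fun h => hl (j.eq_of_mem_cell h hs)) _
  · exact fun h => absurd (Finset.mem_univ k) h

theorem ae_mem_unit : ∀ᵐ s ∂unitMeasure, s ∈ Ico (0 : ℝ) 1 := ae_restrict_mem measurableSet_Ico

theorem pathLift_ae (j : UnitPartition) (x : StepSpace D j) :
    ∀ᵐ s ∂unitMeasure, ∀ k, s ∈ j.cell k → pathLift j x s = x.coord k := by
  filter_upwards [pathLift_coeFn j x] with s hs k hk
  rw [hs, sum_indicator_cell j x hk]

theorem pathLift_add (j : UnitPartition) (x y : StepSpace D j) :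
    pathLift j (x + y) = pathLift j x + pathLift j y := by
  rw [pathLift_eq_sum, pathLift_eq_sum, pathLift_eq_sum, ← Finset.sum_add_distrib]
  exact Finset.sum_congr rfl fun k _ => indicatorConstLp_add.symm

theorem coord_pathProj (j : UnitPartition) (μ : PathSpace D) (k : Fin j.n) :
    (pathProj j μ).coord k = (j.len k)⁻¹ • ∫ s in j.cell k, μ s := rfl

theorem inner_pathLift (j : UnitPartition) (x : StepSpace D j) (μ : PathSpace D) :
    inner ℝ (pathLift j x) μ = inner ℝ x (pathProj j μ) := by
  rw [pathLift_eq_sum, sum_inner (𝕜 := ℝ) (E := PathSpace D), StepSpace.inner_def]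
  refine Finset.sum_congr rfl fun k _ => ?_
  have haverage : inner ℝ (x.coord k) ((pathProj j μ).coord k) =
      (j.len k)⁻¹ * inner ℝ (x.coord k) (∫ s in j.cell k, μ s) :=
    real_inner_smul_right (x.coord k) (∫ s in j.cell k, μ s) (j.len k)⁻¹
  rw [L2.inner_indicatorConstLp_eq_inner_setIntegral, haverage,
    mul_inv_cancel_left₀ (j.len_pos k).ne', j.restrict_cell]

theorem pathProj_add (j : UnitPartition) (μ ν : PathSpace D) :
    pathProj j (μ + ν) = pathProj j μ + pathProj j ν := by
  refine ext_inner_left ℝ fun x => ?_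
  rw [inner_add_right, ← inner_pathLift, ← inner_pathLift, ← inner_pathLift,
    inner_add_right (𝕜 := ℝ) (E := PathSpace D)]

theorem pathProj_smul (j : UnitPartition) (c : ℝ) (μ : PathSpace D) :
    pathProj j (c • μ) = c • pathProj j μ := by
  refine ext_inner_left ℝ fun x => ?_
  rw [real_inner_smul_right, ← inner_pathLift, ← inner_pathLift,
    real_inner_smul_right (F := PathSpace D)]

theorem pathLift_smul (j : UnitPartition) (c : ℝ) (x : StepSpace D j) :
    pathLift j (c • x) = c • pathLift j x := by
  refine ext_inner_right ℝ fun μ => ?_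
  rw [real_inner_smul_left (F := PathSpace D), inner_pathLift, inner_pathLift,
    real_inner_smul_left]

theorem pathLift_ae_restrict_cell (j : UnitPartition) (x : StepSpace D j) (k : Fin j.n) :
    ∀ᵐ s ∂(volume.restrict (j.cell k)), pathLift j x s = x.coord k := by
  rw [← j.restrict_cell]
  filter_upwards [ae_restrict_of_ae (pathLift_ae j x),
    ae_restrict_mem (j.measurableSet_cell k)] with s hconst hs using hconst k hs

theorem pathProj_pathLift (j : UnitPartition) (x : StepSpace D j) :
    pathProj j (pathLift j x) = x := by
  funext k
  change (j.len k)⁻¹ • ∫ s in j.cell k, pathLift j x s = x.coord k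
  rw [integral_congr_ae (pathLift_ae_restrict_cell j x k), setIntegral_const, j.volume_cell]
  exact inv_smul_smul₀ (j.len_pos k).ne' _

/-- The lift `l_j`, which is a linear isometry. -/
noncomputable def liftₗᵢ (D : ℕ) (j : UnitPartition) : StepSpace D j →ₗᵢ[ℝ] PathSpace D where
  toFun := pathLift j
  map_add' := pathLift_add j
  map_smul' := pathLift_smul j
  norm_map' x := by
    have hsq : ‖pathLift j x‖ ^ 2 = ‖x‖ ^ 2 := by
      rw [← real_inner_self_eq_norm_sq (F := PathSpace D), ← real_inner_self_eq_norm_sq x,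
        inner_pathLift, pathProj_pathLift]
    exact (sq_eq_sq₀ (norm_nonneg (pathLift j x)) (norm_nonneg x)).1 hsq

theorem norm_pathLift (j : UnitPartition) (x : StepSpace D j) : ‖pathLift j x‖ = ‖x‖ :=
  (liftₗᵢ D j).norm_map x

theorem pathLift_sub (j : UnitPartition) (x y : StepSpace D j) :
    pathLift j (x - y) = pathLift j x - pathLift j y := (liftₗᵢ D j).map_sub x y

theorem continuous_pathLift (j : UnitPartition) :
    Continuous (pathLift j : StepSpace D j → PathSpace D) := (liftₗᵢ D j).continuous

theorem norm_pathProj_le (j : UnitPartition) (μ : PathSpace D) : ‖pathProj j μ‖ ≤ ‖μ‖ := by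
  have hmul : ‖pathProj j μ‖ * ‖pathProj j μ‖ ≤ ‖pathProj j μ‖ * ‖μ‖ :=
    calc _ = inner ℝ (pathLift j (pathProj j μ)) μ := by
          rw [inner_pathLift, real_inner_self_eq_norm_mul_norm]
      _ ≤ ‖pathLift j (pathProj j μ)‖ * ‖μ‖ := real_inner_le_norm (F := PathSpace D) _ _
      _ = _ := by rw [norm_pathLift]
  rcases (norm_nonneg (pathProj j μ)).eq_or_lt with hzero | hpos
  · exact hzero ▸ norm_nonneg μ
  · exact le_of_mul_le_mul_left hmul hpos

/-- The projection `p_j`, which is linear. -/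
noncomputable def projₗ (D : ℕ) (j : UnitPartition) : PathSpace D →ₗ[ℝ] StepSpace D j where
  toFun := pathProj j
  map_add' := pathProj_add j
  map_smul' := pathProj_smul j

theorem pathProj_sub (j : UnitPartition) (μ ν : PathSpace D) :
    pathProj j (μ - ν) = pathProj j μ - pathProj j ν := (projₗ D j).map_sub μ ν

/-- The `L¹` norm of a path. -/
noncomputable def pathNormL1 (z : PathSpace D) : ℝ := ∫ s, ‖z s‖ ∂unitMeasure

theorem integrable_path (z : PathSpace D) : Integrable z unitMeasure :=
  (Lp.memLp z).integrable one_le_two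

theorem integral_unit_eq_sum (j : UnitPartition) {F : Type*} [NormedAddCommGroup F]
    [NormedSpace ℝ F] {f : ℝ → F} (hf : Integrable f unitMeasure) :
    ∫ s, f s ∂unitMeasure = ∑ k, ∫ s in j.cell k, f s := by
  have hunion := integral_iUnion_fintype (μ := unitMeasure) (f := f) j.measurableSet_cell
    j.pairwise_disjoint_cell fun k => hf.integrableOn
  rw [j.iUnion_cell, unitMeasure, Measure.restrict_restrict measurableSet_Ico, inter_self]
    at hunion
  rw [unitMeasure, hunion]
  exact Finset.sum_congr rfl fun k _ => by rw [← j.restrict_cell]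

theorem integrableOn_cell (j : UnitPartition) {F : Type*} [NormedAddCommGroup F]
    {f : ℝ → F} (hf : Integrable f unitMeasure) (k : Fin j.n) : IntegrableOn f (j.cell k) := by
  rw [IntegrableOn, ← j.restrict_cell]
  exact hf.integrableOn

theorem pathNormL1_pathLift (j : UnitPartition) (x : StepSpace D j) :
    pathNormL1 (pathLift j x) = StepSpace.normL1 x := by
  rw [pathNormL1, integral_unit_eq_sum j (integrable_path _).norm, StepSpace.normL1]
  refine Finset.sum_congr rfl fun k _ => ?_
  rw [integral_congr_ae ((pathLift_ae_restrict_cell j x k).mono fun s hs => congrArg norm hs),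
    setIntegral_const, j.volume_cell, smul_eq_mul]

theorem normL1_pathProj_le (j : UnitPartition) (z : PathSpace D) :
    StepSpace.normL1 (pathProj j z) ≤ pathNormL1 z := by
  rw [pathNormL1, integral_unit_eq_sum j (integrable_path _).norm, StepSpace.normL1]
  refine Finset.sum_le_sum fun k _ => ?_
  rw [coord_pathProj, j.len_mul_norm_inv_smul]
  exact norm_integral_le_integral_norm _

theorem pathLift_eq_of_le {j j' : UnitPartition} (h : j ≤ j') (x : StepSpace D j) :
    pathLift j' (pathProj j' (pathLift j x)) = pathLift j x := by
  choose parent hparent using UnitPartition.exists_cell_subset h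
  let x' : StepSpace D j' := fun m => x.coord (parent m)
  have hx' : pathLift j x = pathLift j' x' := by
    refine Lp.ext ?_
    filter_upwards [pathLift_ae j x, pathLift_ae j' x', ae_mem_unit] with s hs hs' hunit
    obtain ⟨m, hm⟩ := j'.exists_mem_cell hunit
    rw [hs' m hm, hs _ (hparent m hm)]
    rfl
  rw [hx', pathProj_pathLift]

theorem pathProj_pathLift_pathProj {j j' : UnitPartition} (h : j ≤ j') (μ : PathSpace D) :
    pathProj j (pathLift j' (pathProj j' μ)) = pathProj j μ := by
  refine ext_inner_left ℝ fun x => ?_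
  rw [← inner_pathLift, real_inner_comm (F := PathSpace D), inner_pathLift, real_inner_comm,
    ← inner_pathLift, pathLift_eq_of_le h, inner_pathLift]

end LiftProj

/-! ### Increasing paths -/

section Cone

variable {D : ℕ}

open StepSpace

theorem pathLift_mem_pathCone {j : UnitPartition} {x : StepSpace D j} (hx : x ∈ stepCone D j) :
    pathLift j x ∈ pathCone D := by
  let m : ℝ → SymMat D := fun s => ∑ k, (j.cell k).indicator (fun _ => x.coord k) s
  have hcell : ∀ {k s}, s ∈ j.cell k → m s = x.coord k := fun hs => sum_indicator_cell j x hs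
  refine ⟨m, fun s hs => ?_, fun s hs t ht hst => ?_, fun t ht => ?_, fun t ht => ?_,
    pathLift_coeFn j x⟩
  · obtain ⟨k, hk⟩ := j.exists_mem_cell hs
    rw [hcell hk]
    exact hx.1 k
  · obtain ⟨k, hk⟩ := j.exists_mem_cell hs
    obtain ⟨l, hl⟩ := j.exists_mem_cell ht
    rw [hcell hk, hcell hl]
    exact hx.2 k l (j.le_of_mem_cell hst hk hl)
  · obtain ⟨k, hk⟩ := j.exists_mem_cell ht
    refine (continuousWithinAt_const (b := x.coord k)).congr_of_eventuallyEq ?_ (hcell hk)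
    filter_upwards [Ico_mem_nhdsGE hk.2] with s hs
    exact hcell ⟨hk.1.trans hs.1, hs.2⟩
  · obtain ⟨k, hk⟩ := j.exists_mem_Ioc ⟨ht.1, ht.2.le⟩
    refine ⟨x.coord k, tendsto_const_nhds.congr' ?_⟩
    filter_upwards [Ico_mem_nhdsLT hk.1] with s hs
    exact (hcell ⟨hs.1, hs.2.trans_le hk.2⟩).symm

/-- The order properties of the paths in the cone: positive semidefinite and increasing. -/
structure IsIncreasingPath (m : ℝ → SymMat D) : Prop where
  isPSD : ∀ s ∈ Ico (0 : ℝ) 1, SymMat.IsPSD (m s)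
  isPSD_sub : ∀ s ∈ Ico (0 : ℝ) 1, ∀ t ∈ Ico (0 : ℝ) 1, s ≤ t → SymMat.IsPSD (m t - m s)

theorem exists_isIncreasingPath {ι : PathSpace D} (hι : ι ∈ pathCone D) :
    ∃ m, IsIncreasingPath m ∧ ⇑ι =ᵐ[unitMeasure] m := by
  obtain ⟨m, hpos, hmono, -, -, hm⟩ := hι
  exact ⟨m, ⟨hpos, hmono⟩, hm⟩

namespace IsIncreasingPath

variable {m : ℝ → SymMat D} {s t : ℝ}

theorem inner_outer_le (hm : IsIncreasingPath m) (hs : s ∈ Ico (0 : ℝ) 1) (ht : t ∈ Ico (0 : ℝ) 1)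
    (hst : s ≤ t) (v : Fin D → ℝ) :
    inner ℝ (m s) (SymMat.outer v) ≤ inner ℝ (m t) (SymMat.outer v) := by
  rw [← sub_nonneg, ← inner_sub_left]
  exact SymMat.isPSD_iff.1 (hm.isPSD_sub s hs t ht hst) v

theorem tr_le_tr (hm : IsIncreasingPath m) (hs : s ∈ Ico (0 : ℝ) 1) (ht : t ∈ Ico (0 : ℝ) 1)
    (hst : s ≤ t) : SymMat.tr (m s) ≤ SymMat.tr (m t) := by
  rw [← sub_nonneg, ← SymMat.tr_sub]
  exact (hm.isPSD_sub s hs t ht hst).tr_nonneg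

theorem norm_sub_le (hm : IsIncreasingPath m) (hs : s ∈ Ico (0 : ℝ) 1) (ht : t ∈ Ico (0 : ℝ) 1)
    (hst : s ≤ t) : ‖m t - m s‖ ≤ D * (SymMat.tr (m t) - SymMat.tr (m s)) := by
  rw [← SymMat.tr_sub]
  exact (hm.isPSD_sub s hs t ht hst).norm_le

end IsIncreasingPath

theorem inner_coord_pathProj (j : UnitPartition) (ι : PathSpace D) (k : Fin j.n) (a : SymMat D) :
    inner ℝ ((pathProj j ι).coord k) a = (j.len k)⁻¹ * ∫ s in j.cell k, inner ℝ (ι s) a := by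
  have hsmul : inner ℝ ((pathProj j ι).coord k) a =
      (j.len k)⁻¹ * inner ℝ (∫ s in j.cell k, ι s) a := real_inner_smul_left _ a _
  rw [hsmul, real_inner_comm, ← integral_inner (integrableOn_cell j (integrable_path ι) k)]
  simp_rw [real_inner_comm a]

theorem integrableOn_const_cell (j : UnitPartition) (k : Fin j.n) {F : Type*}
    [NormedAddCommGroup F] (b : F) : IntegrableOn (fun _ : ℝ => b) (j.cell k) :=
  integrableOn_const (by simp [UnitPartition.cell])

theorem integrableOn_inner_cell (j : UnitPartition) (ι : PathSpace D) (k : Fin j.n)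
    (a : SymMat D) : IntegrableOn (fun s => inner ℝ (ι s) a) (j.cell k) :=
  Integrable.inner_const (𝕜 := ℝ) (integrableOn_cell j (integrable_path ι) k) a

theorem ae_cell_of_ae {j : UnitPartition} {q : ℝ → Prop} (h : ∀ᵐ s ∂unitMeasure, q s)
    (k : Fin j.n) : ∀ᵐ s ∂(volume.restrict (j.cell k)), q s := by
  rw [← j.restrict_cell]
  exact ae_restrict_of_ae h

theorem le_inner_coord_pathProj {j : UnitPartition} {ι : PathSpace D} {m : ℝ → SymMat D}
    (hm : ⇑ι =ᵐ[unitMeasure] m) {k : Fin j.n} {a : SymMat D} {b : ℝ}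
    (h : ∀ s ∈ j.cell k, b ≤ inner ℝ (m s) a) : b ≤ inner ℝ ((pathProj j ι).coord k) a := by
  rw [inner_coord_pathProj, ← div_eq_inv_mul, le_div_iff₀ (j.len_pos k), ← j.volume_cell,
    mul_comm, ← smul_eq_mul, ← setIntegral_const]
  refine setIntegral_mono_ae_restrict (integrableOn_const_cell j k b)
    (integrableOn_inner_cell j ι k a) ?_
  filter_upwards [ae_cell_of_ae hm k, ae_restrict_mem (j.measurableSet_cell k)] with s hs hsk
  rw [hs]
  exact h s hsk

theorem inner_coord_pathProj_le {j : UnitPartition} {ι : PathSpace D} {m : ℝ → SymMat D}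
    (hm : ⇑ι =ᵐ[unitMeasure] m) {k : Fin j.n} {a : SymMat D} {b : ℝ}
    (h : ∀ s ∈ j.cell k, inner ℝ (m s) a ≤ b) : inner ℝ ((pathProj j ι).coord k) a ≤ b := by
  have hneg := le_inner_coord_pathProj hm (a := -a) (b := -b) fun s hs => by
    rw [inner_neg_right]
    exact neg_le_neg (h s hs)
  rwa [inner_neg_right, neg_le_neg_iff] at hneg

theorem pathProj_mem_stepCone (j : UnitPartition) {ι : PathSpace D} (hι : ι ∈ pathCone D) :
    pathProj j ι ∈ stepCone D j := by
  obtain ⟨m, hinc, hm⟩ := exists_isIncreasingPath hι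
  refine ⟨fun k => SymMat.isPSD_iff.2 fun v => ?_, fun k l hkl => SymMat.isPSD_iff.2 fun v => ?_⟩
  · exact le_inner_coord_pathProj hm fun s hs =>
      SymMat.isPSD_iff.1 (hinc.isPSD s (j.cell_subset k hs)) v
  · rcases hkl.eq_or_lt with rfl | hlt
    · simp
    have hl := j.t_castSucc_mem l
    have hend : j.t k.succ ≤ j.t l.castSucc :=
      j.strictMono.monotone (Fin.succ_le_castSucc_iff.2 hlt)
    rw [inner_sub_left, sub_nonneg]
    calc inner ℝ ((pathProj j ι).coord k) (SymMat.outer v)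
        ≤ inner ℝ (m (j.t l.castSucc)) (SymMat.outer v) := inner_coord_pathProj_le hm fun s hs =>
          hinc.inner_outer_le (j.cell_subset k hs) (j.cell_subset l hl) (hs.2.le.trans hend) v
      _ ≤ inner ℝ ((pathProj j ι).coord l) (SymMat.outer v) := le_inner_coord_pathProj hm
          fun s hs => hinc.inner_outer_le (j.cell_subset l hl) (j.cell_subset l hs) hs.1 v

theorem pathLift_mem_dualCone {j : UnitPartition} {z : StepSpace D j}
    (hz : z ∈ dualCone (stepCone D j)) : pathLift j z ∈ dualCone (pathCone D) := by
  intro μ hμ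
  exact (hz _ (pathProj_mem_stepCone j hμ)).trans_eq (inner_pathLift j z μ).symm

theorem setIntegral_norm_sub_coord_pathProj_le (j : UnitPartition) (ι : PathSpace D) (k : Fin j.n)
    (a : SymMat D) :
    ∫ s in j.cell k, ‖ι s - (pathProj j ι).coord k‖ ≤ 2 * ∫ s in j.cell k, ‖ι s - a‖ := by
  have hint := integrableOn_cell j (integrable_path ι) k
  have hconst := fun b : SymMat D => integrableOn_const_cell j k b
  have hmean : j.len k * ‖a - (pathProj j ι).coord k‖ ≤ ∫ s in j.cell k, ‖ι s - a‖ := by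
    have hdiff : a - (pathProj j ι).coord k = -((j.len k)⁻¹ • ∫ s in j.cell k, (ι s - a)) := by
      rw [integral_sub hint (hconst a), setIntegral_const, j.volume_cell, coord_pathProj, smul_sub,
        inv_smul_smul₀ (j.len_pos k).ne', neg_sub]
    rw [hdiff, norm_neg, j.len_mul_norm_inv_smul]
    exact norm_integral_le_integral_norm _
  have hnorm : IntegrableOn (fun s => ‖ι s - a‖) (j.cell k) := (hint.sub (hconst a)).norm
  have hnorm_const : IntegrableOn (fun _ => ‖a - (pathProj j ι).coord k‖) (j.cell k) :=
    (hconst (a - (pathProj j ι).coord k)).norm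
  calc ∫ s in j.cell k, ‖ι s - (pathProj j ι).coord k‖
      ≤ ∫ s in j.cell k, (‖ι s - a‖ + ‖a - (pathProj j ι).coord k‖) :=
        setIntegral_mono (hint.sub (hconst _)).norm (hnorm.add hnorm_const)
          fun s => norm_sub_le_norm_sub_add_norm_sub _ _ _
    _ = (∫ s in j.cell k, ‖ι s - a‖) + j.len k * ‖a - (pathProj j ι).coord k‖ := by
        rw [integral_add hnorm hnorm_const, setIntegral_const, j.volume_cell, smul_eq_mul]
    _ ≤ 2 * ∫ s in j.cell k, ‖ι s - a‖ := by linarith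

theorem setIntegral_norm_sub_coord_pathProj_le_tr {j : UnitPartition} {ι : PathSpace D}
    {m : ℝ → SymMat D} (hinc : IsIncreasingPath m) (hm : ⇑ι =ᵐ[unitMeasure] m) (k : Fin j.n) :
    ∫ s in j.cell k, ‖ι s - (pathProj j ι).coord k‖ ≤ 2 * D * (j.len k *
      (SymMat.tr ((pathProj j ι).coord k) - SymMat.tr (m (j.t k.castSucc)))) := by
  set a := m (j.t k.castSucc)
  have hint := integrableOn_cell j (integrable_path ι) k
  have hinner := integrableOn_inner_cell j ι k SymMat.one
  have hconst := integrableOn_const_cell j k (SymMat.tr a)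
  have hosc : ∫ s in j.cell k, ‖ι s - a‖ ≤
      ∫ s in j.cell k, D * (inner ℝ (ι s) SymMat.one - SymMat.tr a) := by
    refine setIntegral_mono_ae_restrict (hint.sub (integrableOn_const_cell j k a)).norm
      ((hinner.sub hconst).const_mul _) ?_
    filter_upwards [ae_cell_of_ae hm k, ae_restrict_mem (j.measurableSet_cell k)] with s hs hsk
    rw [hs]
    exact hinc.norm_sub_le (j.cell_subset k (j.t_castSucc_mem k)) (j.cell_subset k hsk) hsk.1
  have htr : j.len k * SymMat.tr ((pathProj j ι).coord k) =
      ∫ s in j.cell k, inner ℝ (ι s) SymMat.one := by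
    rw [SymMat.tr, inner_coord_pathProj, mul_inv_cancel_left₀ (j.len_pos k).ne']
  rw [integral_const_mul, integral_sub hinner hconst, setIntegral_const, j.volume_cell,
    smul_eq_mul, ← htr] at hosc
  linarith [setIntegral_norm_sub_coord_pathProj_le j ι k a]

theorem sum_sub_le_last {n : ℕ} (hn : 0 < n) (a b : Fin n → ℝ)
    (hstep : ∀ k l : Fin n, (l : ℕ) = k + 1 → a k ≤ b l) (hb : 0 ≤ b ⟨0, hn⟩) :
    ∑ k, (a k - b k) ≤ a ⟨n - 1, Nat.sub_one_lt_of_lt hn⟩ := by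
  obtain ⟨n, rfl⟩ := Nat.exists_eq_succ_of_ne_zero hn.ne'
  rw [Finset.sum_sub_distrib, Fin.sum_univ_castSucc a, Fin.sum_univ_succ b]
  have hsum : ∑ k : Fin n, a k.castSucc ≤ ∑ k : Fin n, b k.succ :=
    Finset.sum_le_sum fun k _ => hstep k.castSucc k.succ (by simp)
  have hlast : a ⟨n + 1 - 1, Nat.sub_one_lt_of_lt hn⟩ = a (Fin.last n) := rfl
  have hzero : b ⟨0, hn⟩ = b 0 := rfl
  linarith

theorem len_mul_tr_coord_pathProj_le (j : UnitPartition) (ι : PathSpace D) (k : Fin j.n) :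
    j.len k * SymMat.tr ((pathProj j ι).coord k) ≤
      √(j.len k) * ‖(SymMat.one : SymMat D)‖ * ‖ι‖ := by
  have hsingle :
      ‖(single k SymMat.one : StepSpace D j)‖ = √(j.len k) * ‖(SymMat.one : SymMat D)‖ := by
    rw [← sq_eq_sq₀ (norm_nonneg _) (by positivity), ← real_inner_self_eq_norm_sq, inner_single,
      coord_single_same, real_inner_self_eq_norm_sq, mul_pow, Real.sq_sqrt (j.len_pos k).le]
  rw [SymMat.tr, ← inner_single, ← hsingle, mul_comm]
  exact (real_inner_le_norm _ _).trans (by gcongr; exact norm_pathProj_le j ι)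

/-- The constant in the `L¹` approximation estimate. -/
noncomputable def approxConst (D : ℕ) : ℝ := 2 * D * ‖(SymMat.one : SymMat D)‖

theorem approxConst_nonneg (D : ℕ) : 0 ≤ approxConst D := by unfold approxConst; positivity

theorem pathNormL1_sub_pathLift (j : UnitPartition) (ι : PathSpace D) (x : StepSpace D j) :
    pathNormL1 (ι - pathLift j x) = ∑ k, ∫ s in j.cell k, ‖ι s - x.coord k‖ := by
  rw [pathNormL1, integral_unit_eq_sum j (integrable_path _).norm]
  refine Finset.sum_congr rfl fun k _ => integral_congr_ae ?_
  filter_upwards [ae_cell_of_ae (Lp.coeFn_sub ι (pathLift j x)) k,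
    ae_cell_of_ae (pathLift_ae j x) k, ae_restrict_mem (j.measurableSet_cell k)] with s hs hsx hsk
  rw [hs, Pi.sub_apply, hsx k hsk]

theorem pathNormL1_sub_le {j : UnitPartition} (hj : j.IsUniform) {ι : PathSpace D}
    (hι : ι ∈ pathCone D) :
    pathNormL1 (ι - pathLift j (pathProj j ι)) ≤ approxConst D * (√(j.n : ℝ))⁻¹ * ‖ι‖ := by
  obtain ⟨m, hinc, hm⟩ := exists_isIncreasingPath hι
  have hmem := fun k : Fin j.n => j.cell_subset k (j.t_castSucc_mem k)
  set last : Fin j.n := ⟨j.n - 1, Nat.sub_one_lt_of_lt j.n_pos⟩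
  -- The left endpoint value on the next cell dominates the average, so the sum telescopes.
  have htelescope := sum_sub_le_last j.n_pos (fun k => SymMat.tr ((pathProj j ι).coord k))
    (fun k => SymMat.tr (m (j.t k.castSucc)))
    (fun k l hkl => inner_coord_pathProj_le hm fun s hs => by
      have hend : k.succ = l.castSucc := Fin.ext (by simp [hkl])
      exact hinc.tr_le_tr (j.cell_subset k hs) (hmem l) (hend ▸ hs.2.le))
    (hinc.isPSD _ (hmem _)).tr_nonneg
  have hlast := len_mul_tr_coord_pathProj_le j ι last
  rw [hj.len_eq, Real.sqrt_inv] at hlast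
  calc pathNormL1 (ι - pathLift j (pathProj j ι))
      ≤ ∑ k, 2 * D * ((j.n : ℝ)⁻¹ *
          (SymMat.tr ((pathProj j ι).coord k) - SymMat.tr (m (j.t k.castSucc)))) := by
        rw [pathNormL1_sub_pathLift]
        refine Finset.sum_le_sum fun k _ => ?_
        rw [← hj.len_eq k]
        exact setIntegral_norm_sub_coord_pathProj_le_tr hinc hm k
    _ ≤ 2 * D * ((j.n : ℝ)⁻¹ * SymMat.tr ((pathProj j ι).coord last)) := by
        rw [← Finset.mul_sum, ← Finset.mul_sum]
        gcongr
    _ ≤ approxConst D * (√(j.n : ℝ))⁻¹ * ‖ι‖ := by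
        unfold approxConst
        linarith [mul_le_mul_of_nonneg_left hlast (by positivity : (0 : ℝ) ≤ 2 * D)]

end Cone

/-! ### A totally bounded set of gradients -/

section Gradients

variable {D : ℕ}

theorem integral_norm_sq_path (z : PathSpace D) : ∫ s, ‖z s‖ ^ 2 ∂unitMeasure = ‖z‖ ^ 2 := by
  rw [← real_inner_self_eq_norm_sq (F := PathSpace D), L2.inner_def]
  simp_rw [real_inner_self_eq_norm_sq]

theorem integrable_norm_sq_path (z : PathSpace D) :
    Integrable (fun s => ‖z s‖ ^ 2) unitMeasure := by
  have h := L2.integrable_inner (𝕜 := ℝ) z z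
  simp_rw [real_inner_self_eq_norm_sq] at h
  exact h

theorem lintegral_enorm_path (z : PathSpace D) :
    ∫⁻ s, ‖z s‖ₑ ∂unitMeasure = ENNReal.ofReal (pathNormL1 z) := by
  rw [pathNormL1, ofReal_integral_norm_eq_lintegral_enorm (integrable_path z)]

theorem lintegral_enorm_sq_path (z : PathSpace D) :
    ∫⁻ s, ‖z s‖ₑ ^ (2 : ℝ) ∂unitMeasure = ENNReal.ofReal (‖z‖ ^ 2) := by
  rw [← integral_norm_sq_path, ofReal_integral_eq_lintegral_ofReal (integrable_norm_sq_path z)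
    (Eventually.of_forall fun s => sq_nonneg _)]
  refine lintegral_congr fun s => ?_
  rw [ENNReal.ofReal_pow (norm_nonneg _), ofReal_norm, ENNReal.rpow_two]

theorem pathNormL1_nonneg (z : PathSpace D) : 0 ≤ pathNormL1 z :=
  integral_nonneg fun _ => norm_nonneg _

theorem toReal_eLpNorm_le_norm (z : PathSpace D) {p : ℝ} (hp : p ≤ 2) :
    (eLpNorm z (ENNReal.ofReal p) unitMeasure).toReal ≤ ‖z‖ := by
  have : IsProbabilityMeasure unitMeasure := ⟨by simp⟩
  rw [Lp.norm_def]
  refine ENNReal.toReal_mono (Lp.eLpNorm_ne_top z)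
    (eLpNorm_le_eLpNorm_of_exponent_le ?_ (Lp.aestronglyMeasurable z))
  exact ENNReal.ofReal_le_ofNat.2 hp

theorem lintegral_enorm_rpow_le (z : PathSpace D) {p : ℝ} (hp1 : 1 ≤ p) (hp2 : p ≤ 2) :
    ∫⁻ s, ‖z s‖ₑ ^ p ∂unitMeasure ≤
      ENNReal.ofReal (pathNormL1 z) ^ (2 - p) * ENNReal.ofReal (‖z‖ ^ 2) ^ (p - 1) := by
  have hae : AEMeasurable (fun s => ‖z s‖ₑ) unitMeasure := (Lp.aestronglyMeasurable z).enorm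
  have hsplit : ∀ s, ‖z s‖ₑ ^ (2 - p) * (‖z s‖ₑ ^ (2 : ℝ)) ^ (p - 1) = ‖z s‖ₑ ^ p := by
    intro s
    rw [← ENNReal.rpow_mul, ← ENNReal.rpow_add_of_nonneg _ _ (by linarith) (by linarith)]
    congr 1
    ring
  have hholder := ENNReal.lintegral_mul_norm_pow_le (p := 2 - p) (q := p - 1) hae
    (hae.pow_const (2 : ℝ)) (by linarith) (by linarith) (by ring)
  simp_rw [hsplit] at hholder
  rwa [lintegral_enorm_path, lintegral_enorm_sq_path] at hholder

theorem toReal_eLpNorm_le (z : PathSpace D) {p : ℝ} (hp1 : 1 ≤ p) (hp2 : p ≤ 2) :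
    (eLpNorm z (ENNReal.ofReal p) unitMeasure).toReal ≤
      pathNormL1 z ^ ((2 - p) / p) * ‖z‖ ^ (1 - (2 - p) / p) := by
  have hp0 : 0 < p := by linarith
  have hX := pathNormL1_nonneg z
  have hexp : 2 * ((p - 1) / p) = 1 - (2 - p) / p := by field_simp; ring
  refine ENNReal.toReal_le_of_le_ofReal
    (mul_nonneg (Real.rpow_nonneg hX _) (Real.rpow_nonneg (norm_nonneg z) _)) ?_
  calc eLpNorm z (ENNReal.ofReal p) unitMeasure
      = (∫⁻ s, ‖z s‖ₑ ^ p ∂unitMeasure) ^ (1 / p) := by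
        rw [eLpNorm_eq_lintegral_rpow_enorm_toReal (by simpa using hp0) ENNReal.ofReal_ne_top,
          ENNReal.toReal_ofReal hp0.le]
    _ ≤ (ENNReal.ofReal (pathNormL1 z) ^ (2 - p) *
          ENNReal.ofReal (‖z‖ ^ 2) ^ (p - 1)) ^ (1 / p) :=
        ENNReal.rpow_le_rpow (lintegral_enorm_rpow_le z hp1 hp2) (by positivity)
    _ = ENNReal.ofReal (pathNormL1 z) ^ ((2 - p) / p) *
          ENNReal.ofReal (‖z‖ ^ 2) ^ ((p - 1) / p) := by
        rw [ENNReal.mul_rpow_of_nonneg _ _ (by positivity), ← ENNReal.rpow_mul,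
          ← ENNReal.rpow_mul, mul_one_div, mul_one_div]
    _ = ENNReal.ofReal (pathNormL1 z ^ ((2 - p) / p) * ‖z‖ ^ (1 - (2 - p) / p)) := by
        rw [ENNReal.ofReal_mul (Real.rpow_nonneg hX _),
          ENNReal.ofReal_rpow_of_nonneg hX (div_nonneg (by linarith) hp0.le),
          ENNReal.ofReal_rpow_of_nonneg (by positivity) (div_nonneg (by linarith) hp0.le),
          ← Real.rpow_natCast, ← Real.rpow_mul (norm_nonneg z), Nat.cast_ofNat, hexp]

/-- The increments of `ψ` on the cone of paths are controlled by `a` times the `L¹` norm plus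
`b` times the `L²` norm. Under an `Lᵖ`-Lipschitz bound with `p < 2`, any `b > 0` is admissible. -/
structure IncrementBound (ψ : PathSpace D → ℝ) (a b : ℝ) : Prop where
  left_nonneg : 0 ≤ a
  right_nonneg : 0 ≤ b
  bound : ∀ μ ∈ pathCone D, ∀ ν ∈ pathCone D,
    ψ μ - ψ ν ≤ a * pathNormL1 (μ - ν) + b * ‖μ - ν‖

/-- Increasing paths whose pairings obey every increment bound of `ψ`. The gradients of all the
solutions started from `ψ` lie in this set, up to elements of the dual cone. -/
def gradSet (ψ : PathSpace D → ℝ) : Set (PathSpace D) :=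
  {q | q ∈ pathCone D ∧ ∀ a b, IncrementBound ψ a b → ∀ z, inner ℝ q z ≤ a * pathNormL1 z + b * ‖z‖}

theorem norm_le_of_mem_gradSet {ψ : PathSpace D → ℝ} {L : ℝ} (hL : IncrementBound ψ 0 L)
    {q : PathSpace D} (hq : q ∈ gradSet ψ) : ‖q‖ ≤ L := by
  have h := hq.2 0 L hL q
  rw [real_inner_self_eq_norm_sq (F := PathSpace D), zero_mul, zero_add, sq] at h
  rcases (norm_nonneg q).eq_or_lt with h0 | h0
  · rw [← h0]; exact hL.right_nonneg
  · exact le_of_mul_le_mul_right h h0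

theorem exists_forall_rpow_mul_rpow_le {θ : ℝ} (hθ : 0 < θ) (hθ1 : θ ≤ 1) {b : ℝ} (hb : 0 < b) :
    ∃ a, 0 ≤ a ∧ ∀ X Y : ℝ, 0 ≤ X → 0 ≤ Y → X ^ θ * Y ^ (1 - θ) ≤ a * X + b * Y := by
  -- Weighted AM-GM applied to `a X` and `b Y`, with `a` chosen so that the powers of `b` cancel.
  set a := b ^ (-(1 - θ) / θ) with ha
  have ha0 : 0 < a := Real.rpow_pos_of_pos hb _
  refine ⟨a, ha0.le, fun X Y hX hY => ?_⟩
  have hcancel : b ^ (-(1 - θ)) * b ^ (1 - θ) = 1 := by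
    rw [← Real.rpow_add hb, neg_add_cancel, Real.rpow_zero]
  calc X ^ θ * Y ^ (1 - θ) = (a * X) ^ θ * (b * Y) ^ (1 - θ) := by
        rw [Real.mul_rpow ha0.le hX, Real.mul_rpow hb.le hY, ha, ← Real.rpow_mul hb.le,
          div_mul_cancel₀ _ hθ.ne']
        linear_combination -(X ^ θ * Y ^ (1 - θ)) * hcancel
    _ ≤ θ * (a * X) + (1 - θ) * (b * Y) :=
        Real.geom_mean_le_arith_mean2_weighted hθ.le (sub_nonneg.2 hθ1)
          (mul_nonneg ha0.le hX) (mul_nonneg hb.le hY) (by ring)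
    _ ≤ a * X + b * Y :=
        add_le_add (mul_le_of_le_one_left (by positivity) hθ1)
          (mul_le_of_le_one_left (by positivity) (by linarith))

theorem exists_incrementBound {ψ : PathSpace D → ℝ} {C θ : ℝ} (hC : 0 < C) (hθ : 0 < θ)
    (hθ1 : θ ≤ 1)
    (h : ∀ μ ∈ pathCone D, ∀ ν ∈ pathCone D,
      ψ μ - ψ ν ≤ C * (pathNormL1 (μ - ν) ^ θ * ‖μ - ν‖ ^ (1 - θ)))
    {b : ℝ} (hb : 0 < b) : ∃ a, IncrementBound ψ a b := by
  obtain ⟨a, ha, hab⟩ := exists_forall_rpow_mul_rpow_le hθ hθ1 (div_pos hb hC)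
  refine ⟨C * a, by positivity, hb.le, fun μ hμ ν hν => (h μ hμ ν hν).trans ?_⟩
  calc C * (pathNormL1 (μ - ν) ^ θ * ‖μ - ν‖ ^ (1 - θ))
      ≤ C * (a * pathNormL1 (μ - ν) + b / C * ‖μ - ν‖) := by
        gcongr
        exact hab _ _ (pathNormL1_nonneg _) (norm_nonneg (μ - ν))
    _ = C * a * pathNormL1 (μ - ν) + b * ‖μ - ν‖ := by field_simp

/-- The partition of `[0, 1)` into `n` cells of equal length. -/
noncomputable def uniformPartition (n : ℕ) (hn : 0 < n) : UnitPartition where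
  n := n
  t k := (k : ℝ) / n
  strictMono k l hkl := by
    have : (0 : ℝ) < n := by exact_mod_cast hn
    beta_reduce
    gcongr
    exact_mod_cast hkl
  zero := by simp
  one := by
    have : (n : ℝ) ≠ 0 := by exact_mod_cast hn.ne'
    simp [this]

theorem uniformPartition_isUniform (n : ℕ) (hn : 0 < n) : (uniformPartition n hn).IsUniform :=
  fun _ => rfl

theorem norm_sub_pathLift_pathProj_le (j : UnitPartition) (q : PathSpace D) :
    ‖q - pathLift j (pathProj j q)‖ ≤ 2 * ‖q‖ := by
  refine (norm_sub_le q _).trans ?_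
  rw [norm_pathLift]
  linarith [norm_pathProj_le j q]

theorem norm_sq_sub_pathLift_pathProj (j : UnitPartition) (q : PathSpace D) :
    ‖q - pathLift j (pathProj j q)‖ ^ 2 = inner ℝ q (q - pathLift j (pathProj j q)) := by
  have h : inner ℝ (pathLift j (pathProj j q)) (q - pathLift j (pathProj j q)) = 0 := by
    rw [inner_pathLift, pathProj_sub, pathProj_pathLift, sub_self, inner_zero_right]
  rw [← real_inner_self_eq_norm_sq (F := PathSpace D),
    inner_sub_left (𝕜 := ℝ) (E := PathSpace D), h, sub_zero]

theorem norm_sq_sub_pathLift_pathProj_le {ψ : PathSpace D → ℝ} {L a b : ℝ}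
    (hL : IncrementBound ψ 0 L) (hab : IncrementBound ψ a b) {j : UnitPartition}
    (hj : j.IsUniform) {q : PathSpace D} (hq : q ∈ gradSet ψ) :
    ‖q - pathLift j (pathProj j q)‖ ^ 2 ≤
      a * (approxConst D * (√(j.n : ℝ))⁻¹ * L) + b * (2 * L) := by
  have ha := hab.left_nonneg
  have hb := hab.right_nonneg
  have hc := approxConst_nonneg D
  have hqL := norm_le_of_mem_gradSet hL hq
  rw [norm_sq_sub_pathLift_pathProj]
  refine (hq.2 a b hab _).trans ?_
  gcongr
  · exact (pathNormL1_sub_le hj hq.1).trans (by gcongr)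
  · exact (norm_sub_pathLift_pathProj_le j q).trans (by gcongr)

theorem exists_forall_norm_sub_pathLift_pathProj_lt {ψ : PathSpace D → ℝ} {L : ℝ}
    (hL : IncrementBound ψ 0 L) (hψ : ∀ b > 0, ∃ a, IncrementBound ψ a b) {ε : ℝ} (hε : 0 < ε) :
    ∃ j : UnitPartition, ∀ q ∈ gradSet ψ, ‖q - pathLift j (pathProj j q)‖ < ε := by
  have hL0 := hL.right_nonneg
  set b := ε ^ 2 / (4 * (L + 1))
  obtain ⟨a, hab⟩ := hψ b (by positivity)
  have hb : b * (2 * L) ≤ ε ^ 2 / 2 := by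
    rw [div_mul_eq_mul_div, div_le_div_iff₀ (by positivity) two_pos]
    nlinarith [sq_nonneg ε]
  have hsqrt : Tendsto (fun n : ℕ => (√(n : ℝ))⁻¹) atTop (𝓝 0) :=
    (Real.tendsto_sqrt_atTop.comp tendsto_natCast_atTop_atTop).inv_tendsto_atTop
  have hlim : Tendsto (fun n : ℕ => a * (approxConst D * (√(n : ℝ))⁻¹ * L)) atTop (𝓝 0) := by
    simpa only [mul_zero, zero_mul] using
      ((hsqrt.const_mul (approxConst D)).mul_const L).const_mul a
  obtain ⟨n, hn, hn0⟩ := ((hlim.eventually_lt_const (by positivity : 0 < ε ^ 2 / 2)).and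
    (eventually_gt_atTop 0)).exists
  refine ⟨uniformPartition n hn0, fun q hq => lt_of_pow_lt_pow_left₀ 2 hε.le ?_⟩
  refine (norm_sq_sub_pathLift_pathProj_le hL hab (uniformPartition_isUniform n hn0) hq).trans_lt ?_
  calc _ < ε ^ 2 / 2 + ε ^ 2 / 2 := add_lt_add_of_lt_of_le hn hb
    _ = ε ^ 2 := add_halves _

theorem totallyBounded_gradSet {ψ : PathSpace D → ℝ} {L : ℝ} (hL : IncrementBound ψ 0 L)
    (hψ : ∀ b > 0, ∃ a, IncrementBound ψ a b) : TotallyBounded (gradSet ψ) := by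
  refine Metric.totallyBounded_iff.2 fun ε hε => ?_
  obtain ⟨j, hj⟩ := exists_forall_norm_sub_pathLift_pathProj_lt hL hψ (half_pos hε)
  have hcompact : IsCompact (pathLift j '' Metric.closedBall (0 : StepSpace D j) L) :=
    (isCompact_closedBall _ _).image (continuous_pathLift j)
  obtain ⟨t, -, ht, hcover⟩ := hcompact.finite_cover_balls (half_pos hε)
  refine ⟨t, ht, fun q hq => ?_⟩
  have hmem : pathLift j (pathProj j q) ∈ pathLift j '' Metric.closedBall (0 : StepSpace D j) L :=
    ⟨_, mem_closedBall_zero_iff.2 ((norm_pathProj_le j q).trans (norm_le_of_mem_gradSet hL hq)),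
      rfl⟩
  obtain ⟨y, hy, hdist⟩ := mem_iUnion₂.1 (hcover hmem)
  refine mem_iUnion₂.2 ⟨y, hy, ?_⟩
  have hclose : dist q (pathLift j (pathProj j q)) < ε / 2 := by
    rw [dist_eq_norm (E := PathSpace D)]
    exact hj q hq
  exact (dist_triangle q (pathLift j (pathProj j q)) y).trans_lt (by
    linarith [Metric.mem_ball.1 hdist])

end Gradients

/-! ### A priori estimates for the approximate solutions -/

theorem exists_abs_add_sub_le_of_isCompact {V : Type*} [NormedAddCommGroup V] {H : V → ℝ}
    (hH : LocallyLipschitz H) {K : Set V} (hK : IsCompact K) :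
    ∃ r > 0, ∃ Λ ≥ 0, ∀ q ∈ K, ∀ ρ, ‖ρ‖ ≤ r → |H (q + ρ) - H q| ≤ Λ * ‖ρ‖ := by
  refine hK.induction_on (p := fun s => ∃ r > 0, ∃ Λ ≥ 0, ∀ q ∈ s, ∀ ρ, ‖ρ‖ ≤ r →
    |H (q + ρ) - H q| ≤ Λ * ‖ρ‖) ⟨1, one_pos, 0, le_rfl, by simp⟩ ?_ ?_ ?_
  · rintro s t hst ⟨r, hr, Λ, hΛ, h⟩
    exact ⟨r, hr, Λ, hΛ, fun q hq => h q (hst hq)⟩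
  · rintro s t ⟨r, hr, Λ, hΛ, h⟩ ⟨r', hr', Λ', -, h'⟩
    refine ⟨min r r', lt_min hr hr', max Λ Λ', hΛ.trans (le_max_left _ _), ?_⟩
    rintro q (hq | hq) ρ hρ
    · exact (h q hq ρ (hρ.trans (min_le_left _ _))).trans (by gcongr; exact le_max_left _ _)
    · exact (h' q hq ρ (hρ.trans (min_le_right _ _))).trans (by gcongr; exact le_max_right _ _)
  · intro x _
    obtain ⟨Λ, t, ht, hLip⟩ := hH x
    obtain ⟨ε, hε, hball⟩ := Metric.mem_nhds_iff.1 ht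
    refine ⟨Metric.ball x (ε / 2),
      mem_nhdsWithin_of_mem_nhds (Metric.ball_mem_nhds x (half_pos hε)),
      ε / 2, half_pos hε, Λ, Λ.2, fun q hq ρ hρ => ?_⟩
    rw [Metric.mem_ball] at hq
    have hqρ : dist (q + ρ) q = ‖ρ‖ := by rw [dist_self_add_left]
    have hmem : q + ρ ∈ t := hball <| Metric.mem_ball.2 <| by linarith [dist_triangle (q + ρ) q x]
    have hmem' : q ∈ t := hball <| Metric.mem_ball.2 <| by linarith
    simpa only [Real.dist_eq, hqρ] using hLip.dist_le_mul _ hmem _ hmem'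

section InteriorJets

variable {E : Type*} [NormedAddCommGroup E] [InnerProductSpace ℝ E] {A : Set E}
  {u : ℝ → E → ℝ} {z q : ℝ × E}

theorem neg_inner_le_of_mem_superjet (ht : 0 < z.1) (hx : z.2 ∈ interior A)
    (hq : q ∈ superjet A u z) {v : E} {m : ℝ}
    (hv : ∀ ε : ℝ, 0 < ε → z.2 + ε • v ∈ A → u z.1 z.2 - u z.1 (z.2 + ε • v) ≤ ε * m) :
    -inner ℝ q.2 v ≤ m := by
  have hline : Continuous fun ε : ℝ => z.2 + ε • v := by fun_prop
  have hmem : ∀ᶠ ε in 𝓝[>] (0 : ℝ), z.2 + ε • v ∈ A :=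
    nhdsWithin_le_nhds (hline.continuousAt (mem_interior_iff_mem_nhds.1 (by simpa using hx)))
  have hle := neg_le_of_mem_superjet (z := z) (d := (0, v)) (m := m)
      ⟨ht, interior_subset hx⟩ hq <| by
    filter_upwards [hmem, self_mem_nhdsWithin] with ε hε hε0
    have hz : z + ε • ((0 : ℝ), v) = (z.1, z.2 + ε • v) := by ext <;> simp
    rw [hz]
    exact ⟨⟨ht, hε⟩, hv ε hε0 hε⟩
  simpa using hle

theorem InSolutionClass.exists_growth {f : ℝ → E → ℝ} (hf : InSolutionClass A f) :
    ∃ M : ℝ, 0 ≤ M ∧ ∀ t, 0 ≤ t → ∀ x ∈ A, |f t x - f 0 x| ≤ M * t := by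
  obtain ⟨M, hM⟩ := hf.growth_time
  refine ⟨|M|, abs_nonneg M, fun t ht x hx => ?_⟩
  rcases ht.eq_or_lt with rfl | ht
  · simp
  · exact (div_le_iff₀ ht).1 ((hM t ht x hx).trans (le_abs_self M))

end InteriorJets

section APriori

variable {D : ℕ} {H ψ : PathSpace D → ℝ} {j : UnitPartition} {f : ℝ → StepSpace D j → ℝ}

theorem StepSpace.normL1_smul (c : ℝ) (x : StepSpace D j) :
    StepSpace.normL1 (c • x) = |c| * StepSpace.normL1 x := by
  simp only [StepSpace.normL1, StepSpace.norm_coord_smul, Finset.mul_sum]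
  exact Finset.sum_congr rfl fun k _ => by ring

theorem StepSpace.normL1_neg (x : StepSpace D j) : StepSpace.normL1 (-x) = StepSpace.normL1 x := by
  rw [← neg_one_smul ℝ x, StepSpace.normL1_smul, abs_neg, abs_one, one_mul]

theorem StepSpace.normL1_zero : StepSpace.normL1 (0 : StepSpace D j) = 0 := by
  rw [← zero_smul ℝ (0 : StepSpace D j), StepSpace.normL1_smul, abs_zero, zero_mul]

theorem IncrementBound.sub_pathLift_le {a b : ℝ} (h : IncrementBound ψ a b) {x y : StepSpace D j}
    (hx : x ∈ stepCone D j) (hy : y ∈ stepCone D j) :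
    ψ (pathLift j x) - ψ (pathLift j y) ≤ a * StepSpace.normL1 (x - y) + b * ‖x - y‖ := by
  have hψ := h.bound _ (pathLift_mem_pathCone hx) _ (pathLift_mem_pathCone hy)
  rwa [← pathLift_sub, pathNormL1_pathLift, norm_pathLift] at hψ

theorem IsApproximateSolution.sub_le (hH : Continuous H) (hf : IsApproximateSolution H ψ j f)
    {a b : ℝ} (h : IncrementBound ψ a b) {t : ℝ} (ht : 0 ≤ t) {x y : StepSpace D j}
    (hx : x ∈ stepCone D j) (hy : y ∈ stepCone D j) :
    f t x - f t y ≤ a * StepSpace.normL1 (x - y) + b * ‖x - y‖ := by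
  obtain ⟨M, hM, hgrowth⟩ := hf.inClass.exists_growth
  have hcomp := hf.solution.sub_le_of_initial (isSolidCone_stepCone D j).isClosed
    (hH.comp (continuous_pathLift j))
    (StepSpace.isSmoothable_norms h.left_nonneg h.right_nonneg) hM hM
    (fun x hx y hy => by
      rw [hf.initial x hx, hf.initial y hy]
      exact h.sub_pathLift_le hx hy)
    (fun t ht x hx => by linarith [(abs_le.1 (hgrowth t ht x hx)).2])
    (fun t ht x hx => by linarith [(abs_le.1 (hgrowth t ht x hx)).1])
    ht le_rfl hx hy
  rwa [add_zero, mul_zero, add_zero] at hcomp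

theorem IsApproximateSolution.sub_le_mul_norm (hH : Continuous H)
    (hf : IsApproximateSolution H ψ j f) {L : ℝ} (hL : IncrementBound ψ 0 L) {t : ℝ} (ht : 0 ≤ t)
    {x y : StepSpace D j} (hx : x ∈ stepCone D j) (hy : y ∈ stepCone D j) :
    f t x - f t y ≤ L * ‖x - y‖ := by
  simpa only [zero_mul, zero_add] using hf.sub_le hH hL ht hx hy

/-- The counterpart of `gradSet` for step paths; it is compact, which `gradSet` need not be. -/
def stepGradSet (ψ : PathSpace D → ℝ) (j : UnitPartition) : Set (StepSpace D j) :=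
  {q | q ∈ stepCone D j ∧ ∀ a b, IncrementBound ψ a b →
    ∀ z, inner ℝ q z ≤ a * StepSpace.normL1 z + b * ‖z‖}

theorem pathLift_mem_gradSet {q : StepSpace D j} (hq : q ∈ stepGradSet ψ j) :
    pathLift j q ∈ gradSet ψ := by
  refine ⟨pathLift_mem_pathCone hq.1, fun a b h z => ?_⟩
  have ha := h.left_nonneg
  have hb := h.right_nonneg
  rw [inner_pathLift]
  refine (hq.2 a b h _).trans ?_
  gcongr
  · exact normL1_pathProj_le j z
  · exact norm_pathProj_le j z

theorem isCompact_stepGradSet {L : ℝ} (hL : IncrementBound ψ 0 L) (j : UnitPartition) :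
    IsCompact (stepGradSet ψ j) := by
  refine (isCompact_closedBall (0 : StepSpace D j) L).of_isClosed_subset ?_ fun q hq => ?_
  · have heq : stepGradSet ψ j = stepCone D j ∩ ⋂ a, ⋂ b, ⋂ (_ : IncrementBound ψ a b), ⋂ z,
        {q : StepSpace D j | inner ℝ q z ≤ a * StepSpace.normL1 z + b * ‖z‖} := by
      ext q
      simp only [stepGradSet, mem_inter_iff, mem_iInter]
      rfl
    rw [heq]
    exact (isSolidCone_stepCone D j).isClosed.inter <| isClosed_iInter fun a =>
      isClosed_iInter fun b => isClosed_iInter fun _ => isClosed_iInter fun z =>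
        isClosed_le (by fun_prop) continuous_const
  · rw [mem_closedBall_zero_iff, ← norm_pathLift]
    exact norm_le_of_mem_gradSet hL (pathLift_mem_gradSet hq)

theorem IsApproximateSolution.mem_stepGradSet_of_mem_superjet (hH : Continuous H)
    (hf : IsApproximateSolution H ψ j f) {z q : ℝ × StepSpace D j} (ht : 0 < z.1)
    (hx : z.2 ∈ interior (stepCone D j)) (hq : q ∈ superjet (stepCone D j) f z) :
    q.2 ∈ stepGradSet ψ j := by
  have hxA := interior_subset hx
  refine ⟨mem_stepCone_of_dual fun v hv => ?_, fun a b h v => ?_⟩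
  · refine neg_nonpos.1 (neg_inner_le_of_mem_superjet ht hx hq fun ε hε hmem => ?_)
    have hincr := hf.inClass.increasing z.1 ht.le _ hmem _ hxA (by
      rw [add_sub_cancel_left]
      exact smul_mem_dualCone hε.le hv)
    linarith
  · have hle := neg_inner_le_of_mem_superjet (v := -v)
      (m := a * StepSpace.normL1 v + b * ‖v‖) ht hx hq fun ε hε hmem => by
        have hsub := hf.sub_le hH h ht.le hxA hmem
        have hεv : z.2 - (z.2 + ε • -v) = ε • v := by rw [sub_add_cancel_left, smul_neg, neg_neg]
        rw [hεv, StepSpace.normL1_smul, norm_smul, Real.norm_eq_abs, abs_of_pos hε] at hsub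
        linarith
    rwa [inner_neg_right, neg_neg] at hle

theorem IsApproximateSolution.neg_mem_stepGradSet_of_mem_superjet_neg (hH : Continuous H)
    (hf : IsApproximateSolution H ψ j f) {z q : ℝ × StepSpace D j} (ht : 0 < z.1)
    (hx : z.2 ∈ interior (stepCone D j)) (hq : q ∈ superjet (stepCone D j) (-f) z) :
    -q.2 ∈ stepGradSet ψ j := by
  have hxA := interior_subset hx
  refine ⟨mem_stepCone_of_dual fun v hv => ?_, fun a b h v => ?_⟩
  · have hle := neg_inner_le_of_mem_superjet (v := -v) (m := 0) ht hx hq fun ε hε hmem => by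
      have hincr := hf.inClass.increasing z.1 ht.le _ hxA _ hmem (by
        rw [sub_add_cancel_left, smul_neg, neg_neg]
        exact smul_mem_dualCone hε.le hv)
      simp only [Pi.neg_apply]
      linarith
    rw [inner_neg_right] at hle
    rw [inner_neg_left]
    linarith
  · rw [inner_neg_left]
    refine neg_inner_le_of_mem_superjet ht hx hq fun ε hε hmem => ?_
    have hsub := hf.sub_le hH h ht.le hmem hxA
    rw [add_sub_cancel_left, StepSpace.normL1_smul, norm_smul, Real.norm_eq_abs,
      abs_of_pos hε] at hsub
    simp only [Pi.neg_apply]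
    linarith

theorem IsApproximateSolution.exists_le_of_mem_superjet (hH : Continuous H)
    (hf : IsApproximateSolution H ψ j f) {L : ℝ} (hL : IncrementBound ψ 0 L)
    {z q : ℝ × StepSpace D j} (hz : z ∈ Ioi (0 : ℝ) ×ˢ stepCone D j)
    (hq : q ∈ superjet (stepCone D j) f z) :
    ∃ Q ∈ stepGradSet ψ j, q.2 - Q ∈ dualCone (stepCone D j) ∧ q.1 ≤ H (pathLift j Q) :=
  (isSolidCone_stepCone D j).exists_le_of_mem_superjet (hH.comp (continuous_pathLift j))
    hf.solution.1 (isCompact_stepGradSet hL j)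
    (fun _ ht hx _ hq => hf.mem_stepGradSet_of_mem_superjet hH ht hx hq) hz hq

theorem IsApproximateSolution.exists_ge_of_mem_subjet (hH : Continuous H)
    (hf : IsApproximateSolution H ψ j f) {L : ℝ} (hL : IncrementBound ψ 0 L)
    {z q : ℝ × StepSpace D j} (hz : z ∈ Ioi (0 : ℝ) ×ˢ stepCone D j)
    (hq : q ∈ subjet (stepCone D j) f z) :
    ∃ Q ∈ stepGradSet ψ j, Q - q.2 ∈ dualCone (stepCone D j) ∧ H (pathLift j Q) ≤ q.1 := by
  have hcont : Continuous fun x : StepSpace D j => H (pathLift j x) :=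
    hH.comp (continuous_pathLift j)
  obtain ⟨Q, hQ, hdual, hle⟩ := (isSolidCone_stepCone D j).exists_le_of_mem_superjet
    (hcont.comp continuous_neg).neg hf.solution.2.neg (isCompact_stepGradSet hL j).neg
    (fun _ ht hx _ hq => hf.neg_mem_stepGradSet_of_mem_superjet_neg hH ht hx hq) hz
    (neg_mem_superjet_neg hq)
  refine ⟨-Q, hQ, ?_, neg_le_neg_iff.1 hle⟩
  have hswap : (-q).2 - Q = -Q - q.2 := by rw [Prod.snd_neg]; abel
  rwa [hswap] at hdual

theorem IsApproximateSolution.continuousOn (hf : IsApproximateSolution H ψ j f) :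
    ContinuousOn (fun z : ℝ × StepSpace D j => f z.1 z.2) (Ici (0 : ℝ) ×ˢ stepCone D j) :=
  hf.solution.1.1

theorem IsApproximateSolution.abs_sub_initial_le (hH : Continuous H)
    (hf : IsApproximateSolution H ψ j f) {L M : ℝ} (hL : IncrementBound ψ 0 L)
    (hM : ∀ q ∈ gradSet ψ, |H q| ≤ M) {t : ℝ} (ht : 0 ≤ t) {x : StepSpace D j}
    (hx : x ∈ stepCone D j) : |f t x - f 0 x| ≤ M * t := by
  obtain ⟨M₀, hM₀, hgrowth⟩ := hf.inClass.exists_growth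
  have hclosed := (isSolidCone_stepCone D j).isClosed
  have hup : f t x ≤ f 0 x + M * t :=
    le_initial_add_mul hclosed hf.continuousOn hL.right_nonneg hM₀
      (fun x hx y hy => hf.sub_le_mul_norm hH hL le_rfl hx hy)
      (fun t ht x hx => by linarith [(abs_le.1 (hgrowth t ht x hx)).2])
      (fun z hz q hq => by
        obtain ⟨Q, hQ, -, hle⟩ := hf.exists_le_of_mem_superjet hH hL hz hq
        exact hle.trans (le_of_abs_le (hM _ (pathLift_mem_gradSet hQ)))) ht hx
  have hlow : (-f) t x ≤ (-f) 0 x + M * t :=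
    le_initial_add_mul hclosed hf.continuousOn.neg hL.right_nonneg hM₀
      (fun x hx y hy => by
        have hsub := hf.sub_le_mul_norm hH hL le_rfl hy hx
        rw [norm_sub_rev] at hsub
        simp only [Pi.neg_apply]
        linarith)
      (fun t ht x hx => by
        simp only [Pi.neg_apply]
        linarith [(abs_le.1 (hgrowth t ht x hx)).1])
      (fun z hz q hq => by
        have hq' := neg_mem_subjet_neg hq
        rw [neg_neg] at hq'
        obtain ⟨Q, hQ, -, hle⟩ := hf.exists_ge_of_mem_subjet hH hL hz hq'
        rw [Prod.fst_neg] at hle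
        linarith [neg_le_of_abs_le (hM _ (pathLift_mem_gradSet hQ))]) ht hx
  simp only [Pi.neg_apply] at hlow
  exact abs_le.2 ⟨by linarith, by linarith⟩

theorem IsApproximateSolution.abs_time_sub_le (hH : Continuous H)
    (hf : IsApproximateSolution H ψ j f) {L M : ℝ} (hL : IncrementBound ψ 0 L)
    (hM0 : 0 ≤ M) (hM : ∀ q ∈ gradSet ψ, |H q| ≤ M) {t h : ℝ} (ht : 0 ≤ t) (hh : 0 ≤ h)
    {x : StepSpace D j} (hx : x ∈ stepCone D j) : |f (t + h) x - f t x| ≤ M * h := by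
  have hclosed := (isSolidCone_stepCone D j).isClosed
  have hcont : Continuous fun x : StepSpace D j => H (pathLift j x) :=
    hH.comp (continuous_pathLift j)
  have hN : IsSmoothable fun x : StepSpace D j => 0 * StepSpace.normL1 x + L * ‖x‖ :=
    StepSpace.isSmoothable_norms le_rfl hL.right_nonneg
  have hgrowth : ∀ t, 0 ≤ t → ∀ x ∈ stepCone D j, |f t x - f 0 x| ≤ M * t := fun t ht x hx =>
    hf.abs_sub_initial_le hH hL hM ht hx
  have hup := hf.solution.sub_le_of_initial hclosed hcont hN hM0 hM0
    (fun x hx y hy => hf.sub_le hH hL le_rfl hx hy)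
    (fun t ht x hx => by linarith [(abs_le.1 (hgrowth t ht x hx)).2])
    (fun t ht x hx => by linarith [(abs_le.1 (hgrowth t ht x hx)).1]) ht hh hx hx
  have hlow := hf.solution.neg.sub_le_of_initial hclosed (hcont.comp continuous_neg).neg hN hM0 hM0
    (fun x hx y hy => by
      have hsub := hf.sub_le hH hL le_rfl hy hx
      rw [← neg_sub x y, StepSpace.normL1_neg, norm_neg] at hsub
      simp only [Pi.neg_apply]
      linarith)
    (fun t ht x hx => by
      simp only [Pi.neg_apply]
      linarith [(abs_le.1 (hgrowth t ht x hx)).1])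
    (fun t ht x hx => by
      simp only [Pi.neg_apply]
      linarith [(abs_le.1 (hgrowth t ht x hx)).2]) ht hh hx hx
  simp only [Pi.neg_apply, sub_self, StepSpace.normL1_zero, mul_zero, norm_zero, zero_add]
    at hup hlow
  exact abs_le.2 ⟨by linarith, by linarith⟩

end APriori

/-! ### Comparison of two levels of approximation -/

section Levels

variable {D : ℕ} {H ψ : PathSpace D → ℝ} {j j' : UnitPartition}

/-- The map `p_j l_{j'}` between step spaces. -/
noncomputable def relevel (D : ℕ) (j j' : UnitPartition) : StepSpace D j' →L[ℝ] StepSpace D j :=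
  LinearMap.toContinuousLinearMap ((projₗ D j).comp (liftₗᵢ D j').toLinearMap)

theorem relevel_apply (y : StepSpace D j') : relevel D j j' y = pathProj j (pathLift j' y) := rfl

theorem inner_pathProj_pathLift (x : StepSpace D j) (y : StepSpace D j') :
    inner ℝ (pathProj j' (pathLift j x)) y = inner ℝ x (relevel D j j' y) := by
  rw [relevel_apply, ← inner_pathLift, real_inner_comm, ← inner_pathLift,
    real_inner_comm (F := PathSpace D)]

theorem norm_relevel_le (y : StepSpace D j') : ‖relevel D j j' y‖ ≤ ‖y‖ :=
  (norm_pathProj_le j _).trans (norm_pathLift j' y).le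

theorem relevel_mem_stepCone {y : StepSpace D j'} (hy : y ∈ stepCone D j') :
    relevel D j j' y ∈ stepCone D j :=
  pathProj_mem_stepCone j (pathLift_mem_pathCone hy)

variable {u : ℝ → StepSpace D j → ℝ} {v : ℝ → StepSpace D j' → ℝ} {L κ Λ r : ℝ}

theorem IsApproximateSolution.le_of_mem_superjet_of_mem_subjet (hjj' : j ≤ j') (hH : Continuous H)
    (hHinc : ConeIncreasingOn (dualCone (pathCone D)) univ H) (hu : IsApproximateSolution H ψ j u)
    (hv : IsApproximateSolution H ψ j' v) (hL : IncrementBound ψ 0 L) (hΛ : 0 ≤ Λ)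
    (hHS : ∀ q ∈ gradSet ψ, ∀ ρ, ‖ρ‖ ≤ r → |H (q + ρ) - H q| ≤ Λ * ‖ρ‖)
    {z : ℝ × StepSpace D j} {w : ℝ × StepSpace D j'} (hz : z ∈ Ioi (0 : ℝ) ×ˢ stepCone D j)
    (hw : w ∈ Ioi (0 : ℝ) ×ˢ stepCone D j') {g : StepSpace D j} {ρ : StepSpace D j'} {a a' b : ℝ}
    (hρ : ‖ρ‖ ≤ b) (hb : b ≤ r) (ha : (a, g) ∈ superjet (stepCone D j) u z)
    (ha' : (a', pathProj j' (pathLift j g) - ρ) ∈ subjet (stepCone D j') v w) :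
    a ≤ a' + Λ * b := by
  obtain ⟨Q, hQ, hdual, haQ⟩ := hu.exists_le_of_mem_superjet hH hL hz ha
  have hva := hv.solution.2.le_of_mem_subjet hw ha'
  rw [pathLift_sub, pathLift_eq_of_le hjj'] at hva
  have hρb : ‖-pathLift j' ρ‖ ≤ b := by rwa [norm_neg (E := PathSpace D), norm_pathLift]
  have hperturb := neg_le_of_abs_le (hHS _ (pathLift_mem_gradSet hQ) _ (hρb.trans hb))
  have hincr : H (pathLift j Q + -pathLift j' ρ) ≤ H (pathLift j g - pathLift j' ρ) := by
    refine hHinc _ (mem_univ _) _ (mem_univ _) ?_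
    rw [← sub_eq_add_neg, sub_sub_sub_cancel_right, ← pathLift_sub]
    exact pathLift_mem_dualCone hdual
  linarith [mul_le_mul_of_nonneg_left hρb hΛ]

theorem IsApproximateSolution.le_of_mem_superjet_neg_of_mem_subjet_neg (hjj' : j ≤ j')
    (hH : Continuous H) (hHinc : ConeIncreasingOn (dualCone (pathCone D)) univ H)
    (hu : IsApproximateSolution H ψ j u) (hv : IsApproximateSolution H ψ j' v)
    (hL : IncrementBound ψ 0 L) (hΛ : 0 ≤ Λ)
    (hHS : ∀ q ∈ gradSet ψ, ∀ ρ, ‖ρ‖ ≤ r → |H (q + ρ) - H q| ≤ Λ * ‖ρ‖)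
    {z : ℝ × StepSpace D j} {w : ℝ × StepSpace D j'} (hz : z ∈ Ioi (0 : ℝ) ×ˢ stepCone D j)
    (hw : w ∈ Ioi (0 : ℝ) ×ˢ stepCone D j') {g : StepSpace D j} {ρ : StepSpace D j'} {a a' b : ℝ}
    (hρ : ‖ρ‖ ≤ b) (hb : b ≤ r) (ha : (a, g) ∈ superjet (stepCone D j) (-u) z)
    (ha' : (a', pathProj j' (pathLift j g) - ρ) ∈ subjet (stepCone D j') (-v) w) :
    a ≤ a' + Λ * b := by
  have hau := neg_mem_subjet_neg ha
  have hav := neg_mem_superjet_neg ha'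
  rw [neg_neg] at hau hav
  obtain ⟨Q, hQ, hdual, haQ⟩ := hu.exists_ge_of_mem_subjet hH hL hz hau
  have hva := hv.solution.1.le_of_mem_superjet hw hav
  simp only [Prod.neg_mk, sub_neg_eq_add, neg_sub, pathLift_sub, pathLift_eq_of_le hjj']
    at hdual haQ hva
  have hρb : ‖pathLift j' ρ‖ ≤ b := by rwa [norm_pathLift]
  have hperturb := le_of_abs_le (hHS _ (pathLift_mem_gradSet hQ) _ (hρb.trans hb))
  have hincr : H (pathLift j' ρ - pathLift j g) ≤ H (pathLift j Q + pathLift j' ρ) := by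
    refine hHinc _ (mem_univ _) _ (mem_univ _) ?_
    have hsum : pathLift j Q + pathLift j' ρ - (pathLift j' ρ - pathLift j g) =
        pathLift j (Q + g) := by rw [pathLift_add]; abel
    rw [hsum]
    exact pathLift_mem_dualCone hdual
  linarith [mul_le_mul_of_nonneg_left hρb hΛ]

theorem IsApproximateSolution.exists_abs_sub_le_growth (hu : IsApproximateSolution H ψ j u)
    (hv : IsApproximateSolution H ψ j' v) (hL : IncrementBound ψ 0 L)
    (hψκ : ∀ μ ∈ pathCone D, |ψ (pathLift j (pathProj j μ)) - ψ μ| ≤ κ * ‖μ‖) :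
    ∃ M M' : ℝ, 0 ≤ M ∧ 0 ≤ M' ∧ ∀ t, 0 ≤ t → ∀ x ∈ stepCone D j, ∀ s, 0 ≤ s →
      ∀ y ∈ stepCone D j',
        |u t x - v s y| ≤ L * ‖x - relevel D j j' y‖ + κ * ‖y‖ + M * t + M' * s := by
  obtain ⟨M, hM, hMu⟩ := hu.inClass.exists_growth
  obtain ⟨M', hM', hMv⟩ := hv.inClass.exists_growth
  refine ⟨M, M', hM, hM', fun t ht x hx s hs y hy => ?_⟩
  have hy' := relevel_mem_stepCone (j := j) hy
  have hxy := hL.sub_pathLift_le hx hy'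
  have hyx := hL.sub_pathLift_le hy' hx
  rw [norm_sub_rev] at hyx
  have hψy := hψκ _ (pathLift_mem_pathCone hy)
  rw [norm_pathLift, ← relevel_apply, ← hv.initial y hy] at hψy
  rw [← hu.initial x hx] at hxy hyx
  have hut := abs_le.1 (hMu t ht x hx)
  have hvs := abs_le.1 (hMv s hs y hy)
  rw [abs_le] at hψy ⊢
  constructor <;> linarith [hut.1, hut.2, hvs.1, hvs.2, hψy.1, hψy.2]

theorem IsApproximateSolution.abs_sub_le_of_levels (hjj' : j ≤ j') (hH : Continuous H)
    (hHinc : ConeIncreasingOn (dualCone (pathCone D)) univ H)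
    (hu : IsApproximateSolution H ψ j u) (hv : IsApproximateSolution H ψ j' v)
    (hL : IncrementBound ψ 0 L) (hκ : 0 ≤ κ) (hΛ : 0 ≤ Λ)
    (hHS : ∀ q ∈ gradSet ψ, ∀ ρ, ‖ρ‖ ≤ r → |H (q + ρ) - H q| ≤ Λ * ‖ρ‖) (hκr : κ < r)
    (hψκ : ∀ μ ∈ pathCone D, |ψ (pathLift j (pathProj j μ)) - ψ μ| ≤ κ * ‖μ‖)
    {t : ℝ} (ht : 0 ≤ t) {y : StepSpace D j'} (hy : y ∈ stepCone D j') :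
    |u t (pathProj j (pathLift j' y)) - v t y| ≤ κ * ‖y‖ + Λ * κ * t := by
  obtain ⟨M, M', hM, hM', hgrowth⟩ := hu.exists_abs_sub_le_growth hv hL hψκ
  have hclosed := (isSolidCone_stepCone D j).isClosed
  have hclosed' := (isSolidCone_stepCone D j').isClosed
  have hup := sub_le_of_link hclosed hclosed' hu.continuousOn hv.continuousOn (relevel D j j') _
    inner_pathProj_pathLift norm_relevel_le (fun _ => relevel_mem_stepCone) hL.right_nonneg hκ hΛ
    hM hM' hκr (fun t ht x hx s hs y hy => le_of_abs_le (hgrowth t ht x hx s hs y hy))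
    (fun t ht x hx s hs y hy g ρ a a' b hρ hb ha ha' =>
      hu.le_of_mem_superjet_of_mem_subjet hjj' hH hHinc hv hL hΛ hHS (z := (t, x)) (w := (s, y))
        ⟨ht, hx⟩ ⟨hs, hy⟩ hρ hb ha ha') ht hy
  have hlow := sub_le_of_link hclosed hclosed' (u := -u) (v := -v) hu.continuousOn.neg
    hv.continuousOn.neg (relevel D j j') _ inner_pathProj_pathLift norm_relevel_le
    (fun _ => relevel_mem_stepCone) hL.right_nonneg hκ hΛ hM hM' hκr
    (fun t ht x hx s hs y hy => by
      simp only [Pi.neg_apply]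
      linarith [neg_le_of_abs_le (hgrowth t ht x hx s hs y hy)])
    (fun t ht x hx s hs y hy g ρ a a' b hρ hb ha ha' =>
      hu.le_of_mem_superjet_neg_of_mem_subjet_neg hjj' hH hHinc hv hL hΛ hHS (z := (t, x))
        (w := (s, y)) ⟨ht, hx⟩ ⟨hs, hy⟩ hρ hb ha ha') ht hy
  simp only [Pi.neg_apply, relevel_apply] at hup hlow
  exact abs_le.2 ⟨by linarith, hup⟩

end Levels

/-! ### Best Lipschitz constants -/

section LipConst

variable {X : Type*}

theorem lipConst_le [PseudoMetricSpace X] {A : Set X} {g : X → ℝ} {c : ℝ}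
    (h : ∀ x ∈ A, ∀ y ∈ A, |g x - g y| ≤ c * dist x y) : lipConst A g ≤ ENNReal.ofReal c := by
  refine iSup₂_le fun x hx => iSup₂_le fun y hy => ENNReal.div_le_of_le_mul ?_
  rw [edist_dist, edist_dist, ← ENNReal.ofReal_mul' dist_nonneg, Real.dist_eq]
  exact ENNReal.ofReal_le_ofReal (h x hx y hy)

theorem edist_le_lipConst_mul [MetricSpace X] {A : Set X} (g : X → ℝ) {x y : X} (hx : x ∈ A)
    (hy : y ∈ A) : edist (g x) (g y) ≤ lipConst A g * edist x y := by
  rcases eq_or_ne x y with rfl | hxy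
  · simp only [edist_self, mul_zero, le_refl]
  · rw [← ENNReal.div_le_iff (edist_pos.2 hxy).ne' (edist_ne_top x y)]
    exact le_iSup₂_of_le x hx (le_iSup₂_of_le y hy le_rfl)

theorem abs_sub_le_lipConst_mul [MetricSpace X] {A : Set X} {g : X → ℝ} (hg : lipConst A g ≠ ∞)
    {x y : X} (hx : x ∈ A) (hy : y ∈ A) : |g x - g y| ≤ (lipConst A g).toReal * dist x y := by
  have h := ENNReal.toReal_mono (ENNReal.mul_ne_top hg (edist_ne_top x y))
    (edist_le_lipConst_mul g hx hy)
  rwa [ENNReal.toReal_mul, ← dist_edist, ← dist_edist, Real.dist_eq] at h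

end LipConst

/-! ### Good collections of partitions -/

namespace UnitPartition

-- The sets containing both or none of `z` and `w` form a σ-algebra, which misses `{z}ᶜ`.
theorem IsGenerating.exists_cell_separating {J : Set UnitPartition} (hJ : IsGenerating J)
    {z w : Ico (0 : ℝ) 1} (hzw : z ≠ w) :
    ∃ j ∈ J, ∃ k, ¬((z : ℝ) ∈ j.cell k ↔ (w : ℝ) ∈ j.cell k) := by
  by_contra! hcell
  let m : MeasurableSpace (Ico (0 : ℝ) 1) :=
    { MeasurableSet' := fun s => z ∈ s ↔ w ∈ s
      measurableSet_empty := Iff.rfl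
      measurableSet_compl := fun _ hs => not_congr hs
      measurableSet_iUnion := fun _ hs => by simp only [mem_iUnion, hs] }
  have hle : ⨆ j ∈ J, j.sigmaAlgebra ≤ m := iSup₂_le fun j hj =>
    MeasurableSpace.generateFrom_le <| by
      rintro _ ⟨k, rfl⟩
      exact hcell j hj k
  rw [hJ.2] at hle
  have hmeas : z ∈ ({z}ᶜ : Set (Ico (0 : ℝ) 1)) ↔ w ∈ ({z}ᶜ : Set (Ico (0 : ℝ) 1)) :=
    hle _ (MeasurableSpace.measurableSet_generateFrom (isOpen_compl_singleton (x := z)))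
  exact hmeas.2 hzw.symm rfl

theorem IsUniform.mem_cell_zero {j : UnitPartition} (hj : j.IsUniform) {s : ℝ} (hs : 0 ≤ s)
    (hs' : s < (j.n : ℝ)⁻¹) : s ∈ j.cell ⟨0, j.n_pos⟩ := by
  have hlen := hj.len_eq ⟨0, j.n_pos⟩
  have hzero : j.t (Fin.castSucc ⟨0, j.n_pos⟩) = 0 := j.zero
  rw [len, hzero, sub_zero] at hlen
  exact ⟨hzero.trans_le hs, hs'.trans_eq hlen.symm⟩

theorem mem_cell_iff_of_mem {j : UnitPartition} {k l : Fin j.n} {s : ℝ} (hs : s ∈ j.cell l) :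
    s ∈ j.cell k ↔ k = l :=
  ⟨fun h => j.eq_of_mem_cell h hs, fun h => h ▸ hs⟩

theorem IsGood.exists_n_ge {J : Set UnitPartition} (hJ : IsGood J) (N : ℕ) :
    ∃ j ∈ J, N ≤ j.n := by
  have hN : (0 : ℝ) < N + 2 := by positivity
  have hw : ((N : ℝ) + 2)⁻¹ ∈ Ico (0 : ℝ) 1 := ⟨by positivity, inv_lt_one_of_one_lt₀ (by linarith)⟩
  obtain ⟨j, hj, k, hk⟩ := hJ.2.exists_cell_separating
    (z := ⟨0, left_mem_Ico.2 one_pos⟩) (w := ⟨_, hw⟩)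
    (fun h => (inv_pos.2 hN).ne (congrArg Subtype.val h))
  refine ⟨j, hj, not_lt.1 fun hlt => hk ?_⟩
  have hn : (0 : ℝ) < j.n := by exact_mod_cast j.n_pos
  have hnN : (j.n : ℝ) < N := by exact_mod_cast hlt
  rw [mem_cell_iff_of_mem ((hJ.1 j hj).mem_cell_zero le_rfl (inv_pos.2 hn)),
    mem_cell_iff_of_mem ((hJ.1 j hj).mem_cell_zero hw.1 (inv_strictAnti₀ hn (by linarith)))]

theorem IsGood.nonempty {J : Set UnitPartition} (hJ : IsGood J) : J.Nonempty :=
  let ⟨j, hj, _⟩ := hJ.exists_n_ge 0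
  ⟨j, hj⟩

/-- The rate `|j|^{-(2-p)/(2p)}` at which the approximations converge. -/
noncomputable def rate (p : ℝ) (j : UnitPartition) : ℝ := (j.n : ℝ) ^ (-((2 - p) / (2 * p)))

theorem rate_nonneg (p : ℝ) (j : UnitPartition) : 0 ≤ j.rate p :=
  Real.rpow_nonneg (Nat.cast_nonneg _) _

theorem IsGood.exists_mul_rate_le {J : Set UnitPartition} (hJ : IsGood J) {p : ℝ} (hp0 : 0 < p)
    (hp2 : p < 2) (B : ℝ) {ε : ℝ} (hε : 0 < ε) : ∃ j₀ ∈ J, ∀ j, j₀ ≤ j → B * j.rate p ≤ ε := by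
  have hα : 0 < (2 - p) / (2 * p) := div_pos (by linarith) (by linarith)
  have hlim : Tendsto (fun n : ℕ => B * (n : ℝ) ^ (-((2 - p) / (2 * p)))) atTop (𝓝 0) := by
    simpa only [mul_zero, Function.comp_def] using
      ((tendsto_rpow_neg_atTop hα).comp tendsto_natCast_atTop_atTop).const_mul B
  obtain ⟨N, hN⟩ := eventually_atTop.1 (hlim.eventually_le_const hε)
  obtain ⟨j₀, hj₀, hn⟩ := hJ.exists_n_ge N
  exact ⟨j₀, hj₀, fun j hj => hN j.n (hn.trans (n_le_of_le hj))⟩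

theorem IsGood.le_of_forall_le_add_mul_rate {J : Set UnitPartition} (hJ : IsGood J) {p : ℝ}
    (hp0 : 0 < p) (hp2 : p < 2) {a b B : ℝ} (h : ∀ j ∈ J, a ≤ b + B * j.rate p) : a ≤ b := by
  refine le_of_forall_pos_le_add fun ε hε => ?_
  obtain ⟨j, hj, hjε⟩ := hJ.exists_mul_rate_le hp0 hp2 B hε
  exact (h j hj).trans (add_le_add_right (hjε j (Subset.refl (range j.t))) b)

end UnitPartition

/-! ### Initial conditions that are Lipschitz in `Lᵖ` -/

section Initial

variable {D : ℕ} {ψ : PathSpace D → ℝ} {p C : ℝ}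

/-- On increasing paths, `ψ` is Lipschitz with constant `C` for the `Lᵖ` norm. The norm is taken of
the pointwise difference of representatives. -/
def IsLpLipschitz (ψ : PathSpace D → ℝ) (p C : ℝ) : Prop :=
  ∀ μ ∈ pathCone D, ∀ ν ∈ pathCone D,
    |ψ μ - ψ ν| ≤ C * (eLpNorm (fun s => μ s - ν s) (ENNReal.ofReal p) unitMeasure).toReal

namespace IsLpLipschitz

theorem abs_sub_le_eLpNorm (hψ : IsLpLipschitz ψ p C) {μ ν : PathSpace D} (hμ : μ ∈ pathCone D)
    (hν : ν ∈ pathCone D) :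
    |ψ μ - ψ ν| ≤ C * (eLpNorm (μ - ν : PathSpace D) (ENNReal.ofReal p) unitMeasure).toReal := by
  rw [eLpNorm_congr_ae (Lp.coeFn_sub μ ν)]
  exact hψ μ hμ ν hν

theorem abs_sub_le_interpolation (hψ : IsLpLipschitz ψ p C) (hp1 : 1 ≤ p) (hp2 : p ≤ 2)
    (hC : 0 ≤ C) {μ ν : PathSpace D} (hμ : μ ∈ pathCone D) (hν : ν ∈ pathCone D) :
    |ψ μ - ψ ν| ≤ C * (pathNormL1 (μ - ν) ^ ((2 - p) / p) * ‖μ - ν‖ ^ (1 - (2 - p) / p)) :=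
  (hψ.abs_sub_le_eLpNorm hμ hν).trans (mul_le_mul_of_nonneg_left (toReal_eLpNorm_le _ hp1 hp2) hC)

theorem lipConst_ne_top (hψ : IsLpLipschitz ψ p C) (hp2 : p ≤ 2) (hC : 0 ≤ C) :
    lipConst (pathCone D) ψ ≠ ∞ := by
  refine ne_top_of_le_ne_top ENNReal.ofReal_ne_top (lipConst_le (c := C) fun μ hμ ν hν => ?_)
  rw [dist_eq_norm (E := PathSpace D)]
  exact (hψ.abs_sub_le_eLpNorm hμ hν).trans
    (mul_le_mul_of_nonneg_left (toReal_eLpNorm_le_norm _ hp2) hC)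

theorem totallyBounded_gradSet (hψ : IsLpLipschitz ψ p C) (hp1 : 1 ≤ p) (hp2 : p < 2) (hC : 0 < C)
    {L : ℝ} (hL : IncrementBound ψ 0 L) : TotallyBounded (gradSet ψ) := by
  have hp0 : 0 < p := by linarith
  refine _root_.totallyBounded_gradSet hL fun b hb => exists_incrementBound hC
    (θ := (2 - p) / p) (div_pos (by linarith) hp0) ((div_le_one hp0).2 (by linarith))
    (fun μ hμ ν hν => ?_) hb
  exact (le_abs_self _).trans (hψ.abs_sub_le_interpolation hp1 hp2.le hC.le hμ hν)

end IsLpLipschitz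

theorem incrementBound_lipConst (hfin : lipConst (pathCone D) ψ ≠ ∞) :
    IncrementBound ψ 0 (lipConst (pathCone D) ψ).toReal := by
  refine ⟨le_rfl, ENNReal.toReal_nonneg, fun μ hμ ν hν => ?_⟩
  rw [zero_mul, zero_add, ← dist_eq_norm (E := PathSpace D)]
  exact (le_abs_self _).trans (abs_sub_le_lipConst_mul hfin hμ hν)

/-- The constant in the error made when an increasing path is averaged in the argument of an
`Lᵖ`-Lipschitz function. -/
noncomputable def initialConst (D : ℕ) (p C : ℝ) : ℝ :=
  C * (approxConst D ^ ((2 - p) / p) * 2 ^ (1 - (2 - p) / p))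

theorem initialConst_nonneg (D : ℕ) (p : ℝ) (hC : 0 ≤ C) : 0 ≤ initialConst D p C :=
  mul_nonneg hC (mul_nonneg (Real.rpow_nonneg (approxConst_nonneg D) _)
    (Real.rpow_nonneg zero_le_two _))

theorem UnitPartition.inv_sqrt_rpow_eq_rate (hp : p ≠ 0) (j : UnitPartition) :
    (√(j.n : ℝ))⁻¹ ^ ((2 - p) / p) = j.rate p := by
  have hn : (0 : ℝ) ≤ j.n := Nat.cast_nonneg _
  rw [rate, Real.sqrt_eq_rpow, ← Real.rpow_neg hn, ← Real.rpow_mul hn]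
  congr 1
  field_simp

theorem mul_rpow_mul_mul_rpow_one_sub {a b m θ : ℝ} (ha : 0 ≤ a) (hb : 0 ≤ b) (hm : 0 ≤ m)
    (hθ : 0 ≤ θ) (hθ1 : θ ≤ 1) : (a * m) ^ θ * (b * m) ^ (1 - θ) = a ^ θ * b ^ (1 - θ) * m := by
  rw [Real.mul_rpow ha hm, Real.mul_rpow hb hm, mul_mul_mul_comm,
    ← Real.rpow_add_of_nonneg hm hθ (sub_nonneg.2 hθ1), add_sub_cancel, Real.rpow_one]

theorem IsLpLipschitz.abs_average_sub_le (hψ : IsLpLipschitz ψ p C) (hp1 : 1 ≤ p) (hp2 : p ≤ 2)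
    (hC : 0 ≤ C) {j : UnitPartition} (hj : j.IsUniform) {μ : PathSpace D} (hμ : μ ∈ pathCone D) :
    |ψ (pathLift j (pathProj j μ)) - ψ μ| ≤ initialConst D p C * j.rate p * ‖μ‖ := by
  have hp0 : 0 < p := by linarith
  have hθ : 0 ≤ (2 - p) / p := div_nonneg (by linarith) hp0.le
  have hθ1 : (2 - p) / p ≤ 1 := (div_le_one hp0).2 (by linarith)
  have hc := approxConst_nonneg D
  have hμ0 : 0 ≤ ‖μ‖ := norm_nonneg μ
  rw [abs_sub_comm]
  calc |ψ μ - ψ (pathLift j (pathProj j μ))|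
      ≤ C * (pathNormL1 (μ - pathLift j (pathProj j μ)) ^ ((2 - p) / p) *
          ‖μ - pathLift j (pathProj j μ)‖ ^ (1 - (2 - p) / p)) :=
        hψ.abs_sub_le_interpolation hp1 hp2 hC hμ
          (pathLift_mem_pathCone (pathProj_mem_stepCone j hμ))
    _ ≤ C * ((approxConst D * (√(j.n : ℝ))⁻¹ * ‖μ‖) ^ ((2 - p) / p) *
          (2 * ‖μ‖) ^ (1 - (2 - p) / p)) := by
        have hL1 := Real.rpow_le_rpow (pathNormL1_nonneg _) (pathNormL1_sub_le hj hμ) hθ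
        have hL2 := Real.rpow_le_rpow (norm_nonneg (μ - pathLift j (pathProj j μ)))
          (norm_sub_pathLift_pathProj_le j μ) (sub_nonneg.2 hθ1)
        exact mul_le_mul_of_nonneg_left (mul_le_mul hL1 hL2
          (Real.rpow_nonneg (norm_nonneg (μ - pathLift j (pathProj j μ))) _)
          (Real.rpow_nonneg (by positivity) _)) hC
    _ = initialConst D p C * j.rate p * ‖μ‖ := by
        rw [mul_rpow_mul_mul_rpow_one_sub (by positivity) zero_le_two hμ0 hθ hθ1,
          Real.mul_rpow hc (by positivity), j.inv_sqrt_rpow_eq_rate hp0.ne', initialConst]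
        ring

end Initial

/-! ### The limit of the approximations -/

section CompactBounds

variable {V : Type*} [NormedAddCommGroup V] [CompleteSpace V] {H : V → ℝ} {S : Set V}

theorem exists_abs_le_of_totallyBounded (hH : Continuous H) (hS : TotallyBounded S) :
    ∃ M ≥ 0, ∀ q ∈ S, |H q| ≤ M := by
  have hcompact := hS.closure.isCompact_of_isClosed isClosed_closure
  obtain ⟨M, hM⟩ := hcompact.exists_bound_of_continuousOn hH.continuousOn
  exact ⟨|M|, abs_nonneg M, fun q hq => (hM q (subset_closure hq)).trans (le_abs_self M)⟩

theorem exists_abs_add_sub_le_of_totallyBounded (hH : LocallyLipschitz H) (hS : TotallyBounded S) :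
    ∃ r > 0, ∃ Λ ≥ 0, ∀ q ∈ S, ∀ ρ, ‖ρ‖ ≤ r → |H (q + ρ) - H q| ≤ Λ * ‖ρ‖ := by
  have hcompact := hS.closure.isCompact_of_isClosed isClosed_closure
  obtain ⟨r, hr, Λ, hΛ, h⟩ := exists_abs_add_sub_le_of_isCompact hH hcompact
  exact ⟨r, hr, Λ, hΛ, fun q hq => h q (subset_closure hq)⟩

end CompactBounds

section Limit

variable {D : ℕ} {H ψ : PathSpace D → ℝ} {p C L K : ℝ}

theorem IsApproximateSolution.abs_sub_le_of_growth {j j' : UnitPartition}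
    {u : ℝ → StepSpace D j → ℝ} {v : ℝ → StepSpace D j' → ℝ} (hH : Continuous H)
    (hu : IsApproximateSolution H ψ j u) (hv : IsApproximateSolution H ψ j' v)
    (hL : IncrementBound ψ 0 L) {κ M : ℝ} (hM : ∀ q ∈ gradSet ψ, |H q| ≤ M)
    (hψκ : ∀ μ ∈ pathCone D, |ψ (pathLift j (pathProj j μ)) - ψ μ| ≤ κ * ‖μ‖)
    {t : ℝ} (ht : 0 ≤ t) {x : StepSpace D j'} (hx : x ∈ stepCone D j') :
    |u t (pathProj j (pathLift j' x)) - v t x| ≤ 2 * M * t + κ * ‖x‖ := by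
  have hxj := pathProj_mem_stepCone j (pathLift_mem_pathCone hx)
  have hut := hu.abs_sub_initial_le hH hL hM ht hxj
  have hvt := hv.abs_sub_initial_le hH hL hM ht hx
  have hinit := hψκ _ (pathLift_mem_pathCone hx)
  rw [hu.initial _ hxj] at hut
  rw [hv.initial _ hx] at hvt
  rw [norm_pathLift] at hinit
  rw [abs_le] at hut hvt hinit ⊢
  constructor <;> linarith

-- For `κ < r` compare the two levels; otherwise `2 M ≤ κ (2 M / r)` and growth in time is enough.
theorem IsApproximateSolution.abs_sub_le_of_average {j j' : UnitPartition} (hjj' : j ≤ j')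
    {u : ℝ → StepSpace D j → ℝ} {v : ℝ → StepSpace D j' → ℝ} (hH : Continuous H)
    (hHinc : ConeIncreasingOn (dualCone (pathCone D)) univ H)
    (hu : IsApproximateSolution H ψ j u) (hv : IsApproximateSolution H ψ j' v)
    (hL : IncrementBound ψ 0 L) {κ Λ M r : ℝ} (hκ : 0 ≤ κ) (hΛ : 0 ≤ Λ) (hM0 : 0 ≤ M) (hr : 0 < r)
    (hM : ∀ q ∈ gradSet ψ, |H q| ≤ M)
    (hHS : ∀ q ∈ gradSet ψ, ∀ ρ, ‖ρ‖ ≤ r → |H (q + ρ) - H q| ≤ Λ * ‖ρ‖)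
    (hψκ : ∀ μ ∈ pathCone D, |ψ (pathLift j (pathProj j μ)) - ψ μ| ≤ κ * ‖μ‖)
    {t : ℝ} (ht : 0 ≤ t) {x : StepSpace D j'} (hx : x ∈ stepCone D j') :
    |u t (pathProj j (pathLift j' x)) - v t x| ≤ κ * (1 + Λ + 2 * M / r) * (t + ‖x‖) := by
  rcases lt_or_ge κ r with hκr | hκr
  · calc _ ≤ κ * ‖x‖ + Λ * κ * t :=
          hu.abs_sub_le_of_levels hjj' hH hHinc hv hL hκ hΛ hHS hκr hψκ ht hx
      _ ≤ κ * ‖x‖ + Λ * κ * t + κ * (t + Λ * ‖x‖ + 2 * M / r * (t + ‖x‖)) :=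
          le_add_of_nonneg_right (by positivity)
      _ = κ * (1 + Λ + 2 * M / r) * (t + ‖x‖) := by ring
  · have hMκ : 2 * M ≤ κ * (2 * M / r) := by
      rw [mul_div_assoc', le_div_iff₀ hr, mul_comm κ]
      exact mul_le_mul_of_nonneg_left hκr (by positivity)
    calc _ ≤ 2 * M * t + κ * ‖x‖ := hu.abs_sub_le_of_growth hH hv hL hM hψκ ht hx
      _ ≤ κ * (2 * M / r) * t + κ * ‖x‖ := by gcongr
      _ ≤ κ * (2 * M / r) * t + κ * ‖x‖ + κ * ((1 + Λ) * t + (Λ + 2 * M / r) * ‖x‖) :=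
          le_add_of_nonneg_right (by positivity)
      _ = κ * (1 + Λ + 2 * M / r) * (t + ‖x‖) := by ring

theorem exists_levels_bound (hH : LocallyLipschitz H)
    (hHinc : ConeIncreasingOn (dualCone (pathCone D)) univ H) (hp1 : 1 ≤ p) (hp2 : p < 2)
    (hC : 0 < C) (hψ : IsLpLipschitz ψ p C) :
    ∃ K : ℝ, 0 ≤ K ∧ ∀ j j' : UnitPartition, j.IsUniform → j ≤ j' →
      ∀ (u : ℝ → StepSpace D j → ℝ) (v : ℝ → StepSpace D j' → ℝ),
      IsApproximateSolution H ψ j u → IsApproximateSolution H ψ j' v →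
      ∀ t, 0 ≤ t → ∀ x ∈ stepCone D j',
        |u t (pathProj j (pathLift j' x)) - v t x| ≤ K * j.rate p * (t + ‖x‖) := by
  have hL := incrementBound_lipConst (hψ.lipConst_ne_top hp2.le hC.le)
  have hS := hψ.totallyBounded_gradSet hp1 hp2 hC hL
  obtain ⟨r, hr, Λ, hΛ, hHS⟩ := exists_abs_add_sub_le_of_totallyBounded hH hS
  obtain ⟨M, hM0, hM⟩ := exists_abs_le_of_totallyBounded hH.continuous hS
  have hC₀ := initialConst_nonneg D p hC.le
  refine ⟨initialConst D p C * (1 + Λ + 2 * M / r), by positivity, ?_⟩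
  intro j j' hj hjj' u v hu hv t ht x hx
  rw [mul_right_comm (initialConst D p C)]
  exact hu.abs_sub_le_of_average hjj' hH.continuous hHinc hv hL
    (mul_nonneg hC₀ (j.rate_nonneg p)) hΛ hM0 hr hM hHS
    (fun μ hμ => hψ.abs_average_sub_le hp1 hp2.le hC.le hj hμ) ht hx

theorem exists_limit_of_directed {ι X : Type*} [LE ι] {J : Set ι} (hne : J.Nonempty)
    (hdir : ∀ j ∈ J, ∀ j' ∈ J, ∃ j'' ∈ J, j ≤ j'' ∧ j' ≤ j'') {S : Set X} {g e : ι → X → ℝ}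
    (h : ∀ j ∈ J, ∀ j' ∈ J, j ≤ j' → ∀ x ∈ S, |g j x - g j' x| ≤ e j x) :
    ∃ F : X → ℝ, ∀ j ∈ J, ∀ x ∈ S, |g j x - F x| ≤ e j x := by
  have : Nonempty J := hne.to_subtype
  have hcross : ∀ x ∈ S, ∀ i j : J, g i x - e i x ≤ g j x + e j x := by
    intro x hx i j
    obtain ⟨k, hk, hik, hjk⟩ := hdir i i.2 j j.2
    linarith [(abs_le.1 (h i i.2 k hk hik x hx)).2, (abs_le.1 (h j j.2 k hk hjk x hx)).1]
  refine ⟨fun x => ⨅ j : J, (g j x + e j x), fun i hi x hx => ?_⟩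
  have hbdd : BddBelow (range fun j : J => g j x + e j x) :=
    ⟨g i x - e i x, forall_mem_range.2 (hcross x hx ⟨i, hi⟩)⟩
  have hlower : g i x - e i x ≤ ⨅ j : J, (g j x + e j x) := le_ciInf (hcross x hx ⟨i, hi⟩)
  have hupper : ⨅ j : J, (g j x + e j x) ≤ g i x + e i x := ciInf_le hbdd ⟨i, hi⟩
  rw [abs_le]
  constructor <;> linarith

variable {J : Set UnitPartition} {f : (j : UnitPartition) → ℝ → StepSpace D j → ℝ}
  {F : ℝ → PathSpace D → ℝ}

/-- `F` is the limit of the lifts of the `f j`, `j ∈ J`, with an error at most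
`K |j|^{-(2-p)/(2p)} (t + ‖μ‖)` at the point `(t, μ)`. -/
def IsLimitAtRate (p K : ℝ) (J : Set UnitPartition)
    (f : (j : UnitPartition) → ℝ → StepSpace D j → ℝ) (F : ℝ → PathSpace D → ℝ) : Prop :=
  ∀ j ∈ J, ∀ t, 0 ≤ t → ∀ μ ∈ pathCone D,
    |f j t (pathProj j μ) - F t μ| ≤ K * j.rate p * (t + ‖μ‖)

theorem exists_isLimitAtRate (hJ : UnitPartition.IsGood J) (hK : 0 ≤ K)
    (h : ∀ j ∈ J, ∀ j' ∈ J, j ≤ j' → ∀ t, 0 ≤ t → ∀ x ∈ stepCone D j',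
      |f j t (pathProj j (pathLift j' x)) - f j' t x| ≤ K * j.rate p * (t + ‖x‖)) :
    ∃ F, IsLimitAtRate p K J f F := by
  obtain ⟨F, hF⟩ := exists_limit_of_directed (X := ℝ × PathSpace D) hJ.nonempty hJ.2.1
    (S := Ici (0 : ℝ) ×ˢ pathCone D) (g := fun j z => f j z.1 (pathProj j z.2))
    (e := fun j z => K * j.rate p * (z.1 + ‖z.2‖)) fun j hj j' hj' hjj' z hz => by
      have hlevels := h j hj j' hj' hjj' z.1 hz.1 _ (pathProj_mem_stepCone j' hz.2)
      rw [pathProj_pathLift_pathProj hjj'] at hlevels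
      exact hlevels.trans (mul_le_mul_of_nonneg_left
        (add_le_add le_rfl (norm_pathProj_le j' z.2)) (mul_nonneg hK (j.rate_nonneg p)))
  exact ⟨fun t μ => F (t, μ), fun j hj t ht μ hμ => hF j hj (t, μ) ⟨ht, hμ⟩⟩

namespace IsLimitAtRate

variable (hF : IsLimitAtRate p K J f F) (hJ : UnitPartition.IsGood J) (hp0 : 0 < p) (hp2 : p < 2)

include hF hJ hp0 hp2

theorem tendstoLocalUniform (hK : 0 ≤ K) :
    UnitPartition.TendstoLocalUniform J (Ici (0 : ℝ) ×ˢ pathCone D)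
      (fun j z => f j z.1 (pathProj j z.2)) (fun z => F z.1 z.2) := by
  rintro ⟨t₀, μ₀⟩ - r ε hε
  obtain ⟨j₀, hj₀, hrate⟩ := hJ.exists_mul_rate_le hp0 hp2 (K * (t₀ + r + (‖μ₀‖ + r))) hε
  refine ⟨j₀, hj₀, fun j hj hjj => ?_⟩
  rintro ⟨t, μ⟩ ⟨⟨ht, hμ⟩, hball⟩
  refine (hF j hj t ht μ hμ).trans (le_trans ?_ (hrate j hjj))
  rw [Metric.mem_closedBall, Prod.dist_eq, max_le_iff, Real.dist_eq,
    dist_eq_norm (E := PathSpace D)] at hball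
  have htr : t ≤ t₀ + r := by linarith [le_of_abs_le hball.1]
  have hμr : ‖μ‖ ≤ ‖μ₀‖ + r := by linarith [hball.2, norm_sub_norm_le μ μ₀]
  rw [mul_right_comm]
  exact mul_le_mul_of_nonneg_right (mul_le_mul_of_nonneg_left (add_le_add htr hμr) hK)
    (j.rate_nonneg p)

theorem initial (hf : ∀ j ∈ J, IsApproximateSolution H ψ j (f j)) (hp1 : 1 ≤ p) (hC : 0 ≤ C)
    (hψ : IsLpLipschitz ψ p C) {μ : PathSpace D} (hμ : μ ∈ pathCone D) : F 0 μ = ψ μ := by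
  have hzero : |F 0 μ - ψ μ| ≤ 0 := hJ.le_of_forall_le_add_mul_rate hp0 hp2
    (B := K * ‖μ‖ + initialConst D p C * ‖μ‖) fun j hj => by
      have hlim := hF j hj 0 le_rfl μ hμ
      have haverage := hψ.abs_average_sub_le hp1 hp2.le hC (hJ.1 j hj) hμ
      rw [(hf j hj).initial _ (pathProj_mem_stepCone j hμ)] at hlim
      rw [abs_le] at hlim haverage ⊢
      constructor <;> linarith
  exact sub_eq_zero.1 (abs_nonpos_iff.1 hzero)

variable (hf : ∀ j ∈ J, IsApproximateSolution H ψ j (f j)) (hH : Continuous H)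
  (hL : IncrementBound ψ 0 L)

include hf hH hL

theorem sub_le_mul_norm {t : ℝ} (ht : 0 ≤ t) {μ ν : PathSpace D} (hμ : μ ∈ pathCone D)
    (hν : ν ∈ pathCone D) : F t μ - F t ν ≤ L * ‖μ - ν‖ := by
  refine hJ.le_of_forall_le_add_mul_rate hp0 hp2 (B := K * (t + ‖μ‖) + K * (t + ‖ν‖))
    fun j hj => ?_
  have hFμ := neg_le_of_abs_le (hF j hj t ht μ hμ)
  have hFν := le_of_abs_le (hF j hj t ht ν hν)
  have hfj : f j t (pathProj j μ) - f j t (pathProj j ν) ≤ L * ‖μ - ν‖ := by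
    refine ((hf j hj).sub_le_mul_norm hH hL ht (pathProj_mem_stepCone j hμ)
      (pathProj_mem_stepCone j hν)).trans ?_
    rw [← pathProj_sub]
    exact mul_le_mul_of_nonneg_left (norm_pathProj_le j (μ - ν)) hL.right_nonneg
  linarith

theorem abs_sub_le_mul_dist {t : ℝ} (ht : 0 ≤ t) {μ ν : PathSpace D} (hμ : μ ∈ pathCone D)
    (hν : ν ∈ pathCone D) : |F t μ - F t ν| ≤ L * dist μ ν := by
  rw [abs_le', neg_sub]
  constructor
  · rw [dist_eq_norm (E := PathSpace D)]
    exact hF.sub_le_mul_norm hJ hp0 hp2 hf hH hL ht hμ hν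
  · rw [dist_eq_norm (E := PathSpace D), norm_sub_rev (E := PathSpace D)]
    exact hF.sub_le_mul_norm hJ hp0 hp2 hf hH hL ht hν hμ

variable {M : ℝ} (hM0 : 0 ≤ M) (hM : ∀ q ∈ gradSet ψ, |H q| ≤ M)

include hM0 hM

theorem abs_add_time_sub_le {t h : ℝ} (ht : 0 ≤ t) (hh : 0 ≤ h) {μ : PathSpace D}
    (hμ : μ ∈ pathCone D) : |F (t + h) μ - F t μ| ≤ M * h := by
  refine hJ.le_of_forall_le_add_mul_rate hp0 hp2 (B := K * (t + h + ‖μ‖) + K * (t + ‖μ‖))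
    fun j hj => ?_
  have hFth := hF j hj (t + h) (add_nonneg ht hh) μ hμ
  have hFt := hF j hj t ht μ hμ
  have hfj := (hf j hj).abs_time_sub_le hH hL hM0 hM ht hh (pathProj_mem_stepCone j hμ)
  rw [abs_le] at hFth hFt hfj ⊢
  constructor <;> linarith

theorem abs_time_sub_le_mul_dist {t s : ℝ} (ht : 0 ≤ t) (hs : 0 ≤ s) {μ : PathSpace D}
    (hμ : μ ∈ pathCone D) : |F t μ - F s μ| ≤ M * dist t s := by
  wlog hst : s ≤ t generalizing s t
  · rw [abs_sub_comm, dist_comm]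
    exact this hs ht (le_of_not_ge hst)
  have h := hF.abs_add_time_sub_le hJ hp0 hp2 hf hH hL hM0 hM hs (sub_nonneg.2 hst) hμ
  rwa [add_sub_cancel, ← abs_of_nonneg (sub_nonneg.2 hst), ← Real.dist_eq] at h

theorem lipschitzOnWith : LipschitzOnWith (M + L).toNNReal
    (fun z : ℝ × PathSpace D => F z.1 z.2) (Ici (0 : ℝ) ×ˢ pathCone D) := by
  refine LipschitzOnWith.of_dist_le_mul (α := ℝ × PathSpace D) (β := ℝ) ?_
  rintro ⟨t, μ⟩ ⟨ht, hμ⟩ ⟨s, ν⟩ ⟨hs, hν⟩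
  rw [Real.coe_toNNReal _ (add_nonneg hM0 hL.right_nonneg), Real.dist_eq, add_mul]
  calc |F t μ - F s ν| ≤ |F t μ - F s μ| + |F s μ - F s ν| := abs_sub_le _ _ _
    _ ≤ M * dist t s + L * dist μ ν := add_le_add
        (hF.abs_time_sub_le_mul_dist hJ hp0 hp2 hf hH hL hM0 hM ht hs hμ)
        (hF.abs_sub_le_mul_dist hJ hp0 hp2 hf hH hL hs hμ hν)
    _ ≤ _ := add_le_add (mul_le_mul_of_nonneg_left (le_max_left _ _) hM0)
        (mul_le_mul_of_nonneg_left (le_max_right _ _) hL.right_nonneg)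

end IsLimitAtRate

theorem IsLimitAtRate.iSup_lipConst_le (hF : IsLimitAtRate p K J f F)
    (hJ : UnitPartition.IsGood J) (hp0 : 0 < p) (hp2 : p < 2)
    (hf : ∀ j ∈ J, IsApproximateSolution H ψ j (f j)) (hH : Continuous H) :
    (⨆ t ∈ Ici (0 : ℝ), lipConst (pathCone D) (F t)) ≤ lipConst (pathCone D) ψ := by
  rcases eq_or_ne (lipConst (pathCone D) ψ) ∞ with htop | hfin
  · rw [htop]
    exact le_top
  · exact iSup₂_le fun t ht => (lipConst_le fun μ hμ ν hν => hF.abs_sub_le_mul_dist hJ hp0 hp2 hf hH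
      (incrementBound_lipConst hfin) ht hμ hν).trans_eq (ENNReal.ofReal_toReal hfin)

theorem abs_le_toReal_of_mem_gradSet (hfin : lipConst (pathCone D) ψ ≠ ∞) {S : ℝ≥0∞} (hS : S ≠ ∞)
    (hHS : ∀ ι : PathSpace D, ‖ι‖ₑ ≤ lipConst (pathCone D) ψ → ‖H ι‖ₑ ≤ S) {q : PathSpace D}
    (hq : q ∈ gradSet ψ) : |H q| ≤ S.toReal := by
  have hnorm : ‖q‖ₑ ≤ lipConst (pathCone D) ψ := by
    rw [← ofReal_norm (E := PathSpace D), ← ENNReal.ofReal_toReal hfin]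
    exact ENNReal.ofReal_le_ofReal (norm_le_of_mem_gradSet (incrementBound_lipConst hfin) hq)
  have h := ENNReal.toReal_mono hS (hHS q hnorm)
  rwa [toReal_enorm, Real.norm_eq_abs] at h

theorem IsLimitAtRate.iSup_lipConst_time_le (hF : IsLimitAtRate p K J f F)
    (hJ : UnitPartition.IsGood J) (hp0 : 0 < p) (hp2 : p < 2)
    (hf : ∀ j ∈ J, IsApproximateSolution H ψ j (f j)) (hH : Continuous H)
    (hfin : lipConst (pathCone D) ψ ≠ ∞) :
    (⨆ μ ∈ pathCone D, lipConst (Ici (0 : ℝ)) (fun t => F t μ)) ≤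
      ⨆ (ι : PathSpace D) (_ : ‖ι‖ₑ ≤ lipConst (pathCone D) ψ), ‖H ι‖ₑ := by
  set S := ⨆ (ι : PathSpace D) (_ : ‖ι‖ₑ ≤ lipConst (pathCone D) ψ), ‖H ι‖ₑ
  rcases eq_or_ne S ∞ with htop | hS
  · rw [htop]
    exact le_top
  · have hM : ∀ q ∈ gradSet ψ, |H q| ≤ S.toReal := fun q hq =>
      abs_le_toReal_of_mem_gradSet hfin hS (fun ι hι => le_iSup₂_of_le ι hι le_rfl) hq
    exact iSup₂_le fun μ hμ => (lipConst_le fun t ht s hs =>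
      hF.abs_time_sub_le_mul_dist hJ hp0 hp2 hf hH (incrementBound_lipConst hfin)
        ENNReal.toReal_nonneg hM ht hs hμ).trans_eq (ENNReal.ofReal_toReal hS)

end Limit

theorem propositionp (D : ℕ) (hD : 0 < D)
    (H : PathSpace D → ℝ) (hH : LocallyLipschitz H)
    (hHinc : ConeIncreasingOn (dualCone (pathCone D)) univ H)
    (ψ : PathSpace D → ℝ)
    (hψinc : ConeIncreasingOn (dualCone (pathCone D)) (pathCone D) ψ)
    (p C : ℝ) (hp1 : 1 ≤ p) (hp2 : p < 2) (hC : 0 < C)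
    (hψ : ∀ μ ∈ pathCone D, ∀ ν ∈ pathCone D,
      |ψ μ - ψ ν| ≤ C * (eLpNorm (fun s => μ s - ν s) (ENNReal.ofReal p) unitMeasure).toReal) :
    -- convergence along any good collection of partitions, and bounds for the limit
    (∀ J : Set UnitPartition, UnitPartition.IsGood J →
      ∀ f : (j : UnitPartition) → ℝ → StepSpace D j → ℝ,
      (∀ j ∈ J, IsApproximateSolution H ψ j (f j)) →
      ∃ F : ℝ → PathSpace D → ℝ,
        UnitPartition.TendstoLocalUniform J (Ici (0 : ℝ) ×ˢ pathCone D)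
          (fun j z => f j z.1 (pathProj j z.2)) (fun z => F z.1 z.2) ∧
        (∃ K : ℝ≥0, LipschitzOnWith K (fun z : ℝ × PathSpace D => F z.1 z.2)
          (Ici (0 : ℝ) ×ˢ pathCone D)) ∧
        (∀ μ ∈ pathCone D, F 0 μ = ψ μ) ∧
        (⨆ t ∈ Ici (0 : ℝ), lipConst (pathCone D) (F t)) ≤ lipConst (pathCone D) ψ ∧
        (⨆ μ ∈ pathCone D, lipConst (Ici (0 : ℝ)) (fun t => F t μ)) ≤
          ⨆ (ι : PathSpace D) (_ : ‖ι‖ₑ ≤ lipConst (pathCone D) ψ), ‖H ι‖ₑ) ∧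
    -- quantitative comparison of two approximations, with a constant independent of the partitions
    (∃ K : ℝ, ∀ j j' : UnitPartition, j.IsUniform → j'.IsUniform → j ≤ j' →
      ∀ (u : ℝ → StepSpace D j → ℝ) (v : ℝ → StepSpace D j' → ℝ),
      IsApproximateSolution H ψ j u → IsApproximateSolution H ψ j' v →
      ∀ t, 0 ≤ t → ∀ x ∈ stepCone D j',
        |u t (pathProj j (pathLift j' x)) - v t x| ≤
          K * (j.n : ℝ) ^ (-((2 - p) / (2 * p))) * (t + ‖x‖)) := by
  have hp0 : 0 < p := one_pos.trans_le hp1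
  have hfin := IsLpLipschitz.lipConst_ne_top hψ hp2.le hC.le
  have hL := incrementBound_lipConst hfin
  have hgrad := IsLpLipschitz.totallyBounded_gradSet hψ hp1 hp2 hC hL
  obtain ⟨M, hM0, hM⟩ := exists_abs_le_of_totallyBounded hH.continuous hgrad
  obtain ⟨K, hK, hlevels⟩ := exists_levels_bound hH hHinc hp1 hp2 hC hψ
  refine ⟨fun J hJ f hf => ?_, K, fun j j' hj _ => hlevels j j' hj⟩
  obtain ⟨F, hF⟩ := exists_isLimitAtRate hJ hK fun j hj j' hj' hjj' =>
    hlevels j j' (hJ.1 j hj) hjj' _ _ (hf j hj) (hf j' hj')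
  exact ⟨F, hF.tendstoLocalUniform hJ hp0 hp2 hK,
    ⟨_, hF.lipschitzOnWith hJ hp0 hp2 hf hH.continuous hL hM0 hM⟩,
    fun μ hμ => hF.initial hJ hp0 hp2 hf hp1 hC.le hψ hμ,
    hF.iSup_lipConst_le hJ hp0 hp2 hf hH.continuous,
    hF.iSup_lipConst_time_le hJ hp0 hp2 hf hH.continuous hfin⟩
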